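/- Let $M$ be a compact (Hausdorff, smooth, boundaryless) oriented $6$-manifold and let $\mathcal J_+(M)$ be the set of smooth almost complex structures on $M$ that induce the given orientation. Here $J$ induces the orientation if every basis of the form $v_1,Jv_1,v_2,Jv_2,v_3,Jv_3$ is positive. For $J\in\mathcal J_+(M)$, a *$J$-complex local coframing* on an open set $U\subset M$ is a triple $\alpha=(\alpha^1,\alpha^2,\alpha^3)$ of smooth complex-valued $1$-forms on $U$ that satisfy $\alpha^k(Jv)=i\,\alpha^k(v)$ and are $\mathbb C$-linearly independent at every point. Its *Nijenhuis matrix* $N(\alpha):U\to M_{3\times3}(\mathbb C)$ is defined by $$(d\alpha^i)^{0,2}=N_{i1}\,\overline{\alpha^2\wedge\alpha^3}+N_{i2}\,\overline{\alpha^3\wedge\alpha^1}+N_{i3}\,\overline{\alpha^1\wedge\alpha^2}\qquad(i=1,2,3),$$ where $(\cdot)^{0,2}$ denotes the $(0,2)$-part. Let $P$ be the symmetric trilinear form on $M_{3\times 3}(\mathbb C)$ with $P(a,a,a)=\det a$, and on $U$ put, with $N=N(\alpha)$, $$\Phi(J)=\tfrac i8\,|\det N|^2\,\alpha^1\wedge\alpha^2\wedge\alpha^3\wedge\overline{\alpha^1}\wedge\overline{\alpha^2}\wedge\overline{\alpha^3},\qquad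 \psi(J)=P(\overline N,\overline N,{}^tN)\,\alpha^1\wedge\alpha^2\wedge\alpha^3 .$$ **Theorem.** Let $c_1,c_2$ be (real or complex) constants. 1. (Well defined.) For every $J\in\mathcal J_+(M)$, local coframings exist near every point of $M$, each of them has a unique Nijenhuis matrix at each point of its domain, and the forms $\Phi(J)$ and $\psi(J)$ do not depend on the coframing, hence are defined globally on $M$. The integral $$F_c(J)=\int_M c_1\,\Phi(J)+c_2\,\tfrac i8\,\psi(J)\wedge\overline{\psi(J)}$$ exists, independently of the partition of unity used to compute it, and it is real if $c_1,c_2$ are real. 2. (Diffeomorphism invariance.) If $f:M\to M$ is a diffeomorphism and both $J$ and $f^*J$ lie in $\mathcal J_+(M)$, then $F_c(f^*J)=F_c(J)$. 3. (First order.) There is a function $L_c$, explicitly given by the formulas above, on the $1$-jets $(j,j')$ of endomorphism fields on $\mathbb R^6$, whose restriction to $\{j^2=-1\}$ is smooth, such that in every chart of the atlas, with coordinates $y$, one has $$c_1\Phi(J)+c_2\tfrac i8\psi(J)\wedge\overline{\psi(J)}=L_c\bigl(J(y),DJ(y)\bigr)\,dy^1\wedge\cdots\wedge dy^6$$ for all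 $J\in\mathcal J_+(M)$. Thus $F_c(J)$ is the integral over $M$ of $L_c(J,DJ)$. 4. (Class $L^6_1$.) Call a (not necessarily continuous) field $J$ of complex structures on the tangent spaces of $M$ that induces the orientation a *bounded $L^6_1$ almost complex structure* if in each chart it is essentially bounded on compact sets and has a weak first derivative $DJ$ that is in $L^6$ on compact sets. For each such $J$, the integral of $L_c(J,DJ)$ over $M$ converges absolutely and does not depend on the choice of the weak derivative or of the partition of unity. The resulting functional on bounded $L^6_1$ almost complex structures extends $F_c$. It is sequentially continuous in the following sense: if in each chart and on each compact set $J_n\to J$ and $DJ_n\to DJ$ in $L^6$, and the $J_n$ are essentially bounded uniformly in $n$, then the values at $J_n$ converge to the value at $J$. -/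

import Mathlib

open Set Filter MeasureTheory
open scoped Manifold ContDiff Topology

set_option maxSynthPendingDepth 3

noncomputable section

/-! ### Linear algebra at one point -/

section Pointwise

variable {V : Type*} [AddCommGroup V] [Module ℝ V] [TopologicalSpace V]

/-- The wedge product `θ 0 ∧ ⋯ ∧ θ (n - 1)` of complex-valued covectors:
its value on `v 0, …, v (n - 1)` is `det (θ j (v i))`. -/
def wedgeCovectors {n : ℕ} (θ : Fin n → V →L[ℝ] ℂ) : V [⋀^Fin n]→ₗ[ℝ] ℂ where
  toFun v := Matrix.det (Matrix.of fun i j => θ j (v i))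
  map_update_add' := by
    intro inst v i x y
    obtain rfl : inst = instDecidableEqFin n := Subsingleton.elim _ _
    have h : ∀ z : V, (Matrix.of fun k j => θ j (Function.update v i z k)) =
        (Matrix.of fun k j => θ j (v k)).updateRow i (fun j => θ j z) := by
      intro z
      ext k j
      by_cases hk : k = i
      · subst hk; simp
      · simp [hk]
    have hxy : (fun j => θ j (x + y)) = (fun j => θ j x) + fun j => θ j y := by
      ext j; simp
    simp only [h]
    rw [hxy, Matrix.det_updateRow_add]
  map_update_smul' := by
    intro inst v i c x
    obtain rfl : inst = instDecidableEqFin n := Subsingleton.elim _ _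
    have h : ∀ z : V, (Matrix.of fun k j => θ j (Function.update v i z k)) =
        (Matrix.of fun k j => θ j (v k)).updateRow i (fun j => θ j z) := by
      intro z
      ext k j
      by_cases hk : k = i
      · subst hk; simp
      · simp [hk]
    have hcx : (fun j => θ j (c • x)) = (c : ℂ) • fun j => θ j x := by
      ext j; simp
    simp only [h]
    rw [hcx, Matrix.det_updateRow_smul, Complex.real_smul]
  map_eq_zero_of_eq' := by
    intro v i k hv hik
    exact Matrix.det_zero_of_row_eq hik (by ext j; simp [hv])

/-- The wedge product of complex-valued alternating forms (the sum over shuffles). -/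
def wedgeForms {k l : ℕ} (a : V [⋀^Fin k]→ₗ[ℝ] ℂ) (b : V [⋀^Fin l]→ₗ[ℝ] ℂ) :
    V [⋀^Fin (k + l)]→ₗ[ℝ] ℂ :=
  ((LinearMap.mul' ℝ ℂ).compAlternatingMap (a.domCoprod b)).domDomCongr finSumFinEquiv

/-- The complex conjugate of a complex-valued alternating form. -/
def conjForm {k : ℕ} (a : V [⋀^Fin k]→ₗ[ℝ] ℂ) : V [⋀^Fin k]→ₗ[ℝ] ℂ :=
  Complex.conjAe.toLinearMap.compAlternatingMap a

/-- The complex conjugate of a complex-valued covector. -/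
def conjCovector (a : V →L[ℝ] ℂ) : V →L[ℝ] ℂ :=
  (Complex.conjCLE : ℂ →L[ℝ] ℂ).comp a

/-- `α` consists of three `ℂ`-linearly independent covectors of type `(1,0)` for `j`. -/
def IsCoframe (j : V →L[ℝ] V) (α : Fin 3 → V →L[ℝ] ℂ) : Prop :=
  (∀ k v, α k (j v) = Complex.I * α k v) ∧ LinearIndependent ℂ α

/-- The `(0,2)`-part of a complex-valued 2-form `β`: the complex-bilinear extension of `β`
evaluated on the `(0,1)`-parts `(v + i j v) / 2` and `(w + i j w) / 2`. -/
def part02 (j : V →L[ℝ] V) (β : V → V → ℂ) (v w : V) : ℂ :=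
  (β v w + Complex.I * β (j v) w + Complex.I * β v (j w) - β (j v) (j w)) / 4

/-- `N` is the matrix of the Nijenhuis tensor in the coframe `α` whose exterior derivative at the
point is `dα`: the `(0,2)`-part of `dα i` is
`N i 0 • conj (α 1 ∧ α 2) + N i 1 • conj (α 2 ∧ α 0) + N i 2 • conj (α 0 ∧ α 1)`.
(The indices in `Fin 3` are added modulo 3.) -/
def IsNijenhuisMatrix (j : V →L[ℝ] V) (α : Fin 3 → V →L[ℝ] ℂ) (dα : Fin 3 → V → V → ℂ)
    (N : Matrix (Fin 3) (Fin 3) ℂ) : Prop :=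
  ∀ i v w, part02 j (dα i) v w =
    ∑ k, N i k * (starRingEnd ℂ)
      (α (k + 1) v * α (k + 2) w - α (k + 1) w * α (k + 2) v)

/-- The symmetric trilinear form on `3 × 3` matrices with `P a a a = det a`
(the polarization of the determinant). -/
def polarDet (a b c : Matrix (Fin 3) (Fin 3) ℂ) : ℂ :=
  ((a + b + c).det - (a + b).det - (a + c).det - (b + c).det + a.det + b.det + c.det) / 6

theorem polarDet_self (a : Matrix (Fin 3) (Fin 3) ℂ) : polarDet a a a = a.det := by
  simp only [polarDet, Matrix.det_fin_three, Matrix.add_apply]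
  ring

theorem polarDet_add_smul (t : ℂ) (a a' b c : Matrix (Fin 3) (Fin 3) ℂ) :
    polarDet (a + t • a') b c = polarDet a b c + t * polarDet a' b c := by
  simp only [polarDet, Matrix.det_fin_three, Matrix.add_apply, Matrix.smul_apply, smul_eq_mul]
  ring

theorem polarDet_symm (a b c : Matrix (Fin 3) (Fin 3) ℂ) :
    polarDet a b c = polarDet b a c ∧ polarDet a b c = polarDet a c b := by
  simp only [polarDet, Matrix.det_fin_three, Matrix.add_apply]
  constructor <;> ring

/-- `(i/8) |det N|² α₁ ∧ α₂ ∧ α₃ ∧ conj α₁ ∧ conj α₂ ∧ conj α₃`. -/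
def phiOf (α : Fin 3 → V →L[ℝ] ℂ) (N : Matrix (Fin 3) (Fin 3) ℂ) : V [⋀^Fin 6]→ₗ[ℝ] ℂ :=
  (Complex.I / 8 * ((‖N.det‖ ^ 2 : ℝ) : ℂ)) •
    wedgeCovectors ![α 0, α 1, α 2, conjCovector (α 0), conjCovector (α 1), conjCovector (α 2)]

/-- `P(conj N, conj N, Nᵀ) α₁ ∧ α₂ ∧ α₃`. -/
def psiOf (α : Fin 3 → V →L[ℝ] ℂ) (N : Matrix (Fin 3) (Fin 3) ℂ) : V [⋀^Fin 3]→ₗ[ℝ] ℂ :=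
  polarDet (N.map (starRingEnd ℂ)) (N.map (starRingEnd ℂ)) N.transpose • wedgeCovectors α

/-- `c₁ Φ + c₂ (i/8) ψ ∧ conj ψ`. -/
def integrandOf (c₁ c₂ : ℂ) (Φ : V [⋀^Fin 6]→ₗ[ℝ] ℂ) (ψ : V [⋀^Fin 3]→ₗ[ℝ] ℂ) :
    V [⋀^Fin 6]→ₗ[ℝ] ℂ :=
  c₁ • Φ + (c₂ * (Complex.I / 8)) • wedgeForms ψ (conjForm ψ)

end Pointwise

/-- The model space `ℝ⁶`. -/
abbrev E6 : Type := EuclideanSpace ℝ (Fin 6)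

/-- The standard basis of `ℝ⁶`. -/
def stdFrame : Fin 6 → E6 := fun i => EuclideanSpace.single i 1

/-- The exterior derivative `(v, w) ↦ (D_v β)(w) - (D_w β)(v)` of a complex-valued 1-form on an
open subset of `ℝ⁶`. -/
def extDerivOne (β : E6 → E6 →L[ℝ] ℂ) (y v w : E6) : ℂ :=
  fderiv ℝ β y v w - fderiv ℝ β y w v

/-! ### The Lagrangian on 1-jets -/

/-- A 1-jet of a field of endomorphisms of `ℝ⁶`: the value and the first derivative at a point. -/
abbrev EndJet : Type := (E6 →L[ℝ] E6) × (E6 →L[ℝ] E6 →L[ℝ] E6)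

/-- The exterior derivative, at the point where `J` has the 1-jet `q`, of the `(1,0)`-form
`(a - i a ∘ J) / 2`, where `a` is a constant form. If `a` is of type `(1,0)` for `q.1`,
then `(a - i a ∘ J) / 2` has the value `a` at that point. -/
def jetExtDeriv (q : EndJet) (a : E6 →L[ℝ] ℂ) (v w : E6) : ℂ :=
  -(Complex.I / 2) * (a (q.2 v w) - a (q.2 w v))

/-- A coframe for the endomorphism `q.1`. -/
def jetCoframe (q : EndJet) : Fin 3 → E6 →L[ℝ] ℂ :=
  Classical.epsilon fun α => IsCoframe q.1 α

/-- The Nijenhuis matrix of a 1-jet in the coframe `jetCoframe q`. -/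
def jetNijenhuis (q : EndJet) : Matrix (Fin 3) (Fin 3) ℂ :=
  Classical.epsilon fun N =>
    IsNijenhuisMatrix q.1 (jetCoframe q) (fun k => jetExtDeriv q (jetCoframe q k)) N

/-- The coefficient of `c₁ Φ + c₂ (i/8) ψ ∧ conj ψ` with respect to `dx¹ ∧ ⋯ ∧ dx⁶`,
as a function of the 1-jet of the almost complex structure. -/
def lagrangian (c₁ c₂ : ℂ) (q : EndJet) : ℂ :=
  integrandOf c₁ c₂ (phiOf (jetCoframe q) (jetNijenhuis q))
    (psiOf (jetCoframe q) (jetNijenhuis q)) stdFrame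

/-! ### Six-manifolds: coordinates, orientations, integration -/

section Manifold

variable {M : Type*} [TopologicalSpace M] [ChartedSpace E6 M]

/-- The differential of the inverse of the preferred chart at `p`; it sends the standard basis to
the coordinate frame. -/
def coordMap (p : M) (y : E6) : E6 →L[ℝ] TangentSpace (𝓡 6) ((chartAt E6 p).symm y) :=
  mfderiv 𝓘(ℝ, E6) (𝓡 6) (chartAt E6 p).symm y

/-- The differential of the preferred chart at `p`. -/
def coordInv (p : M) (x : M) : TangentSpace (𝓡 6) x →L[ℝ] E6 :=
  mfderiv (𝓡 6) 𝓘(ℝ, E6) (chartAt E6 p) x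

/-- The coordinate frame of the preferred chart at `p`. -/
def coordFrame (p : M) (y : E6) : Fin 6 → TangentSpace (𝓡 6) ((chartAt E6 p).symm y) :=
  fun i => coordMap p y (stdFrame i)

/-- The sign of a frame for an orientation of a 6-dimensional vector space: `1` for positive
bases, `-1` for negative bases, `0` for linearly dependent families. -/
def frameSign {V : Type*} [AddCommGroup V] [Module ℝ V] (o : Orientation ℝ V (Fin 6))
    (v : Fin 6 → V) : ℝ :=
  (SignType.sign (Module.Ray.someVector o v) : ℝ)

variable (M) in
/-- An orientation of a 6-manifold: an orientation of each tangent space for which the sign of the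
coordinate frame of every preferred chart is locally constant. -/
structure ManifoldOrientation where
  at_point : ∀ x : M, Orientation ℝ (TangentSpace (𝓡 6) x) (Fin 6)
  locally_constant : ∀ p : M, ∀ y ∈ (chartAt E6 p).target, ∀ᶠ z in 𝓝 y,
    frameSign (at_point ((chartAt E6 p).symm z)) (coordFrame p z) =
      frameSign (at_point ((chartAt E6 p).symm y)) (coordFrame p y)

/-- The integral over the oriented manifold, computed with the partition of unity `ρ` subordinate
to the preferred charts, of the 6-form whose coefficient in the chart at `p` is `θ p`. -/
def chartIntegral (o : ManifoldOrientation M) (ρ : SmoothPartitionOfUnity M (𝓡 6) M univ)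
    (θ : M → E6 → ℂ) : ℂ :=
  ∑ᶠ p : M, ∫ y in (chartAt E6 p).target,
    ((ρ p ((chartAt E6 p).symm y) *
      frameSign (o.at_point ((chartAt E6 p).symm y)) (coordFrame p y) : ℝ) : ℂ) * θ p y

/-- The 6-form with coefficients `θ p` in the charts is integrable over the oriented manifold and
its integral is `c`, whichever partition of unity subordinate to the charts is used. -/
def HasIntegral (o : ManifoldOrientation M) (θ : M → E6 → ℂ) (c : ℂ) : Prop :=
  ∀ ρ : SmoothPartitionOfUnity M (𝓡 6) M univ,
    ρ.IsSubordinate (fun p => (chartAt E6 p).source) →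
      (∀ p : M, IntegrableOn (fun y =>
        ((ρ p ((chartAt E6 p).symm y) *
          frameSign (o.at_point ((chartAt E6 p).symm y)) (coordFrame p y) : ℝ) : ℂ) * θ p y)
        (chartAt E6 p).target volume) ∧
      chartIntegral o ρ θ = c

/-- The coefficient of a 6-form in the preferred chart at `p`. -/
def coefficient (Θ : ∀ x : M, TangentSpace (𝓡 6) x [⋀^Fin 6]→ₗ[ℝ] ℂ) (p : M) (y : E6) : ℂ :=
  Θ ((chartAt E6 p).symm y) (coordFrame p y)

/-- The integral of a 6-form over a compact oriented 6-manifold. -/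
def integralForm [IsManifold (𝓡 6) ∞ M] [CompactSpace M] [T2Space M]
    (o : ManifoldOrientation M) (Θ : ∀ x : M, TangentSpace (𝓡 6) x [⋀^Fin 6]→ₗ[ℝ] ℂ) : ℂ :=
  chartIntegral o
    (Classical.choose (SmoothPartitionOfUnity.exists_isSubordinate_chartAt_source (𝓡 6) M))
    (coefficient Θ)

/-! ### Almost complex structures and their invariant forms -/

variable (M) in
/-- A field of complex structures on the tangent spaces, with no regularity imposed. -/
structure ComplexField where
  toFun : ∀ x : M, TangentSpace (𝓡 6) x →L[ℝ] TangentSpace (𝓡 6) x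
  sq_eq_neg : ∀ x v, toFun x (toFun x v) = -v

/-- `J` induces the orientation `o`: bases `v₁, J v₁, v₂, J v₂, v₃, J v₃` are positive. -/
def ComplexField.Induces (J : ComplexField M) (o : ManifoldOrientation M) : Prop :=
  ∀ (x : M) (v : Fin 3 → TangentSpace (𝓡 6) x),
    LinearIndependent ℝ
      ![v 0, J.toFun x (v 0), v 1, J.toFun x (v 1), v 2, J.toFun x (v 2)] →
    frameSign (o.at_point x)
      ![v 0, J.toFun x (v 0), v 1, J.toFun x (v 1), v 2, J.toFun x (v 2)] = 1

/-- The field of endomorphisms `J` in the coordinates of the preferred chart at `p`. -/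
def ComplexField.inChart (J : ComplexField M) (p : M) (y : E6) : E6 →L[ℝ] E6 :=
  (coordInv p ((chartAt E6 p).symm y)).comp
    ((J.toFun ((chartAt E6 p).symm y)).comp (coordMap p y))

/-- The exterior derivative at `x` of a complex-valued 1-form that is smooth near `x`,
computed in the preferred chart at `x`. -/
def extDerivAt (a : ∀ x : M, TangentSpace (𝓡 6) x →L[ℝ] ℂ) (x : M)
    (v w : TangentSpace (𝓡 6) x) : ℂ :=
  extDerivOne (fun y => (a ((chartAt E6 x).symm y)).comp (coordMap x y)) (chartAt E6 x x)
    (coordInv x x v) (coordInv x x w)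

section Smooth

variable [IsManifold (𝓡 6) ∞ M]

/-- `J` is a smooth section of the bundle of endomorphisms of the tangent bundle. -/
def ComplexField.IsSmooth (J : ComplexField M) : Prop :=
  ContMDiff (𝓡 6) ((𝓡 6).prod 𝓘(ℝ, E6 →L[ℝ] E6)) ∞
    (fun x => Bundle.TotalSpace.mk' (E6 →L[ℝ] E6)
      (E := fun x : M => TangentSpace (𝓡 6) x →L[ℝ] TangentSpace (𝓡 6) x) x (J.toFun x))

/-- The complex-valued 1-form `a` is smooth on `U`. -/
def IsSmoothOneFormOn (a : ∀ x : M, TangentSpace (𝓡 6) x →L[ℝ] ℂ) (U : Set M) : Prop :=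
  ContMDiffOn (𝓡 6) ((𝓡 6).prod 𝓘(ℝ, E6 →L[ℝ] ℂ)) ∞
    (fun x => Bundle.TotalSpace.mk' (E6 →L[ℝ] ℂ)
      (E := fun x : M => TangentSpace (𝓡 6) x →L[ℝ] Bundle.Trivial M ℂ x) x (a x)) U

/-- `α` is a `J`-complex local coframing with domain `U`. -/
def IsCoframing (J : ComplexField M) (U : Set M)
    (α : Fin 3 → ∀ x : M, TangentSpace (𝓡 6) x →L[ℝ] ℂ) : Prop :=
  IsOpen U ∧ (∀ k, IsSmoothOneFormOn (α k) U) ∧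
    ∀ x ∈ U, IsCoframe (J.toFun x) (fun k => α k x)

/-- `N` is the value at `x` of the matrix of the Nijenhuis tensor in the coframing `α`. -/
def IsNijenhuisMatrixAt (J : ComplexField M)
    (α : Fin 3 → ∀ x : M, TangentSpace (𝓡 6) x →L[ℝ] ℂ) (x : M)
    (N : Matrix (Fin 3) (Fin 3) ℂ) : Prop :=
  IsNijenhuisMatrix (J.toFun x) (fun k => α k x) (fun k => extDerivAt (α k) x) N

/-- The matrix `N(α)` at `x`. -/
def nijenhuisMatrix (J : ComplexField M)
    (α : Fin 3 → ∀ x : M, TangentSpace (𝓡 6) x →L[ℝ] ℂ) (x : M) : Matrix (Fin 3) (Fin 3) ℂ :=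
  Classical.epsilon (IsNijenhuisMatrixAt J α x)

/-- Some `J`-complex local coframing whose domain contains `x`. -/
def someCoframing (J : ComplexField M) (x : M) :
    Fin 3 → ∀ x : M, TangentSpace (𝓡 6) x →L[ℝ] ℂ :=
  Classical.epsilon fun α => ∃ U : Set M, x ∈ U ∧ IsCoframing J U α

/-- The 6-form `Φ(J)`, evaluated at each point with some local coframing. -/
def phiForm (J : ComplexField M) (x : M) : TangentSpace (𝓡 6) x [⋀^Fin 6]→ₗ[ℝ] ℂ :=
  phiOf (fun k => someCoframing J x k x) (nijenhuisMatrix J (someCoframing J x) x)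

/-- The 3-form `ψ(J)`, evaluated at each point with some local coframing. -/
def psiForm (J : ComplexField M) (x : M) : TangentSpace (𝓡 6) x [⋀^Fin 3]→ₗ[ℝ] ℂ :=
  psiOf (fun k => someCoframing J x k x) (nijenhuisMatrix J (someCoframing J x) x)

/-- The 6-form `c₁ Φ(J) + c₂ (i/8) ψ(J) ∧ conj ψ(J)`. -/
def integrandForm (c₁ c₂ : ℂ) (J : ComplexField M) (x : M) :
    TangentSpace (𝓡 6) x [⋀^Fin 6]→ₗ[ℝ] ℂ :=
  integrandOf c₁ c₂ (phiForm J x) (psiForm J x)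

/-- The forms `Φ(J)` and `ψ(J)` are well defined: local coframings exist near every point, each
has a unique Nijenhuis matrix, and all of them compute `Φ(J)` and `ψ(J)`. -/
def FormsWellDefined (J : ComplexField M) : Prop :=
  (∀ x : M, ∃ (U : Set M) (α : Fin 3 → ∀ x : M, TangentSpace (𝓡 6) x →L[ℝ] ℂ),
    x ∈ U ∧ IsCoframing J U α) ∧
  ∀ (U : Set M) (α : Fin 3 → ∀ x : M, TangentSpace (𝓡 6) x →L[ℝ] ℂ), IsCoframing J U α →
    ∀ x ∈ U, (∃! N, IsNijenhuisMatrixAt J α x N) ∧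
      phiForm J x = phiOf (fun k => α k x) (nijenhuisMatrix J α x) ∧
      psiForm J x = psiOf (fun k => α k x) (nijenhuisMatrix J α x)

/-- The space `𝒥₊(M)` of smooth almost complex structures that induce the orientation `o`. -/
def AlmostComplexPlus (o : ManifoldOrientation M) : Type _ :=
  {J : ComplexField M // J.IsSmooth ∧ J.Induces o}

/-- The functional `F_c(J) = ∫ c₁ Φ(J) + c₂ (i/8) ψ(J) ∧ conj ψ(J)` on `𝒥₊(M)`. -/
def invariantFunctional [CompactSpace M] [T2Space M] (o : ManifoldOrientation M) (c₁ c₂ : ℂ)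
    (J : AlmostComplexPlus o) : ℂ :=
  integralForm o (integrandForm c₁ c₂ J.1)

/-- `F` takes equal values at `J` and `J'` whenever `J' = f^* J` for a diffeomorphism `f`. -/
def IsDiffeomorphismInvariant (o : ManifoldOrientation M) (F : AlmostComplexPlus o → ℂ) : Prop :=
  ∀ (J J' : AlmostComplexPlus o) (f : Diffeomorph (𝓡 6) (𝓡 6) M M ∞),
    (∀ (x : M) (v : TangentSpace (𝓡 6) x),
      mfderiv (𝓡 6) (𝓡 6) f x (J'.1.toFun x v) =
        J.1.toFun (f x) (mfderiv (𝓡 6) (𝓡 6) f x v)) →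
    F J' = F J

/-- `F` is the integral of the Lagrangian `L`, a smooth function of the 1-jet of the almost
complex structure in local coordinates. -/
def IsFirstOrder (o : ManifoldOrientation M) (L : EndJet → ℂ) (F : AlmostComplexPlus o → ℂ) :
    Prop :=
  ContDiffOn ℝ ∞ L {q : EndJet | ∀ v, q.1 (q.1 v) = -v} ∧
  ∀ J : AlmostComplexPlus o,
    HasIntegral o (fun p y => L (J.1.inChart p y, fderiv ℝ (J.1.inChart p) y)) (F J)

end Smooth

/-! ### The class `L⁶₁` -/

/-- `D` is the weak derivative of `f` on the open set `Ω ⊆ ℝ⁶`. -/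
def IsWeakDerivOn (Ω : Set E6) (f : E6 → E6 →L[ℝ] E6) (D : E6 → E6 →L[ℝ] E6 →L[ℝ] E6) : Prop :=
  LocallyIntegrableOn f Ω ∧ LocallyIntegrableOn D Ω ∧
  ∀ φ : E6 → ℝ, ContDiff ℝ ∞ φ → HasCompactSupport φ → tsupport φ ⊆ Ω →
    ∀ v : E6, ∫ y, (fderiv ℝ φ y v) • f y = -∫ y, φ y • D y v

/-- In every chart, `D p` is the weak derivative of `J`, and it is in `L⁶` on compact sets. -/
def ComplexField.IsL6Deriv (J : ComplexField M) (D : M → E6 → E6 →L[ℝ] E6 →L[ℝ] E6) : Prop :=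
  ∀ p : M, IsWeakDerivOn (chartAt E6 p).target (J.inChart p) (D p) ∧
    ∀ K ⊆ (chartAt E6 p).target, IsCompact K → MemLp (D p) 6 (volume.restrict K)

/-- `J` is essentially bounded and has weak first derivatives in `L⁶`
(on compact subsets of the charts). -/
def ComplexField.MemL61 (J : ComplexField M) : Prop :=
  (∀ p : M, ∀ K ⊆ (chartAt E6 p).target, IsCompact K →
    MemLp (J.inChart p) ⊤ (volume.restrict K)) ∧
  ∃ D : M → E6 → E6 →L[ℝ] E6 →L[ℝ] E6, J.IsL6Deriv D

/-- `Js n` converges to `J` in `L⁶₁`, with a uniform essential bound. -/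
def ConvergesL61 (Js : ℕ → ComplexField M) (J : ComplexField M) : Prop :=
  ∃ (Ds : ℕ → M → E6 → E6 →L[ℝ] E6 →L[ℝ] E6) (D : M → E6 → E6 →L[ℝ] E6 →L[ℝ] E6),
    (∀ n, (Js n).IsL6Deriv (Ds n)) ∧ J.IsL6Deriv D ∧
    ∀ p : M, ∀ K ⊆ (chartAt E6 p).target, IsCompact K →
      (∃ C : NNReal, ∀ n, eLpNorm ((Js n).inChart p) ⊤ (volume.restrict K) ≤ C) ∧
      Tendsto (fun n => eLpNorm (fun y => (Js n).inChart p y - J.inChart p y) 6 (volume.restrict K))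
        atTop (𝓝 0) ∧
      Tendsto (fun n => eLpNorm (fun y => Ds n p y - D p y) 6 (volume.restrict K))
        atTop (𝓝 0)

/-- The functional `F` with Lagrangian `L` is of class `L⁶₁`: the integral of the Lagrangian
converges absolutely and is well defined on all bounded almost complex structures with weak first
derivatives in `L⁶` that induce the orientation, it extends `F`, and it is continuous under
`L⁶₁`-convergence with a uniform bound. -/
def IsOfClassL61 [IsManifold (𝓡 6) ∞ M] (o : ManifoldOrientation M) (L : EndJet → ℂ)
    (F : AlmostComplexPlus o → ℂ) : Prop :=
  ∃ G : {J : ComplexField M // J.MemL61 ∧ J.Induces o} → ℂ,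
    (∀ J, ∀ D : M → E6 → E6 →L[ℝ] E6 →L[ℝ] E6, J.1.IsL6Deriv D →
      HasIntegral o (fun p y => L (J.1.inChart p y, D p y)) (G J)) ∧
    (∀ J : AlmostComplexPlus o, ∃ h : J.1.MemL61, G ⟨J.1, h, J.2.2⟩ = F J) ∧
    (∀ (Js : ℕ → {J : ComplexField M // J.MemL61 ∧ J.Induces o}) (J),
      ConvergesL61 (fun n => (Js n).1) J.1 → Tendsto (fun n => G (Js n)) atTop (𝓝 (G J)))

end Manifold

end

/-! Pointwise algebra gives the well-definedness. Under a change of coframe β = Gα, the Nijenhuis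
matrix becomes GNG* times the conjugate of det G⁻¹, where G* is the conjugate transpose
(`nijenhuisMatrix_change`). Hence |det N|² and P(N̄, N̄, ᵗN) are multiplied by powers of det G and
of its conjugate, and these cancel exactly against the factors picked up by the 6-form and by
α¹∧α²∧α³ (`phiOf_psiOf_change`). Derivatives of G never enter: differentiating β∘J = iβ shows that
the (0,2)-part of dβ depends only on the value of β and the 1-jet of J (`part02_extDerivOne`). So
the integrand is a function of the 1-jet of J.

This function `lagrangian` has three decisive properties. It is smooth on {j² = -1}, because the
(1,0)-projection of a coframe for j is a coframe for all nearby j' (`contDiffOn_lagrangian`). It is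
homogeneous of degree 6 in the derivative, hence at most C|Dj|⁶ as long as j stays bounded
(`exists_lagrangian_bound`). Under a change of coordinates it is multiplied by the Jacobian
determinant, the second derivatives cancelling by their symmetry (`lagrangian_naturality`).

The bound explains the exponent 6: it gives absolute convergence, and along an L⁶-convergent
sequence it gives uniform integrability, so that Vitali's theorem yields continuity
(`tendsto_integral_lagrangian`). Naturality survives for weak derivatives, since these obey the
product and chain rules and are unique (`SmoothTransition.ae_lagrangian_eq`).

All global statements come from one change-of-variables formula for an orientation-preserving
diffeomorphism f and two partitions of unity (`chartIntegral_eq_of_pullback`). For general f it is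
diffeomorphism invariance; for f = id it is independence of the partition and of the weak
derivative. -/

noncomputable section

/-! ### Wedge products of covectors as determinants. -/

section WedgeAlgebra

variable {V : Type*} [AddCommGroup V] [Module ℝ V] [TopologicalSpace V]

theorem wedgeCovectors_apply {n : ℕ} (θ : Fin n → V →L[ℝ] ℂ) (v : Fin n → V) :
    wedgeCovectors θ v = Matrix.det (Matrix.of fun i j => θ j (v i)) := rfl

/-- The wedge product of covectors as the alternatization of their product. -/
theorem wedgeCovectors_eq_alternatization {n : ℕ} (θ : Fin n → V →L[ℝ] ℂ) :
    wedgeCovectors θ = MultilinearMap.alternatization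
      ((MultilinearMap.mkPiAlgebra ℝ (Fin n) ℂ).compLinearMap
        fun i => ((θ i : V →L[ℝ] ℂ) : V →ₗ[ℝ] ℂ)) := by
  ext v
  rw [wedgeCovectors_apply, Matrix.det_apply, MultilinearMap.alternatization_apply]
  simp

/-- This is Laplace expansion: the shuffle sum of two alternatizations is the alternatization of the
product, that is, a sum over all permutations of the disjoint union of the index sets. -/
theorem wedgeForms_wedgeCovectors {k l : ℕ} (θ : Fin k → V →L[ℝ] ℂ) (η : Fin l → V →L[ℝ] ℂ) :
    wedgeForms (wedgeCovectors θ) (wedgeCovectors η) = wedgeCovectors (Fin.append θ η) := by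
  ext v
  rw [wedgeForms, wedgeCovectors_eq_alternatization θ, wedgeCovectors_eq_alternatization η,
    ← MultilinearMap.domCoprod_alternization, AlternatingMap.domDomCongr_apply,
    ← LinearMap.compMultilinearMap_alternatization, MultilinearMap.alternatization_apply,
    wedgeCovectors_apply, ← Matrix.det_submatrix_equiv_self finSumFinEquiv, Matrix.det_apply]
  refine Finset.sum_congr rfl fun σ _ => ?_
  simp [Fintype.prod_sum_type]

theorem conjForm_wedgeCovectors {k : ℕ} (θ : Fin k → V →L[ℝ] ℂ) :
    conjForm (wedgeCovectors θ) = wedgeCovectors fun i => conjCovector (θ i) := by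
  ext v
  have h := (starRingEnd ℂ).map_det (Matrix.of fun i j => θ j (v i))
  exact h

theorem wedgeCovectors_linearCombination {n : ℕ} (H : Matrix (Fin n) (Fin n) ℂ)
    (θ : Fin n → V →L[ℝ] ℂ) :
    wedgeCovectors (fun i => ∑ j, H i j • θ j) = H.det • wedgeCovectors θ := by
  ext v
  rw [AlternatingMap.smul_apply, wedgeCovectors_apply, wedgeCovectors_apply, smul_eq_mul,
    mul_comm, ← H.det_transpose, ← Matrix.det_mul]
  congr 1
  ext i j
  simp [Matrix.mul_apply, mul_comm]

/-- The 6-form `α₁ ∧ α₂ ∧ α₃ ∧ conj α₁ ∧ conj α₂ ∧ conj α₃`. -/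
def wedgeSix (α : Fin 3 → V →L[ℝ] ℂ) : V [⋀^Fin 6]→ₗ[ℝ] ℂ :=
  wedgeCovectors ![α 0, α 1, α 2, conjCovector (α 0), conjCovector (α 1), conjCovector (α 2)]

theorem wedgeSix_eq_append (α : Fin 3 → V →L[ℝ] ℂ) :
    wedgeSix α = wedgeCovectors (Fin.append α fun i => conjCovector (α i)) := by
  rw [wedgeSix]
  congr 1
  ext i : 1
  fin_cases i <;> rfl

theorem wedgeForms_conjForm (α : Fin 3 → V →L[ℝ] ℂ) :
    wedgeForms (wedgeCovectors α) (conjForm (wedgeCovectors α)) = wedgeSix α := by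
  rw [conjForm_wedgeCovectors, wedgeForms_wedgeCovectors, wedgeSix_eq_append]

theorem wedgeSix_linearCombination (G : Matrix (Fin 3) (Fin 3) ℂ) (α : Fin 3 → V →L[ℝ] ℂ) :
    wedgeSix (fun i => ∑ j, G i j • α j) =
      (G.det * (starRingEnd ℂ) G.det) • wedgeSix α := by
  -- The six covectors α, conj α are transformed by the block-diagonal matrix with blocks G and conj
  -- G, reindexed from a disjoint union to `Fin 6`.
  set H : Matrix (Fin (3 + 3)) (Fin (3 + 3)) ℂ :=
    (Matrix.fromBlocks G 0 0 (G.map (starRingEnd ℂ))).submatrix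
      (finSumFinEquiv (m := 3) (n := 3)).symm (finSumFinEquiv (m := 3) (n := 3)).symm with hH
  have hdet : H.det = G.det * (starRingEnd ℂ) G.det := by
    rw [hH, Matrix.det_submatrix_equiv_self, Matrix.det_fromBlocks_zero₂₁,
      ← RingHom.mapMatrix_apply, ← RingHom.map_det]
  rw [← hdet, wedgeSix_eq_append α, ← wedgeCovectors_linearCombination, wedgeSix_eq_append]
  congr 1
  refine funext fun i => ContinuousLinearMap.ext fun v => ?_
  obtain ⟨i, rfl⟩ := (finSumFinEquiv (m := 3) (n := 3)).surjective i
  have key : ∀ (f g : Fin 3 → V →L[ℝ] ℂ) (s : Fin 3 ⊕ Fin 3),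
      Fin.append f g (finSumFinEquiv s) = Sum.elim f g s := by
    rintro f g (s | s)
    exacts [Fin.append_left f g s, Fin.append_right f g s]
  refine (congrArg (fun c : V →L[ℝ] ℂ => c v) (key _ _ i)).trans ?_
  have hsum : (∑ j, H (finSumFinEquiv i) j • Fin.append α (fun i => conjCovector (α i)) j) v =
      ∑ s : Fin 3 ⊕ Fin 3, H (finSumFinEquiv i) (finSumFinEquiv s) *
        (Sum.elim α (fun i => conjCovector (α i)) s) v := by
    rw [_root_.sum_apply, ← Equiv.sum_comp (finSumFinEquiv (m := 3) (n := 3))]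
    exact Finset.sum_congr rfl fun s _ => by rw [key]; rfl
  refine Eq.trans ?_ hsum.symm
  rcases i with i | i <;> simp [hH, conjCovector]

/-- Absorbing the scalar into the first covector keeps ψ decomposable, so that `wedgeForms_conjForm`
computes ψ ∧ conj ψ without bilinearity of `wedgeForms`. -/
theorem psiOf_eq_wedgeCovectors (α : Fin 3 → V →L[ℝ] ℂ) (c : ℂ) :
    c • wedgeCovectors α =
      wedgeCovectors fun i => ∑ j, (Matrix.diagonal ![c, 1, 1]) i j • α j := by
  rw [wedgeCovectors_linearCombination, Matrix.det_diagonal]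
  simp [Fin.prod_univ_three]

/-- The whole integrand becomes a scalar depending on N alone times one fixed 6-form; every later
computation separates these two factors. -/
theorem integrandOf_phiOf_psiOf (c₁ c₂ : ℂ) (α : Fin 3 → V →L[ℝ] ℂ)
    (N : Matrix (Fin 3) (Fin 3) ℂ) :
    integrandOf c₁ c₂ (phiOf α N) (psiOf α N) =
      ((c₁ * (N.det * (starRingEnd ℂ) N.det) +
        c₂ * (polarDet (N.map (starRingEnd ℂ)) (N.map (starRingEnd ℂ)) N.transpose *
          (starRingEnd ℂ)
            (polarDet (N.map (starRingEnd ℂ)) (N.map (starRingEnd ℂ)) N.transpose))) *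
        (Complex.I / 8)) • wedgeSix α := by
  rw [integrandOf, phiOf, psiOf, psiOf_eq_wedgeCovectors, wedgeForms_conjForm,
    wedgeSix_linearCombination, Matrix.det_diagonal]
  change _ • _ • wedgeSix α + _ = _
  rw [smul_smul, smul_smul, ← add_smul]
  congr 1
  simp [Fin.prod_univ_three, Complex.mul_conj, Complex.normSq_eq_norm_sq]
  ring

theorem wedgeSix_compLinearMap {W : Type*} [AddCommGroup W] [Module ℝ W] [TopologicalSpace W]
    (A : V →L[ℝ] W) (α : Fin 3 → W →L[ℝ] ℂ) (v : Fin 6 → V) :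
    wedgeSix (fun k => (α k).comp A) v = wedgeSix α fun i => A (v i) := by
  rw [wedgeSix, wedgeSix, wedgeCovectors_apply, wedgeCovectors_apply]
  congr 1
  ext i j
  fin_cases j <;> rfl

theorem conj_wedgeSix (α : Fin 3 → V →L[ℝ] ℂ) (v : Fin 6 → V) :
    (starRingEnd ℂ) (wedgeSix α v) = -wedgeSix α v := by
  have h1 : (starRingEnd ℂ) (wedgeSix α v) = conjForm (wedgeSix α) v := rfl
  rw [h1, wedgeSix, conjForm_wedgeCovectors]
  -- Conjugation exchanges the two blocks of three covectors; this is a product of three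
  -- transpositions, hence odd.
  set τ : Equiv.Perm (Fin 6) := Equiv.swap 0 3 * Equiv.swap 1 4 * Equiv.swap 2 5 with hτ
  have hs : (Equiv.Perm.sign τ : ℤ) = -1 := by rw [hτ]; decide
  have h := Matrix.det_permute' τ (Matrix.of fun i j =>
    (![α 0, α 1, α 2, conjCovector (α 0), conjCovector (α 1), conjCovector (α 2)] :
      Fin 6 → V →L[ℝ] ℂ) j (v i))
  rw [hs, Int.cast_neg, Int.cast_one, neg_one_mul] at h
  rw [wedgeCovectors_apply, wedgeCovectors_apply]
  refine Eq.trans ?_ h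
  · congr 1
    ext i j
    have e0 : τ 0 = 3 := by rw [hτ]; decide
    have e1 : τ 1 = 4 := by rw [hτ]; decide
    have e2 : τ 2 = 5 := by rw [hτ]; decide
    have e3 : τ 3 = 0 := by rw [hτ]; decide
    have e4 : τ 4 = 1 := by rw [hτ]; decide
    have e5 : τ 5 = 2 := by rw [hτ]; decide
    fin_cases j <;> simp [conjCovector, e0, e1, e2, e3, e4, e5]

end WedgeAlgebra

/-! ### Dual frames and the Nijenhuis matrix at a point. -/

section CoframeAlgebra

variable {V : Type*} [AddCommGroup V] [Module ℝ V] [TopologicalSpace V]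

/-- `e` is the frame of `(1,0)`-vectors dual to `α`. -/
def IsDualFrame (j : V →L[ℝ] V) (α : Fin 3 → V →L[ℝ] ℂ) (e : Fin 3 → V) : Prop :=
  (∀ k l, α k (e l) = if k = l then 1 else 0) ∧
    ∀ v, v = ∑ k, ((α k v).re • e k + (α k v).im • j (e k))

/-- The image of V in ℂ³ is a complex subspace. Were it proper, a nonzero functional vanishing on it
would be a complex linear relation between the α k. So the map is onto, and both real dimensions are
6. -/
theorem IsCoframe.bijective {j : V →L[ℝ] V} {α : Fin 3 → V →L[ℝ] ℂ}
    (hV : Module.finrank ℝ V = 6) (h : IsCoframe j α) :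
    Function.Bijective fun (v : V) (k : Fin 3) => α k v := by
  have : FiniteDimensional ℝ V := Module.finite_of_finrank_pos (by omega)
  let A : V →ₗ[ℝ] (Fin 3 → ℂ) := LinearMap.pi fun k => (α k : V →ₗ[ℝ] ℂ)
  have hsurj : Function.Surjective A := by
    let S : Submodule ℂ (Fin 3 → ℂ) :=
      { carrier := Set.range A
        add_mem' := by
          rintro _ _ ⟨v, rfl⟩ ⟨w, rfl⟩
          exact ⟨v + w, map_add A v w⟩
        zero_mem' := ⟨0, map_zero A⟩
        smul_mem' := by
          rintro c _ ⟨v, rfl⟩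
          -- Since each α k turns j into multiplication by i, this vector realises multiplication by
          -- c on the image.
          refine ⟨c.re • v + c.im • j v, ?_⟩
          ext k
          have := h.1 k v
          simp only [A, LinearMap.pi_apply, ContinuousLinearMap.coe_coe, map_add, map_smul, this,
            Pi.smul_apply, smul_eq_mul, Complex.real_smul]
          conv_rhs => rw [← Complex.re_add_im c]
          ring }
    have hS : S = ⊤ := by
      by_contra hne
      obtain ⟨f, hf0, hf⟩ := Submodule.exists_le_ker_of_lt_top S (lt_top_iff_ne_top.2 hne)
      apply hf0
      have hsum : ∀ z : Fin 3 → ℂ, f z = ∑ k, z k * f (Pi.single k 1) := by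
        intro z
        conv_lhs => rw [pi_eq_sum_univ' z, map_sum]
        refine Finset.sum_congr rfl fun k _ => ?_
        rw [map_smul, smul_eq_mul]
      have hlin := Fintype.linearIndependent_iff.1 h.2 (fun k => f (Pi.single k 1)) (by
        ext v
        have hv : f (A v) = 0 := hf ⟨v, rfl⟩
        rw [hsum] at hv
        rw [_root_.sum_apply]
        simpa [A, mul_comm] using hv)
      refine LinearMap.ext fun z => ?_
      rw [hsum]
      simp [hlin]
    intro z
    have hz : z ∈ S := hS ▸ Submodule.mem_top
    exact hz
  have hfin : Module.finrank ℝ V = Module.finrank ℝ (Fin 3 → ℂ) := by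
    rw [hV, Module.finrank_pi_fintype]
    simp
  exact ⟨(LinearMap.injective_iff_surjective_of_finrank_eq_finrank hfin).2 hsurj, hsurj⟩

theorem IsCoframe.exists_isDualFrame {j : V →L[ℝ] V} {α : Fin 3 → V →L[ℝ] ℂ}
    (hV : Module.finrank ℝ V = 6) (h : IsCoframe j α) : ∃ e, IsDualFrame j α e := by
  obtain ⟨hinj, hsurj⟩ := h.bijective hV
  choose e he using fun l : Fin 3 => hsurj (fun k => if k = l then 1 else 0)
  have he' : ∀ k l, α k (e l) = if k = l then 1 else 0 := fun k l => congrFun (he l) k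
  refine ⟨e, he', fun v => hinj (funext fun k => ?_)⟩
  simp only [map_sum, map_add, map_smul, h.1, he', Complex.real_smul, mul_ite, mul_one, mul_zero,
    Finset.sum_add_distrib, Finset.sum_ite_eq, Finset.mem_univ, if_true]
  exact (Complex.re_add_im (α k v)).symm

theorem IsDualFrame.eq_sum {j : V →L[ℝ] V} {α : Fin 3 → V →L[ℝ] ℂ} {e : Fin 3 → V}
    (he : IsDualFrame j α e) {β : V →L[ℝ] ℂ} (hβ : ∀ v, β (j v) = Complex.I * β v) (v : V) :
    β v = ∑ k, β (e k) * α k v := by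
  conv_lhs => rw [he.2 v]
  rw [map_sum]
  refine Finset.sum_congr rfl fun k _ => ?_
  simp only [map_add, map_smul, hβ, Complex.real_smul]
  conv_rhs => rw [← Complex.re_add_im (α k v)]
  ring

/-- The duality relations alone give independence: evaluating a vanishing combination at `e i`
isolates its i-th coefficient. -/
theorem IsDualFrame.isCoframe {j : V →L[ℝ] V} {α : Fin 3 → V →L[ℝ] ℂ} {e : Fin 3 → V}
    (h : ∀ k v, α k (j v) = Complex.I * α k v)
    (he : ∀ k l, α k (e l) = if k = l then 1 else 0) : IsCoframe j α := by
  refine ⟨h, Fintype.linearIndependent_iff.2 fun g hg i => ?_⟩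
  have := congrArg (fun β : V →L[ℝ] ℂ => β (e i)) hg
  simpa [_root_.sum_apply, he] using this

/-- A real-bilinear antisymmetric form. -/
def IsSkewBilinear (β : V → V → ℂ) : Prop :=
  (∀ v v' w, β (v + v') w = β v w + β v' w) ∧ (∀ (c : ℝ) v w, β (c • v) w = c * β v w) ∧
    ∀ v w, β v w = -β w v

theorem IsSkewBilinear.part02 {j : V →L[ℝ] V} {β : V → V → ℂ} (h : IsSkewBilinear β) :
    IsSkewBilinear (part02 j β) := by
  obtain ⟨h1, h2, h3⟩ := h
  refine ⟨fun v v' w => ?_, fun c v w => ?_, fun v w => ?_⟩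
  · simp only [_root_.part02, map_add, h1]; ring
  · simp only [_root_.part02, map_smul, h2]; ring
  · simp only [_root_.part02]
    rw [h3 v w, h3 (j v) w, h3 v (j w), h3 (j v) (j w)]
    ring

/-- Replacing v by j v turns v + i j v into j v - i v = -i (v + i j v), so the (0,2)-part is
conjugate linear for j. -/
theorem part02_map_left {j : V →L[ℝ] V} (hj : ∀ v, j (j v) = -v) {β : V → V → ℂ}
    (h : IsSkewBilinear β) (v w : V) : part02 j β (j v) w = -Complex.I * part02 j β v w := by
  have hneg : ∀ v w, β (-v) w = -β v w := fun v w => by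
    simpa using h.2.1 (-1) v w
  simp only [part02, hj, hneg]
  linear_combination ((1 / 4 : ℂ) * β (j v) w + (1 / 4) * β v (j w)) * Complex.I_sq

theorem IsDualFrame.semilinear_expand {j : V →L[ℝ] V} {α : Fin 3 → V →L[ℝ] ℂ} {e : Fin 3 → V}
    (he : IsDualFrame j α e) {T : V → V → ℂ} (hT : IsSkewBilinear T)
    (hjT : ∀ v w, T (j v) w = -Complex.I * T v w) (v w : V) :
    T v w = ∑ k, (starRingEnd ℂ) (α k v) * T (e k) w := by
  have hzero : T 0 w = 0 := by simpa using hT.2.1 0 0 w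
  let f : V →+ ℂ := ⟨⟨fun v => T v w, hzero⟩, fun v v' => hT.1 v v' w⟩
  have : T v w = f v := rfl
  rw [this]
  conv_lhs => rw [he.2 v, map_sum]
  refine Finset.sum_congr rfl fun k _ => ?_
  have h1 : f (e k) = T (e k) w := rfl
  have h2 : f (j (e k)) = -Complex.I * T (e k) w := hjT _ _
  have h3 : ∀ (c : ℝ) x, f (c • x) = c * f x := fun c x => hT.2.1 c x w
  rw [map_add, h3, h3, h1, h2]
  have : (starRingEnd ℂ) (α k v) = (α k v).re - (α k v).im * Complex.I := by
    apply Complex.ext <;> simp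
  rw [this]
  ring

/-- A skew form on V that is conjugate linear in both arguments is determined by its values on the
three pairs of dual frame vectors, and these values are the entries of the matrix. -/
theorem exists_isNijenhuisMatrix {j : V →L[ℝ] V} (hj : ∀ v, j (j v) = -v)
    {α : Fin 3 → V →L[ℝ] ℂ} {e : Fin 3 → V} (he : IsDualFrame j α e)
    {dα : Fin 3 → V → V → ℂ} (hd : ∀ i, IsSkewBilinear (dα i)) :
    IsNijenhuisMatrix j α dα
      (Matrix.of fun i k => part02 j (dα i) (e (k + 1)) (e (k + 2))) := by
  intro i v w
  set T := part02 j (dα i) with hTdef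
  have hT : IsSkewBilinear T := (hd i).part02
  have hjT := fun v w => part02_map_left hj (hd i) v w
  rw [he.semilinear_expand hT hjT v w]
  have h2 : ∀ k, T (e k) w = ∑ l, (starRingEnd ℂ) (α l w) * T (e k) (e l) := by
    intro k
    rw [hT.2.2, he.semilinear_expand hT hjT w, ← Finset.sum_neg_distrib]
    refine Finset.sum_congr rfl fun l _ => ?_
    rw [hT.2.2 (e l)]
    ring
  have hself : ∀ k, T (e k) (e k) = 0 := fun k => self_eq_neg.1 (hT.2.2 _ _)
  have e0 : ∀ k : Fin 3, (0 : Fin 3) + k = k := zero_add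
  have e1 : (1 : Fin 3) + 1 = 2 := rfl
  have e2 : (1 : Fin 3) + 2 = 0 := rfl
  have e3 : (2 : Fin 3) + 1 = 0 := rfl
  have e4 : (2 : Fin 3) + 2 = 1 := rfl
  simp only [h2, Fin.sum_univ_three, Matrix.of_apply, map_sub, map_mul, e0, e1, e2, e3, e4, hself,
    ← hTdef]
  rw [hT.2.2 (e 1) (e 0), hT.2.2 (e 2) (e 1), hT.2.2 (e 2) (e 0)]
  ring

/-- On a pair of dual frame vectors only one of the three wedge terms survives, which forces the
entry and so gives uniqueness. -/
theorem IsNijenhuisMatrix.apply_eq {j : V →L[ℝ] V} {α : Fin 3 → V →L[ℝ] ℂ} {e : Fin 3 → V}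
    (he : IsDualFrame j α e) {dα : Fin 3 → V → V → ℂ} {N : Matrix (Fin 3) (Fin 3) ℂ}
    (hN : IsNijenhuisMatrix j α dα N) (i k : Fin 3) :
    N i k = part02 j (dα i) (e (k + 1)) (e (k + 2)) := by
  rw [hN]
  have e0 : ∀ k : Fin 3, (0 : Fin 3) + k = k := zero_add
  have e1 : (1 : Fin 3) + 1 = 2 := rfl
  have e2 : (1 : Fin 3) + 2 = 0 := rfl
  have e3 : (2 : Fin 3) + 1 = 0 := rfl
  have e4 : (2 : Fin 3) + 2 = 1 := rfl
  simp only [he.1]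
  fin_cases k <;> simp [Fin.sum_univ_three, e1, e2, e3, e4]

theorem IsNijenhuisMatrix.unique {j : V →L[ℝ] V} {α : Fin 3 → V →L[ℝ] ℂ} {e : Fin 3 → V}
    (he : IsDualFrame j α e) {dα : Fin 3 → V → V → ℂ} {N N' : Matrix (Fin 3) (Fin 3) ℂ}
    (hN : IsNijenhuisMatrix j α dα N) (hN' : IsNijenhuisMatrix j α dα N') : N = N' := by
  ext i k
  rw [hN.apply_eq he, hN'.apply_eq he]

/-! ### Change of coframe -/

/-- Each determinant in the polarization formula acquires the factor det A · det B. -/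
theorem polarDet_mul (A B X Y Z : Matrix (Fin 3) (Fin 3) ℂ) :
    polarDet (A * X * B) (A * Y * B) (A * Z * B) = A.det * B.det * polarDet X Y Z := by
  simp only [polarDet, ← Matrix.add_mul, ← Matrix.mul_add, Matrix.det_mul]
  ring

theorem polarDet_smul (a b c : ℂ) (X Y Z : Matrix (Fin 3) (Fin 3) ℂ) :
    polarDet (a • X) (b • Y) (c • Z) = a * b * c * polarDet X Y Z := by
  simp only [polarDet, Matrix.det_fin_three, Matrix.add_apply, Matrix.smul_apply, smul_eq_mul]
  ring

/-- The transformation law of the Nijenhuis matrix under `β = G α`, with `G' = G⁻¹`. -/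
theorem nijenhuisMatrix_change {j : V →L[ℝ] V} {α β : Fin 3 → V →L[ℝ] ℂ} {e' : Fin 3 → V}
    (hβ : IsDualFrame j β e') {dα dβ : Fin 3 → V → V → ℂ}
    {N N' G G' : Matrix (Fin 3) (Fin 3) ℂ} (hGG : G * G' = 1)
    (hG' : ∀ k l, α k (e' l) = G' k l)
    (hd : ∀ i v w, part02 j (dβ i) v w = ∑ l, G i l * part02 j (dα l) v w)
    (hN : IsNijenhuisMatrix j α dα N) (hN' : IsNijenhuisMatrix j β dβ N') :
    N' = (starRingEnd ℂ) G'.det • (G * N * (G.map (starRingEnd ℂ)).transpose) := by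
  -- Since G is the inverse of G', Cramer's rule makes the 2 × 2 minors of G' equal to det G' times
  -- entries of G; this is the source of the factor conj (det G').
  have hadj : G'.adjugate = G'.det • G := by
    have h1 : G'.adjugate = G'.adjugate * (G' * G) := by
      rw [mul_eq_one_comm.1 hGG, Matrix.mul_one]
    rw [h1, ← Matrix.mul_assoc, Matrix.adjugate_mul, Matrix.smul_mul, Matrix.one_mul]
  have hcof : ∀ k m, α (m + 1) (e' (k + 1)) * α (m + 2) (e' (k + 2)) -
      α (m + 1) (e' (k + 2)) * α (m + 2) (e' (k + 1)) = G'.det * G k m := by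
    intro k m
    have h2 := congrFun (congrFun hadj k) m
    rw [Matrix.smul_apply, smul_eq_mul] at h2
    rw [← h2, Matrix.adjugate_fin_three]
    have e0 : ∀ k : Fin 3, (0 : Fin 3) + k = k := zero_add
    have e1 : (1 : Fin 3) + 1 = 2 := rfl
    have e2 : (1 : Fin 3) + 2 = 0 := rfl
    have e3 : (2 : Fin 3) + 1 = 0 := rfl
    have e4 : (2 : Fin 3) + 2 = 1 := rfl
    simp only [hG']
    fin_cases k <;> fin_cases m <;> simp [e1, e2, e3, e4] <;> ring
  ext i k
  rw [hN'.apply_eq hβ, hd]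
  have hN2 : ∀ l, part02 j (dα l) (e' (k + 1)) (e' (k + 2)) =
      ∑ m, N l m * (starRingEnd ℂ) (G'.det * G k m) := by
    intro l
    rw [hN]
    simp only [hcof]
  simp only [hN2, Matrix.smul_apply, Matrix.mul_apply, Matrix.transpose_apply, Matrix.map_apply,
    smul_eq_mul, map_mul, Fin.sum_univ_three]
  ring

theorem map_conj_mul (A B : Matrix (Fin 3) (Fin 3) ℂ) :
    (A * B).map (starRingEnd ℂ) = A.map (starRingEnd ℂ) * B.map (starRingEnd ℂ) :=
  Matrix.map_mul

theorem det_map_conj (A : Matrix (Fin 3) (Fin 3) ℂ) :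
    (A.map (starRingEnd ℂ)).det = (starRingEnd ℂ) A.det :=
  ((starRingEnd ℂ).map_det A).symm

theorem map_conj_map_conj (A : Matrix (Fin 3) (Fin 3) ℂ) :
    (A.map (starRingEnd ℂ)).map (starRingEnd ℂ) = A := by
  ext i k; simp

theorem phiOf_eq_wedgeSix (α : Fin 3 → V →L[ℝ] ℂ) (N : Matrix (Fin 3) (Fin 3) ℂ) :
    phiOf α N = (Complex.I / 8 * (N.det * (starRingEnd ℂ) N.det)) • wedgeSix α := by
  rw [Complex.mul_conj, Complex.normSq_eq_norm_sq]
  rfl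

/-- `Φ` and `ψ` do not depend on the coframe. -/
theorem phiOf_psiOf_change {j : V →L[ℝ] V} (hV : Module.finrank ℝ V = 6)
    {α β : Fin 3 → V →L[ℝ] ℂ} (hα : IsCoframe j α) (hβ : IsCoframe j β)
    {dα dβ : Fin 3 → V → V → ℂ} {N N' : Matrix (Fin 3) (Fin 3) ℂ}
    (hd : ∀ G : Matrix (Fin 3) (Fin 3) ℂ, (∀ i, β i = ∑ l, G i l • α l) →
      ∀ i v w, part02 j (dβ i) v w = ∑ l, G i l * part02 j (dα l) v w)
    (hN : IsNijenhuisMatrix j α dα N) (hN' : IsNijenhuisMatrix j β dβ N') :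
    phiOf β N' = phiOf α N ∧ psiOf β N' = psiOf α N := by
  obtain ⟨e, he⟩ := hα.exists_isDualFrame hV
  obtain ⟨e', he'⟩ := hβ.exists_isDualFrame hV
  set G : Matrix (Fin 3) (Fin 3) ℂ := Matrix.of fun i l => β i (e l) with hGdef
  set G' : Matrix (Fin 3) (Fin 3) ℂ := Matrix.of fun i l => α i (e' l) with hGdef'
  have hβα : ∀ i, β i = ∑ l, G i l • α l := by
    intro i
    ext v
    rw [he.eq_sum (hβ.1 i) v, _root_.sum_apply]
    rfl
  have hGG : G * G' = 1 := by
    ext i l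
    rw [Matrix.mul_apply, Matrix.one_apply, ← he'.1 i l, he.eq_sum (hβ.1 i) (e' l)]
    rfl
  have hchange := nijenhuisMatrix_change he' hGG (fun _ _ => rfl) (hd G hβα) hN hN'
  have hdet : G.det * G'.det = 1 := by rw [← Matrix.det_mul, hGG, Matrix.det_one]
  have hdet' : (starRingEnd ℂ) G.det * (starRingEnd ℂ) G'.det = 1 := by
    rw [← map_mul, hdet, map_one]
  have hsix : wedgeSix β = (G.det * (starRingEnd ℂ) G.det) • wedgeSix α := by
    rw [← wedgeSix_linearCombination, ← funext hβα]
  have hthree : wedgeCovectors β = G.det • wedgeCovectors α := by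
    rw [← wedgeCovectors_linearCombination, ← funext hβα]
  constructor
  -- The scalar contributes conj (det G') cubed; one of these factors cancels against the
  -- determinant of conj G.
  · have hdN : N'.det = (starRingEnd ℂ) G'.det ^ 2 * G.det * N.det := by
      rw [hchange, Matrix.det_smul, Matrix.det_mul, Matrix.det_mul, Matrix.det_transpose,
        det_map_conj, Fintype.card_fin]
      linear_combination
        ((starRingEnd ℂ) G'.det ^ 2 * G.det * N.det) * hdet'
    rw [phiOf_eq_wedgeSix, phiOf_eq_wedgeSix, hsix, smul_smul, hdN]
    congr 1
    simp only [map_mul, map_pow, Complex.conj_conj]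
    set d := G.det
    set d' := G'.det
    set s := (starRingEnd ℂ) d
    set s' := (starRingEnd ℂ) d'
    have h1 : s' ^ 2 * d * s * d' ^ 2 * d * s = 1 := by
      linear_combination (s' ^ 2 * d * s * s * d' + s' ^ 2 * s * s) * hdet + (s' * s + 1) * hdet'
    linear_combination (Complex.I / 8 * N.det * (starRingEnd ℂ) N.det) * h1
  · rw [psiOf, psiOf, hthree, smul_smul]
    congr 1
    -- The conjugate and the transpose of N are multiplied by the same matrices, conj G on the left
    -- and ᵗG on the right. This is why P is applied to N̄, N̄ and ᵗN: `polarDet_mul` extracts the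
    -- common factors.
    have hconj : N'.map (starRingEnd ℂ) =
        G'.det • (G.map (starRingEnd ℂ) * N.map (starRingEnd ℂ) * G.transpose) := by
      have h1 : ((starRingEnd ℂ) G'.det • (G * N * (G.map (starRingEnd ℂ)).transpose)).map
          (starRingEnd ℂ) = (starRingEnd ℂ) ((starRingEnd ℂ) G'.det) •
            (G * N * (G.map (starRingEnd ℂ)).transpose).map (starRingEnd ℂ) := by
        ext i k; simp only [Matrix.map_apply, Matrix.smul_apply, smul_eq_mul, map_mul]
      rw [hchange, h1, map_conj_mul, map_conj_mul, Matrix.transpose_map, map_conj_map_conj,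
        Complex.conj_conj]
    have htr : N'.transpose = (starRingEnd ℂ) G'.det •
        (G.map (starRingEnd ℂ) * N.transpose * G.transpose) := by
      rw [hchange, Matrix.transpose_smul, Matrix.transpose_mul, Matrix.transpose_mul,
        Matrix.transpose_transpose, Matrix.mul_assoc]
    rw [hconj, htr, polarDet_smul, polarDet_mul, det_map_conj, Matrix.det_transpose]
    set d := G.det
    set d' := G'.det
    set s := (starRingEnd ℂ) d
    set s' := (starRingEnd ℂ) d'
    have h1 : d' * d' * s' * s * d * d = 1 := by
      linear_combination (d' * d * s' * s + s' * s) * hdet + hdet'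
    linear_combination
      polarDet (N.map (starRingEnd ℂ)) (N.map (starRingEnd ℂ)) N.transpose * h1

end CoframeAlgebra

/-! ### The Lagrangian on 1-jets: choice of coframe, homogeneity, naturality. -/

section Jets

theorem finrank_E6 : Module.finrank ℝ E6 = 6 := by simp

theorem alternatingMap_map_linearMap {V ι : Type*} [AddCommGroup V] [Module ℝ V] [Fintype ι]
    [DecidableEq ι] (b : Module.Basis ι ℝ V) (η : V [⋀^ι]→ₗ[ℝ] ℝ) (f : V →ₗ[ℝ] V) (v : ι → V) :
    η (fun i => f (v i)) = LinearMap.det f * η v := by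
  rw [AlternatingMap.eq_smul_basis_det b η, AlternatingMap.smul_apply, AlternatingMap.smul_apply,
    smul_eq_mul, smul_eq_mul, mul_left_comm]
  congr 1
  exact b.det_comp f v

theorem complexAlternatingMap_map_linearMap {V ι : Type*} [AddCommGroup V] [Module ℝ V]
    [Fintype ι] [DecidableEq ι] (b : Module.Basis ι ℝ V) (η : V [⋀^ι]→ₗ[ℝ] ℂ) (f : V →ₗ[ℝ] V)
    (v : ι → V) : η (fun i => f (v i)) = ((LinearMap.det f : ℝ) : ℂ) * η v := by
  have hre := alternatingMap_map_linearMap b (Complex.reLm.compAlternatingMap η) f v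
  have him := alternatingMap_map_linearMap b (Complex.imLm.compAlternatingMap η) f v
  simp only [LinearMap.compAlternatingMap_apply, Complex.reLm_coe, Complex.imLm_coe] at hre him
  apply Complex.ext <;> simp [hre, him]

/-- The standard basis of `ℝ⁶`. -/
def stdBasis : Module.Basis (Fin 6) ℝ E6 := (EuclideanSpace.basisFun (Fin 6) ℝ).toBasis

theorem coe_stdBasis : ⇑stdBasis = stdFrame := by
  ext1 i
  rw [stdBasis, OrthonormalBasis.coe_toBasis, EuclideanSpace.basisFun_apply]
  rfl

/-- The 1-jets of almost complex structures. -/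
def complexJets : Set EndJet := {q : EndJet | ∀ v, q.1 (q.1 v) = -v}

/-- The endomorphism j makes ℝ⁶ a complex vector space of dimension 3, and the coordinates of a
complex basis form a coframe. -/
theorem exists_isCoframe {j : E6 →L[ℝ] E6} (hj : ∀ v, j (j v) = -v) :
    ∃ α : Fin 3 → E6 →L[ℝ] ℂ, IsCoframe j α := by
  have hsq : (j : E6 →ₗ[ℝ] E6) * (j : E6 →ₗ[ℝ] E6) = (-1 : Module.End ℝ E6) :=
    LinearMap.ext fun v => hj v
  let φ : ℂ →ₐ[ℝ] Module.End ℝ E6 := Complex.lift ⟨(j : E6 →ₗ[ℝ] E6), hsq⟩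
  let _ : Module ℂ E6 := Module.compHom E6 φ.toRingHom
  have hsmul : ∀ (c : ℂ) (v : E6), c • v = φ c v := fun _ _ => rfl
  have hI : ∀ v : E6, Complex.I • v = j v := fun v => by
    have h := Complex.liftAux_apply_I (j : E6 →ₗ[ℝ] E6) hsq
    exact congrArg (fun f : Module.End ℝ E6 => f v) h
  have : IsScalarTower ℝ ℂ E6 := ⟨fun r c v => by
    rw [hsmul, hsmul, map_smul, LinearMap.smul_apply]⟩
  have : FiniteDimensional ℂ E6 := FiniteDimensional.right ℝ ℂ E6
  have hdim : Module.finrank ℂ E6 = 3 := by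
    have := Module.finrank_mul_finrank ℝ ℂ E6
    rw [Complex.finrank_real_complex, finrank_E6] at this
    omega
  let b : Module.Basis (Fin 3) ℂ E6 := Module.finBasisOfFinrankEq ℂ E6 hdim
  let α : Fin 3 → E6 →L[ℝ] ℂ := fun k =>
    LinearMap.toContinuousLinearMap ((b.coord k).restrictScalars ℝ)
  have hα : ∀ k v, α k v = b.coord k v := fun _ _ => rfl
  refine ⟨α, IsDualFrame.isCoframe (e := b) (fun k v => ?_) fun k l => ?_⟩
  · rw [hα, hα, ← hI, map_smul, smul_eq_mul]
  · rw [hα, Module.Basis.coord_apply, Module.Basis.repr_self, Finsupp.single_apply]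
    simp only [eq_comm]

theorem isCoframe_jetCoframe {q : EndJet} (hq : q ∈ complexJets) :
    IsCoframe q.1 (jetCoframe q) :=
  Classical.epsilon_spec (exists_isCoframe hq)

theorem isSkewBilinear_jetExtDeriv (q : EndJet) (a : E6 →L[ℝ] ℂ) :
    IsSkewBilinear (jetExtDeriv q a) := by
  refine ⟨fun v v' w => ?_, fun c v w => ?_, fun v w => ?_⟩ <;> simp [jetExtDeriv] <;> ring

theorem isNijenhuisMatrix_jetNijenhuis {q : EndJet} (hq : q ∈ complexJets) :
    IsNijenhuisMatrix q.1 (jetCoframe q) (fun k => jetExtDeriv q (jetCoframe q k))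
      (jetNijenhuis q) := by
  obtain ⟨e, he⟩ := (isCoframe_jetCoframe hq).exists_isDualFrame finrank_E6
  exact Classical.epsilon_spec (p := fun N => IsNijenhuisMatrix q.1 (jetCoframe q)
    (fun k => jetExtDeriv q (jetCoframe q k)) N)
    ⟨_, exists_isNijenhuisMatrix hq he fun i => isSkewBilinear_jetExtDeriv q _⟩

/-- Here G is a constant matrix: `jetExtDeriv` is linear in the covector, so the transformation law
has no term in derivatives of G. -/
theorem part02_jetExtDeriv_linearCombination (q : EndJet) {α β : Fin 3 → E6 →L[ℝ] ℂ}
    (G : Matrix (Fin 3) (Fin 3) ℂ) (h : ∀ i, β i = ∑ l, G i l • α l) (i : Fin 3) (v w : E6) :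
    part02 q.1 (jetExtDeriv q (β i)) v w = ∑ l, G i l * part02 q.1 (jetExtDeriv q (α l)) v w := by
  have h' : ∀ x, β i x = ∑ l, G i l * α l x := fun x => by
    rw [h, _root_.sum_apply]
    rfl
  simp only [part02, jetExtDeriv, h', Fin.sum_univ_three]
  ring

/-- The coefficient of the 6-form computed from a coframe and a Nijenhuis matrix. -/
def density (c₁ c₂ : ℂ) (α : Fin 3 → E6 →L[ℝ] ℂ) (N : Matrix (Fin 3) (Fin 3) ℂ) : ℂ :=
  integrandOf c₁ c₂ (phiOf α N) (psiOf α N) stdFrame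

theorem density_eq (c₁ c₂ : ℂ) (α : Fin 3 → E6 →L[ℝ] ℂ) (N : Matrix (Fin 3) (Fin 3) ℂ) :
    density c₁ c₂ α N =
      (c₁ * (N.det * (starRingEnd ℂ) N.det) +
        c₂ * (polarDet (N.map (starRingEnd ℂ)) (N.map (starRingEnd ℂ)) N.transpose *
          (starRingEnd ℂ)
            (polarDet (N.map (starRingEnd ℂ)) (N.map (starRingEnd ℂ)) N.transpose))) *
        (Complex.I / 8) * wedgeSix α stdFrame := by
  rw [density, integrandOf_phiOf_psiOf]
  rfl

/-- The Lagrangian can be computed in any coframe. -/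
theorem lagrangian_eq_density (c₁ c₂ : ℂ) {q : EndJet} (hq : q ∈ complexJets)
    {α : Fin 3 → E6 →L[ℝ] ℂ} (hα : IsCoframe q.1 α) {N : Matrix (Fin 3) (Fin 3) ℂ}
    (hN : IsNijenhuisMatrix q.1 α (fun k => jetExtDeriv q (α k)) N) :
    lagrangian c₁ c₂ q = density c₁ c₂ α N := by
  obtain ⟨h1, h2⟩ := phiOf_psiOf_change finrank_E6 hα (isCoframe_jetCoframe hq)
    (fun G hG => part02_jetExtDeriv_linearCombination q G hG) hN
    (isNijenhuisMatrix_jetNijenhuis hq)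
  rw [lagrangian, density, h1, h2]

/-- The scalar in `density_eq` is real, while i/8 and the 6-form both change sign under conjugation.
The formula also applies off `complexJets`, where the coframe and matrix are arbitrary values of
`Classical.epsilon`. -/
theorem lagrangian_im {c₁ c₂ : ℂ} (h₁ : c₁.im = 0) (h₂ : c₂.im = 0) (q : EndJet) :
    (lagrangian c₁ c₂ q).im = 0 := by
  have h := density_eq c₁ c₂ (jetCoframe q) (jetNijenhuis q)
  have hL : lagrangian c₁ c₂ q = density c₁ c₂ (jetCoframe q) (jetNijenhuis q) := rfl
  rw [← hL] at h
  rw [← Complex.conj_eq_iff_im, h]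
  simp only [map_mul, map_add, conj_wedgeSix, Complex.conj_conj, map_div₀, Complex.conj_I,
    Complex.conj_eq_iff_im.2 h₁, Complex.conj_eq_iff_im.2 h₂, map_ofNat]
  ring

theorem jetExtDeriv_smul (t : ℝ) (q : EndJet) (a : E6 →L[ℝ] ℂ) (v w : E6) :
    jetExtDeriv (q.1, t • q.2) a v w = t * jetExtDeriv q a v w := by
  simp [jetExtDeriv]
  ring

/-- The Lagrangian is homogeneous of degree 6 in the derivative. -/
theorem lagrangian_smul (c₁ c₂ : ℂ) {q : EndJet} (hq : q ∈ complexJets) (t : ℝ) :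
    lagrangian c₁ c₂ (q.1, t • q.2) = t ^ 6 * lagrangian c₁ c₂ q := by
  have hN := isNijenhuisMatrix_jetNijenhuis hq
  have hα := isCoframe_jetCoframe hq
  set N := jetNijenhuis q
  set α := jetCoframe q
  -- The coframe depends on `q.1` only and N is linear in `q.2`; the density is of degree 6 in N and
  -- its conjugate.
  have hN' : IsNijenhuisMatrix q.1 α (fun k => jetExtDeriv (q.1, t • q.2) (α k))
      ((t : ℂ) • N) := by
    intro i v w
    have := hN i v w
    simp only [part02, jetExtDeriv_smul, Matrix.smul_apply, smul_eq_mul, mul_assoc] at this ⊢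
    rw [← Finset.mul_sum, ← this]
    ring
  have hq' : ((q.1, t • q.2) : EndJet) ∈ complexJets := hq
  rw [lagrangian_eq_density c₁ c₂ hq hα hN, lagrangian_eq_density c₁ c₂ hq' hα hN', density_eq,
    density_eq]
  have hmap : ((t : ℂ) • N).map (starRingEnd ℂ) = (t : ℂ) • N.map (starRingEnd ℂ) := by
    ext i k
    simp
  rw [hmap, Matrix.transpose_smul, polarDet_smul, Matrix.det_smul]
  simp only [map_mul, map_pow, Complex.conj_ofReal, Fintype.card_fin]
  ring

/-- Behaviour of the Lagrangian under a change of coordinates with first derivative `A` and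
second derivative `B`. -/
theorem lagrangian_naturality (c₁ c₂ : ℂ) {q q' : EndJet} (hq : q ∈ complexJets)
    (hq' : q' ∈ complexJets) {A : E6 →L[ℝ] E6} (hA : A.det ≠ 0) {B : E6 →L[ℝ] E6 →L[ℝ] E6}
    (hB : ∀ v w, B v w = B w v) (h1 : ∀ v, A (q.1 v) = q'.1 (A v))
    (h2 : ∀ v w, B v (q.1 w) + A (q.2 v w) = q'.2 (A v) (A w) + q'.1 (B v w)) :
    lagrangian c₁ c₂ q = A.det * lagrangian c₁ c₂ q' := by
  obtain ⟨α, hα⟩ := exists_isCoframe hq'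
  obtain ⟨e, he⟩ := hα.exists_isDualFrame finrank_E6
  have hN := exists_isNijenhuisMatrix hq' he fun i => isSkewBilinear_jetExtDeriv q' (α i)
  set N : Matrix (Fin 3) (Fin 3) ℂ := Matrix.of fun i k =>
    part02 q'.1 (jetExtDeriv q' (α i)) (e (k + 1)) (e (k + 2))
  let Ae : E6 ≃ₗ[ℝ] E6 := LinearEquiv.ofIsUnitDet (f := (A : E6 →ₗ[ℝ] E6))
    (v := Module.finBasis ℝ E6) (v' := Module.finBasis ℝ E6)
    (by rw [LinearMap.det_toMatrix]; exact hA.isUnit)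
  have hAe : ∀ v, A (Ae.symm v) = v := fun v => Ae.apply_symm_apply v
  have hβ : IsCoframe q.1 fun k => (α k).comp A := by
    refine IsDualFrame.isCoframe (e := fun k => Ae.symm (e k)) (fun k v => ?_) fun k l => ?_
    · simp only [ContinuousLinearMap.comp_apply, h1, hα.1]
    · simp only [ContinuousLinearMap.comp_apply, hAe, he.1]
  -- The (0,2)-part commutes with pullback. Antisymmetrization kills the term i a(B v w). The
  -- remaining terms a(B v (j w)) cancel in the (0,2)-part, because j acts as -i on (0,1)-vectors
  -- and B is symmetric.
  have hD : ∀ (a : E6 →L[ℝ] ℂ), (∀ v, a (q'.1 v) = Complex.I * a v) → ∀ v w,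
      part02 q.1 (jetExtDeriv q (a.comp A)) v w = part02 q'.1 (jetExtDeriv q' a) (A v) (A w) := by
    intro a ha v w
    have h3 : ∀ v w, a (A (q.2 v w)) =
        a (q'.2 (A v) (A w)) + Complex.I * a (B v w) - a (B v (q.1 w)) := by
      intro v w
      have := congrArg a (h2 v w)
      rw [map_add, map_add, ha] at this
      linear_combination this
    have hqq : ∀ v, q.1 (q.1 v) = -v := hq
    simp only [part02, jetExtDeriv, ContinuousLinearMap.comp_apply, h3, ← h1, hqq, map_neg]
    rw [hB w v, hB (q.1 w) (q.1 v), hB w (q.1 v), hB (q.1 w) v]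
    ring_nf
  -- The pulled-back coframe has the same matrix N, so the two densities differ only by the factor
  -- of the 6-form, det A.
  have hN' : IsNijenhuisMatrix q.1 (fun k => (α k).comp A)
      (fun k => jetExtDeriv q ((α k).comp A)) N := by
    intro i v w
    rw [hD _ (hα.1 i), hN]
    rfl
  rw [lagrangian_eq_density c₁ c₂ hq hβ hN', lagrangian_eq_density c₁ c₂ hq' hα hN, density_eq,
    density_eq, wedgeSix_compLinearMap]
  have hdet : wedgeSix α (fun i => A (stdFrame i)) = A.det * wedgeSix α stdFrame := by
    exact complexAlternatingMap_map_linearMap stdBasis (wedgeSix α) A stdFrame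
  rw [hdet]
  ring

end Jets

/-! ### Smoothness and growth of the Lagrangian. -/

section LagrangianSmooth

theorem ContDiffAt.matrix_det {E : Type*} [NormedAddCommGroup E] [NormedSpace ℝ E] {n : ℕ}
    {M : E → Matrix (Fin n) (Fin n) ℂ} {x : E} (h : ∀ i j, ContDiffAt ℝ ∞ (fun y => M y i j) x) :
    ContDiffAt ℝ ∞ (fun y => (M y).det) x := by
  simp only [Matrix.det_apply]
  refine ContDiffAt.sum fun σ _ => ?_
  have hp : ContDiffAt ℝ ∞ (fun y => ∏ i, M y (σ i) i) x := contDiffAt_prod fun i _ => h _ _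
  have : ∀ (s : ℤˣ) (z : ℂ), s • z = ((s : ℤ) : ℂ) * z := fun s z => by
    rw [Units.smul_def, zsmul_eq_mul]
  simp only [this]
  exact contDiffAt_const.mul hp

theorem ContDiffAt.conj {E : Type*} [NormedAddCommGroup E] [NormedSpace ℝ E] {f : E → ℂ} {x : E}
    (h : ContDiffAt ℝ ∞ f x) : ContDiffAt ℝ ∞ (fun y => (starRingEnd ℂ) (f y)) x :=
  Complex.conjCLE.contDiff.contDiffAt.comp x h

theorem ContDiffAt.polarDet {E : Type*} [NormedAddCommGroup E] [NormedSpace ℝ E]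
    {A B C : E → Matrix (Fin 3) (Fin 3) ℂ} {x : E}
    (hA : ∀ i j, ContDiffAt ℝ ∞ (fun y => A y i j) x)
    (hB : ∀ i j, ContDiffAt ℝ ∞ (fun y => B y i j) x)
    (hC : ∀ i j, ContDiffAt ℝ ∞ (fun y => C y i j) x) :
    ContDiffAt ℝ ∞ (fun y => _root_.polarDet (A y) (B y) (C y)) x := by
  simp only [_root_.polarDet, div_eq_mul_inv]
  refine ContDiffAt.mul ?_ contDiffAt_const
  exact ((((((ContDiffAt.matrix_det fun i j => ((hA i j).add (hB i j)).add (hC i j)).sub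
    (ContDiffAt.matrix_det fun i j => (hA i j).add (hB i j))).sub
    (ContDiffAt.matrix_det fun i j => (hA i j).add (hC i j))).sub
    (ContDiffAt.matrix_det fun i j => (hB i j).add (hC i j))).add
    (ContDiffAt.matrix_det hA)).add (ContDiffAt.matrix_det hB)).add (ContDiffAt.matrix_det hC)

/-- The `(1,0)`-part of a covector. -/
def part10 (j : E6 →L[ℝ] E6) (a : E6 →L[ℝ] ℂ) : E6 →L[ℝ] ℂ :=
  (1 / 2 : ℂ) • (a - Complex.I • a.comp j)

theorem part10_apply (j : E6 →L[ℝ] E6) (a : E6 →L[ℝ] ℂ) (v : E6) :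
    part10 j a v = (1 / 2) * (a v - Complex.I * a (j v)) := rfl

theorem part10_map {j : E6 →L[ℝ] E6} (hj : ∀ v, j (j v) = -v) (a : E6 →L[ℝ] ℂ) (v : E6) :
    part10 j a (j v) = Complex.I * part10 j a v := by
  rw [part10_apply, part10_apply, hj, map_neg]
  linear_combination ((1 / 2) * a (j v)) * Complex.I_sq

theorem part10_eq_self {j : E6 →L[ℝ] E6} {a : E6 →L[ℝ] ℂ} (h : ∀ v, a (j v) = Complex.I * a v) :
    part10 j a = a := by
  ext v
  rw [part10_apply, h]
  linear_combination (-(1 / 2) * a v) * Complex.I_sq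

/-- The `(1,0)`-parts of three covectors, as a map to `ℂ³`. -/
def part10Map (α : Fin 3 → E6 →L[ℝ] ℂ) (j : E6 →L[ℝ] E6) : E6 →L[ℝ] (Fin 3 → ℂ) :=
  ContinuousLinearMap.pi fun k => part10 j (α k)

theorem contDiff_part10 (a : E6 →L[ℝ] ℂ) : ContDiff ℝ ∞ fun j => part10 j a := by
  unfold part10
  fun_prop

theorem contDiff_part10Map (α : Fin 3 → E6 →L[ℝ] ℂ) : ContDiff ℝ ∞ (part10Map α) := by
  have h : part10Map α = fun j => ∑ k,
      (ContinuousLinearMap.single ℝ (fun _ : Fin 3 => ℂ) k).comp (part10 j (α k)) := by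
    ext j v k
    simp [part10Map, _root_.sum_apply, Finset.sum_apply, Pi.single_apply]
  rw [h]
  exact ContDiff.sum fun k _ => contDiff_const.clm_comp (contDiff_part10 (α k))

/-- At j itself the (1,0)-projection leaves α unchanged. Since invertibility is an open condition,
the fixed covectors α then project to a coframe for every nearby complex structure. -/
theorem part10Map_isInvertible {j : E6 →L[ℝ] E6} {α : Fin 3 → E6 →L[ℝ] ℂ} (h : IsCoframe j α) :
    (part10Map α j).IsInvertible := by
  have hmap : ∀ v k, part10Map α j v k = α k v := fun v k => by
    change part10 j (α k) v = _
    rw [part10_eq_self (h.1 k)]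
  have hb : Function.Bijective (part10Map α j : E6 →ₗ[ℝ] (Fin 3 → ℂ)) := by
    have := h.bijective finrank_E6
    convert this using 1
    funext v k
    exact hmap v k
  exact ⟨(LinearEquiv.ofBijective _ hb).toContinuousLinearEquiv, by ext; rfl⟩

/-- The frame dual to the `(1,0)`-parts of three covectors. -/
def part10Frame (α : Fin 3 → E6 →L[ℝ] ℂ) (j : E6 →L[ℝ] E6) (k : Fin 3) : E6 :=
  (part10Map α j).inverse (Pi.single k 1)

theorem part10_part10Frame {α : Fin 3 → E6 →L[ℝ] ℂ} {j : E6 →L[ℝ] E6}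
    (h : (part10Map α j).IsInvertible) (k l : Fin 3) :
    part10 j (α k) (part10Frame α j l) = if k = l then 1 else 0 := by
  have := congrFun (h.self_apply_inverse (Pi.single l 1)) k
  rw [Pi.single_apply] at this
  exact this

/-- The Nijenhuis matrix of a jet in the coframe of `(1,0)`-parts. -/
def part10Nijenhuis (α : Fin 3 → E6 →L[ℝ] ℂ) (q : EndJet) : Matrix (Fin 3) (Fin 3) ℂ :=
  Matrix.of fun i k => part02 q.1 (jetExtDeriv q (part10 q.1 (α i)))
    (part10Frame α q.1 (k + 1)) (part10Frame α q.1 (k + 2))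

/-- The choices made by `Classical.epsilon` are replaced by a coframe and a dual frame that depend
smoothly on the jet. -/
theorem lagrangian_eq_part10 (c₁ c₂ : ℂ) {α : Fin 3 → E6 →L[ℝ] ℂ} {q : EndJet}
    (hq : q ∈ complexJets) (h : (part10Map α q.1).IsInvertible) :
    lagrangian c₁ c₂ q = density c₁ c₂ (fun k => part10 q.1 (α k)) (part10Nijenhuis α q) := by
  have hα : IsCoframe q.1 fun k => part10 q.1 (α k) :=
    IsDualFrame.isCoframe (fun k v => part10_map hq (α k) v) (part10_part10Frame h)
  obtain ⟨e, he⟩ := hα.exists_isDualFrame finrank_E6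
  have hframe : ∀ l, part10Frame α q.1 l = e l := fun l =>
    (hα.bijective finrank_E6).1 (funext fun k => by
      change part10 q.1 (α k) _ = part10 q.1 (α k) _
      rw [part10_part10Frame h, he.1])
  refine lagrangian_eq_density c₁ c₂ hq hα ?_
  have := exists_isNijenhuisMatrix hq he fun i =>
    isSkewBilinear_jetExtDeriv q (part10 q.1 (α i))
  simpa only [part10Nijenhuis, hframe] using this

theorem contDiffAt_part10Frame {α : Fin 3 → E6 →L[ℝ] ℂ} {q : EndJet}
    (h : (part10Map α q.1).IsInvertible) (k : Fin 3) :
    ContDiffAt ℝ ∞ (fun q : EndJet => part10Frame α q.1 k) q := by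
  unfold part10Frame
  refine ContDiffAt.clm_apply ?_ contDiffAt_const
  have h1 : ContDiffAt ℝ ∞ (fun q : EndJet => part10Map α q.1) q :=
    ((contDiff_part10Map α).comp contDiff_fst).contDiffAt
  exact ContDiffAt.comp (g := ContinuousLinearMap.inverse)
    (f := fun q : EndJet => part10Map α q.1) q h.contDiffAt_map_inverse h1

theorem contDiffAt_part10Nijenhuis {α : Fin 3 → E6 →L[ℝ] ℂ} {q : EndJet}
    (h : (part10Map α q.1).IsInvertible) (i k : Fin 3) :
    ContDiffAt ℝ ∞ (fun q : EndJet => part10Nijenhuis α q i k) q := by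
  have h1 : ContDiffAt ℝ ∞ (fun q : EndJet => q.1) q := contDiffAt_fst
  have h2 : ContDiffAt ℝ ∞ (fun q : EndJet => q.2) q := contDiffAt_snd
  have ha : ContDiffAt ℝ ∞ (fun q : EndJet => part10 q.1 (α i)) q :=
    ((contDiff_part10 (α i)).comp contDiff_fst).contDiffAt
  have hext : ∀ {v w : EndJet → E6}, ContDiffAt ℝ ∞ v q → ContDiffAt ℝ ∞ w q →
      ContDiffAt ℝ ∞ (fun q : EndJet => jetExtDeriv q (part10 q.1 (α i)) (v q) (w q)) q := by
    intro v w hv hw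
    unfold jetExtDeriv
    exact contDiffAt_const.mul ((ha.clm_apply ((h2.clm_apply hv).clm_apply hw)).sub
      (ha.clm_apply ((h2.clm_apply hw).clm_apply hv)))
  have hv := contDiffAt_part10Frame h (k + 1)
  have hw := contDiffAt_part10Frame h (k + 2)
  have hjv := h1.clm_apply hv
  have hjw := h1.clm_apply hw
  change ContDiffAt ℝ ∞ (fun q : EndJet => part02 q.1 (jetExtDeriv q (part10 q.1 (α i)))
    (part10Frame α q.1 (k + 1)) (part10Frame α q.1 (k + 2))) q
  simp only [part02, div_eq_mul_inv]
  exact ((((hext hv hw).add (contDiffAt_const.mul (hext hjv hw))).add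
    (contDiffAt_const.mul (hext hv hjw))).sub (hext hjv hjw)).mul contDiffAt_const

theorem contDiffAt_density (c₁ c₂ : ℂ) {E : Type*} [NormedAddCommGroup E] [NormedSpace ℝ E]
    {α : E → Fin 3 → E6 →L[ℝ] ℂ} {N : E → Matrix (Fin 3) (Fin 3) ℂ} {x : E}
    (hα : ∀ k, ContDiffAt ℝ ∞ (fun y => α y k) x)
    (hN : ∀ i k, ContDiffAt ℝ ∞ (fun y => N y i k) x) :
    ContDiffAt ℝ ∞ (fun y => density c₁ c₂ (α y) (N y)) x := by
  simp only [density_eq]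
  have hdet := ContDiffAt.matrix_det hN
  have hP := ContDiffAt.polarDet (A := fun y => (N y).map (starRingEnd ℂ))
    (B := fun y => (N y).map (starRingEnd ℂ)) (C := fun y => (N y).transpose)
    (fun i k => (hN i k).conj) (fun i k => (hN i k).conj) (fun i k => hN k i)
  have hsix : ContDiffAt ℝ ∞ (fun y => wedgeSix (α y) stdFrame) x := by
    simp only [wedgeSix, wedgeCovectors_apply]
    refine ContDiffAt.matrix_det fun i k => ?_
    have hv : ∀ l, ContDiffAt ℝ ∞ (fun y => α y l (stdFrame i)) x := fun l =>
      (hα l).clm_apply contDiffAt_const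
    fin_cases k
    exacts [hv 0, hv 1, hv 2, (hv 0).conj, (hv 1).conj, (hv 2).conj]
  exact (((contDiffAt_const.mul (hdet.mul hdet.conj)).add
    (contDiffAt_const.mul (hP.mul hP.conj))).mul contDiffAt_const).mul hsix

/-- Near a given jet the Lagrangian agrees, on `complexJets`, with the explicit smooth expression
built from the projections of one fixed coframe. Off `complexJets` the two need not agree, so
smoothness is only asserted within this set. -/
theorem contDiffOn_lagrangian (c₁ c₂ : ℂ) : ContDiffOn ℝ ∞ (lagrangian c₁ c₂) complexJets := by
  intro q hq
  obtain ⟨α, hα⟩ := exists_isCoframe hq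
  have hinv := part10Map_isInvertible hα
  have hev : ∀ᶠ q' in 𝓝 q, (part10Map α q'.1).IsInvertible := by
    have hcont : ContinuousAt (fun q' : EndJet => part10Map α q'.1) q :=
      ((contDiff_part10Map α).continuous.comp continuous_fst).continuousAt
    obtain ⟨M, hM⟩ := hinv
    have hM' := ContinuousLinearEquiv.nhds M
    rw [hM] at hM'
    exact hcont hM'
  have hF : ContDiffAt ℝ ∞ (fun q : EndJet =>
      density c₁ c₂ (fun k => part10 q.1 (α k)) (part10Nijenhuis α q)) q :=
    contDiffAt_density c₁ c₂ (fun k => ((contDiff_part10 (α k)).comp contDiff_fst).contDiffAt)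
      (contDiffAt_part10Nijenhuis hinv)
  refine hF.contDiffWithinAt.congr_of_eventuallyEq ?_ (lagrangian_eq_part10 c₁ c₂ hq hinv)
  filter_upwards [self_mem_nhdsWithin, mem_nhdsWithin_of_mem_nhds hev] with q' hq' hq''
  exact lagrangian_eq_part10 c₁ c₂ hq' hq''

theorem isClosed_complexJets : IsClosed complexJets := by
  have : complexJets = ⋂ v : E6, {q : EndJet | q.1 (q.1 v) = -v} := by
    ext q
    simp [complexJets]
  rw [this]
  refine isClosed_iInter fun v => isClosed_eq ?_ continuous_const
  fun_prop

/-- The jets in `complexJets` with |j| ≤ R and |Dj| ≤ 1 form a compact set, on which the Lagrangian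
is bounded; homogeneity extends the bound to every derivative. -/
theorem exists_lagrangian_bound (c₁ c₂ : ℂ) (R : ℝ) :
    ∃ C : ℝ, 0 ≤ C ∧ ∀ q ∈ complexJets, ‖q.1‖ ≤ R → ‖lagrangian c₁ c₂ q‖ ≤ C * ‖q.2‖ ^ 6 := by
  have hK : IsCompact (complexJets ∩ (Metric.closedBall 0 R ×ˢ Metric.closedBall 0 1)) := by
    refine IsCompact.inter_left ?_ isClosed_complexJets
    exact (isCompact_closedBall _ _).prod (isCompact_closedBall _ _)
  obtain ⟨C, hC⟩ := hK.exists_bound_of_continuousOn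
    ((contDiffOn_lagrangian c₁ c₂).continuousOn.mono inter_subset_left)
  refine ⟨max C 0, le_max_right _ _, fun q hq hR => ?_⟩
  -- A zero derivative cannot be normalised; homogeneity with t = 0 makes the Lagrangian vanish
  -- there.
  rcases eq_or_ne q.2 0 with h0 | h0
  · have h := lagrangian_smul c₁ c₂ hq 0
    rw [zero_smul, ← h0, Prod.mk.eta] at h
    rw [h]
    simp [h0]
  · have hpos : 0 < ‖q.2‖ := norm_pos_iff.2 h0
    set q' : EndJet := (q.1, ‖q.2‖⁻¹ • q.2) with hq'def
    have hq' : q' ∈ complexJets := hq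
    have h : lagrangian c₁ c₂ q = (‖q.2‖ : ℂ) ^ 6 * lagrangian c₁ c₂ q' := by
      have h' := lagrangian_smul c₁ c₂ hq' ‖q.2‖
      rw [hq'def, smul_smul, mul_inv_cancel₀ hpos.ne', one_smul] at h'
      exact h'
    have hmem : q' ∈ complexJets ∩ (Metric.closedBall 0 R ×ˢ Metric.closedBall 0 1) := by
      refine ⟨hq', by simpa [hq'def] using hR, ?_⟩
      simp [hq'def, norm_smul, inv_mul_cancel₀ hpos.ne']
    rw [h, norm_mul, norm_pow, Complex.norm_real, norm_norm, mul_comm]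
    gcongr
    exact (hC q' hmem).trans (le_max_left _ _)

/-- The `(0,2)`-part of the exterior derivative of a `(1,0)`-form depends only on the value of
the form and the 1-jet of the almost complex structure. -/
theorem part02_extDerivOne {β : E6 → E6 →L[ℝ] ℂ} {J : E6 → E6 →L[ℝ] E6} {y : E6}
    (hβ : DifferentiableAt ℝ β y) (hJ : DifferentiableAt ℝ J y)
    (hsq : ∀ v, J y (J y v) = -v)
    (h : ∀ᶠ z in 𝓝 y, ∀ v, β z (J z v) = Complex.I * β z v) (v w : E6) :
    part02 (J y) (extDerivOne β y) v w =
      part02 (J y) (jetExtDeriv (J y, fderiv ℝ J y) (β y)) v w := by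
  -- Differentiating β∘J = iβ expresses the terms of `jetExtDeriv` through the derivative of β.
  have hD : ∀ v w, β y (fderiv ℝ J y v w) =
      Complex.I * fderiv ℝ β y v w - fderiv ℝ β y v (J y w) := by
    intro v w
    have h1 : HasFDerivAt (fun z => β z (J z w)) _ y :=
      hβ.hasFDerivAt.clm_apply (hJ.hasFDerivAt.clm_apply (hasFDerivAt_const w y))
    have h2 : HasFDerivAt (fun z => Complex.I * β z w) _ y :=
      (hβ.hasFDerivAt.clm_apply (hasFDerivAt_const w y)).const_mul Complex.I
    have h3 : (fun z => β z (J z w)) =ᶠ[𝓝 y] fun z => Complex.I * β z w := by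
      filter_upwards [h] with z hz using hz w
    have h4 := congrArg (fun L : E6 →L[ℝ] ℂ => L v) ((h3.hasFDerivAt_iff.1 h1).unique h2)
    simp at h4
    linear_combination h4
  simp only [part02, extDerivOne, jetExtDeriv, hD, hsq, map_neg]
  ring_nf
  simp only [Complex.I_sq, Complex.I_pow_three]
  ring

end LagrangianSmooth

/-! ### Weak derivatives: uniqueness and product rule. -/

section WeakDerivatives

variable {X Y : Type*} [NormedAddCommGroup X] [NormedSpace ℝ X] [NormedAddCommGroup Y]
  [NormedSpace ℝ Y]

theorem contDiff_of_eq_zero_off_compact {Ω K : Set E6} (hΩ : IsOpen Ω) (hK : IsCompact K)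
    (hKΩ : K ⊆ Ω) {F : E6 → Y} (hF : ContDiffOn ℝ ∞ F Ω) (h0 : ∀ y ∉ K, F y = 0) :
    ContDiff ℝ ∞ F := by
  refine contDiff_iff_contDiffAt.2 fun x => ?_
  by_cases hx : x ∈ Ω
  · exact hF.contDiffAt (hΩ.mem_nhds hx)
  · have hev : F =ᶠ[𝓝 x] fun _ => 0 := by
      filter_upwards [hK.isClosed.isOpen_compl.mem_nhds fun h => hx (hKΩ h)] with y hy
      exact h0 y hy
    exact contDiffAt_const.congr_of_eventuallyEq hev

theorem fderiv_eq_zero_off_compact {K : Set E6} (hK : IsCompact K) {F : E6 → Y}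
    (h0 : ∀ y ∉ K, F y = 0) : ∀ y ∉ K, fderiv ℝ F y = 0 := by
  intro y hy
  have hev : F =ᶠ[𝓝 y] fun _ => 0 := by
    filter_upwards [hK.isClosed.isOpen_compl.mem_nhds hy] with z hz
    exact h0 z hz
  rw [hev.fderiv_eq]
  simp

theorem tsupport_subset_of_eq_zero {Z : Type*} [Zero Z] {K : Set E6} (hK : IsCompact K)
    {F : E6 → Z}
    (h0 : ∀ y ∉ K, F y = 0) : tsupport F ⊆ K :=
  closure_minimal (fun y hy => by_contra fun h => hy (h0 y h)) hK.isClosed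

theorem integrable_clm_apply_of_compact {Ω K : Set E6} (hK : IsCompact K) (hKΩ : K ⊆ Ω)
    {ψ : E6 → X →L[ℝ] Y} (hψ : Continuous ψ) (h0 : ∀ y ∉ K, ψ y = 0) {f : E6 → X}
    (hf : LocallyIntegrableOn f Ω) : Integrable fun y => ψ y (f y) := by
  have hfK := hf.integrableOn_compact_subset hKΩ hK
  obtain ⟨C, hC⟩ := hK.exists_bound_of_continuousOn hψ.continuousOn
  have hint : IntegrableOn (fun y => ψ y (f y)) K := by
    refine Integrable.mono' (hfK.norm.const_mul C)
      (isBoundedBilinearMap_apply.continuous.comp_aestronglyMeasurable₂ hψ.aestronglyMeasurable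
        hfK.aestronglyMeasurable) ?_
    filter_upwards [ae_restrict_mem hK.measurableSet] with y hy
    exact (ψ y).le_of_opNorm_le (hC y hy) _
  refine (integrableOn_iff_integrable_of_support_subset fun y hy => ?_).1 hint
  by_contra h
  exact hy (by simp [h0 y h])

theorem integrable_smul_of_compact {Ω K : Set E6} (hK : IsCompact K) (hKΩ : K ⊆ Ω)
    {φ : E6 → ℝ} (hφ : Continuous φ) (h0 : ∀ y ∉ K, φ y = 0) {f : E6 → X}
    (hf : LocallyIntegrableOn f Ω) : Integrable fun y => φ y • f y :=
  integrable_clm_apply_of_compact (ψ := fun y => φ y • ContinuousLinearMap.id ℝ X) hK hKΩ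
    (hφ.smul continuous_const) (fun y hy => by rw [h0 y hy, zero_smul]) hf

theorem continuousOn_fderiv_of_contDiffOn {Ω : Set E6} (hΩ : IsOpen Ω) {u : E6 → Y}
    (hu : ContDiffOn ℝ ∞ u Ω) : ContinuousOn (fderiv ℝ u) Ω :=
  hu.continuousOn_fderiv_of_isOpen hΩ (by simp)

/-- Integration by parts against a compactly supported smooth function. -/
theorem integral_fderiv_smul_of_compact {Ω K : Set E6} (hΩ : IsOpen Ω) (hK : IsCompact K)
    (hKΩ : K ⊆ Ω) {φ : E6 → ℝ} (hφ : ContDiff ℝ ∞ φ) (h0 : ∀ y ∉ K, φ y = 0) {u : E6 → Y}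
    (hu : ContDiffOn ℝ ∞ u Ω) (v : E6) :
    ∫ y, fderiv ℝ φ y v • u y = -∫ y, φ y • fderiv ℝ u y v := by
  have hφ' : Continuous fun y => fderiv ℝ φ y v :=
    (hφ.continuous_fderiv (by simp)).clm_apply continuous_const
  have hu0 : LocallyIntegrableOn u Ω := hu.continuousOn.locallyIntegrableOn hΩ.measurableSet
  have hu1 : LocallyIntegrableOn (fun y => fderiv ℝ u y v) Ω :=
    ((continuousOn_fderiv_of_contDiffOn hΩ hu).clm_apply continuousOn_const).locallyIntegrableOn
      hΩ.measurableSet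
  rw [integral_smul_fderiv_eq_neg_fderiv_smul_of_integrable, neg_neg]
  · exact integrable_smul_of_compact hK hKΩ hφ'
      (fun y hy => by rw [fderiv_eq_zero_off_compact hK h0 y hy]; rfl) hu0
  · exact integrable_smul_of_compact hK hKΩ hφ.continuous h0 hu1
  · exact integrable_smul_of_compact hK hKΩ hφ.continuous h0 hu0
  · exact fun x _ => hφ.differentiable (by simp) x
  · intro x hx
    have hxΩ := hKΩ (tsupport_subset_of_eq_zero hK h0 hx)
    exact (hu.contDiffAt (hΩ.mem_nhds hxΩ)).differentiableAt (by simp)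

theorem IsWeakDerivOn.test {Ω K : Set E6} {f : E6 → E6 →L[ℝ] E6}
    {D : E6 → E6 →L[ℝ] E6 →L[ℝ] E6} (h : IsWeakDerivOn Ω f D) (hK : IsCompact K) (hKΩ : K ⊆ Ω)
    {φ : E6 → ℝ} (hφ : ContDiff ℝ ∞ φ) (h0 : ∀ y ∉ K, φ y = 0) (v : E6) :
    ∫ y, fderiv ℝ φ y v • f y = -∫ y, φ y • D y v :=
  h.2.2 φ hφ (HasCompactSupport.intro hK h0) ((tsupport_subset_of_eq_zero hK h0).trans hKΩ) v

theorem locallyIntegrableOn_apply {Ω : Set E6} (hΩ : IsOpen Ω) {D : E6 → E6 →L[ℝ] X}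
    (hD : LocallyIntegrableOn D Ω) (v : E6) : LocallyIntegrableOn (fun y => D y v) Ω := by
  rw [locallyIntegrableOn_iff hΩ.isLocallyClosed] at hD ⊢
  intro k hk hkc
  exact ((ContinuousLinearMap.apply ℝ X v).integrable_comp (hD k hk hkc))

theorem locallyIntegrableOn_clm_apply {Ω : Set E6} (hΩ : IsOpen Ω) {T : E6 → X →L[ℝ] Y}
    (hT : ContinuousOn T Ω) {f : E6 → X} (hf : LocallyIntegrableOn f Ω) :
    LocallyIntegrableOn (fun y => T y (f y)) Ω := by
  rw [locallyIntegrableOn_iff hΩ.isLocallyClosed] at hf ⊢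
  intro K hKΩ hK
  have hfK := hf K hKΩ hK
  obtain ⟨C, hC⟩ := hK.exists_bound_of_continuousOn (hT.mono hKΩ)
  refine Integrable.mono' (hfK.norm.const_mul C)
    (isBoundedBilinearMap_apply.continuous.comp_aestronglyMeasurable₂
      ((hT.mono hKΩ).aestronglyMeasurable_of_isCompact hK hK.measurableSet)
      hfK.aestronglyMeasurable) ?_
  filter_upwards [ae_restrict_mem hK.measurableSet] with y hy
  exact (T y).le_of_opNorm_le (hC y hy) _

/-- Weak derivatives are unique. -/
theorem IsWeakDerivOn.ae_eq {Ω : Set E6} (hΩ : IsOpen Ω) {f f' : E6 → E6 →L[ℝ] E6}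
    {D D' : E6 → E6 →L[ℝ] E6 →L[ℝ] E6} (h : IsWeakDerivOn Ω f D) (h' : IsWeakDerivOn Ω f' D')
    (hff : EqOn f f' Ω) : ∀ᵐ y, y ∈ Ω → D y = D' y := by
  have key : ∀ v : E6, ∀ᵐ y, y ∈ Ω → D y v - D' y v = 0 := by
    intro v
    have hl := locallyIntegrableOn_apply hΩ h.2.1 v
    have hl' := locallyIntegrableOn_apply hΩ h'.2.1 v
    refine hΩ.ae_eq_zero_of_integral_contDiff_smul_eq_zero (hl.sub hl') fun φ hφ hc hs => ?_
    have h0 : ∀ y ∉ tsupport φ, φ y = 0 := fun y hy => image_eq_zero_of_notMem_tsupport hy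
    have e : ∫ y, fderiv ℝ φ y v • f y = ∫ y, fderiv ℝ φ y v • f' y := by
      refine integral_congr_ae (ae_of_all _ fun y => ?_)
      by_cases hy : y ∈ tsupport φ
      · simp only [hff (hs hy)]
      · simp only [fderiv_eq_zero_off_compact hc h0 y hy, _root_.zero_apply, zero_smul]
    rw [h.2.2 φ hφ hc hs v, h'.2.2 φ hφ hc hs v, neg_inj] at e
    simp only [smul_sub]
    rw [integral_sub (integrable_smul_of_compact hc hs hφ.continuous h0 hl)
      (integrable_smul_of_compact hc hs hφ.continuous h0 hl'), e, sub_self]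
  -- The exceptional null set depends on the direction, so only six basis directions are used.
  have hall : ∀ᵐ y, ∀ i : Fin 6, y ∈ Ω → D y (stdBasis i) - D' y (stdBasis i) = 0 :=
    ae_all_iff.2 fun i => key _
  filter_upwards [hall] with y hy hyΩ
  refine ContinuousLinearMap.coe_injective (stdBasis.ext fun i => ?_)
  exact sub_eq_zero.1 (hy i hyΩ)

theorem isWeakDerivOn_fderiv {Ω : Set E6} (hΩ : IsOpen Ω) {f : E6 → E6 →L[ℝ] E6}
    (hf : ContDiffOn ℝ ∞ f Ω) : IsWeakDerivOn Ω f (fderiv ℝ f) := by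
  refine ⟨hf.continuousOn.locallyIntegrableOn hΩ.measurableSet,
    (continuousOn_fderiv_of_contDiffOn hΩ hf).locallyIntegrableOn hΩ.measurableSet,
    fun φ hφ hc hs v => ?_⟩
  exact integral_fderiv_smul_of_compact hΩ hc hs hφ
    (fun y hy => image_eq_zero_of_notMem_tsupport hy) hf v

/-- Weak derivatives tested against operator-valued functions. -/
theorem IsWeakDerivOn.test_clm {Ω K : Set E6} (hΩ : IsOpen Ω) {f : E6 → E6 →L[ℝ] E6}
    {D : E6 → E6 →L[ℝ] E6 →L[ℝ] E6} (h : IsWeakDerivOn Ω f D) (hK : IsCompact K) (hKΩ : K ⊆ Ω)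
    {ψ : E6 → (E6 →L[ℝ] E6) →L[ℝ] (E6 →L[ℝ] E6)} (hψ : ContDiff ℝ ∞ ψ) (h0 : ∀ y ∉ K, ψ y = 0)
    (v : E6) : ∫ y, fderiv ℝ ψ y v (f y) = -∫ y, ψ y (D y v) := by
  have : Module.Free ℝ ((E6 →L[ℝ] E6) →L[ℝ] (E6 →L[ℝ] E6)) := Module.Free.of_divisionRing ℝ _
  -- In a basis of the space of operators the coefficients of ψ are scalar test functions, to which
  -- the definition of the weak derivative applies.
  let b := Module.finBasis ℝ ((E6 →L[ℝ] E6) →L[ℝ] (E6 →L[ℝ] E6))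
  let c := fun k => LinearMap.toContinuousLinearMap (b.coord k)
  have hsum : ∀ A, A = ∑ k, c k A • b k := fun A => (b.sum_repr A).symm
  have hφ : ∀ k, ContDiff ℝ ∞ fun y => c k (ψ y) := fun k => (c k).contDiff.comp hψ
  have hφ0 : ∀ k, ∀ y ∉ K, c k (ψ y) = 0 := fun k y hy => by rw [h0 y hy, map_zero]
  have hfd : ∀ k y, fderiv ℝ (fun y => c k (ψ y)) y v = c k (fderiv ℝ ψ y v) := by
    intro k y
    have := ((c k).hasFDerivAt.comp y (hψ.differentiable (by simp) y).hasFDerivAt).fderiv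
    exact congrArg (fun L : E6 →L[ℝ] ℝ => L v) this
  have htest := fun k => h.test hK hKΩ (hφ k) (hφ0 k) v
  simp only [hfd] at htest
  have hi1 : ∀ k, Integrable fun y => c k (fderiv ℝ ψ y v) • f y := fun k => by
    refine integrable_smul_of_compact hK hKΩ ?_ (fun y hy => ?_) h.1
    · exact (c k).continuous.comp
        ((hψ.continuous_fderiv (by simp)).clm_apply continuous_const)
    · rw [fderiv_eq_zero_off_compact hK h0 y hy]
      simp
  have hi2 : ∀ k, Integrable fun y => c k (ψ y) • D y v := fun k =>
    integrable_smul_of_compact hK hKΩ (hφ k).continuous (hφ0 k)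
      (locallyIntegrableOn_apply hΩ h.2.1 v)
  have e1 : ∀ y, fderiv ℝ ψ y v (f y) = ∑ k, b k (c k (fderiv ℝ ψ y v) • f y) := fun y => by
    conv_lhs => rw [hsum (fderiv ℝ ψ y v), _root_.sum_apply]
    refine Finset.sum_congr rfl fun k _ => ?_
    rw [map_smul]
    rfl
  have e2 : ∀ y, ψ y (D y v) = ∑ k, b k (c k (ψ y) • D y v) := fun y => by
    conv_lhs => rw [hsum (ψ y), _root_.sum_apply]
    refine Finset.sum_congr rfl fun k _ => ?_
    rw [map_smul]
    rfl
  simp only [e1, e2]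
  rw [integral_finsetSum _ fun k _ => (b k).integrable_comp (hi1 k),
    integral_finsetSum _ fun k _ => (b k).integrable_comp (hi2 k), ← Finset.sum_neg_distrib]
  refine Finset.sum_congr rfl fun k _ => ?_
  rw [(b k).integral_comp_comm (hi1 k), (b k).integral_comp_comm (hi2 k), htest k, map_neg]

/-- The product rule for weak derivatives. -/
theorem IsWeakDerivOn.clm_apply {Ω : Set E6} (hΩ : IsOpen Ω) {f : E6 → E6 →L[ℝ] E6}
    {D : E6 → E6 →L[ℝ] E6 →L[ℝ] E6} (h : IsWeakDerivOn Ω f D)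
    {T : E6 → (E6 →L[ℝ] E6) →L[ℝ] (E6 →L[ℝ] E6)} (hT : ContDiffOn ℝ ∞ T Ω) :
    IsWeakDerivOn Ω (fun y => T y (f y))
      fun y => (T y).comp (D y) + (fderiv ℝ T y).flip (f y) := by
  have hT1 := continuousOn_fderiv_of_contDiffOn hΩ hT
  have hl1 : LocallyIntegrableOn (fun y => (T y).comp (D y)) Ω :=
    locallyIntegrableOn_clm_apply (T := fun y =>
      ContinuousLinearMap.compL ℝ E6 (E6 →L[ℝ] E6) (E6 →L[ℝ] E6) (T y)) hΩ
      ((ContinuousLinearMap.continuous _).comp_continuousOn hT.continuousOn) h.2.1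
  have hl2 : LocallyIntegrableOn (fun y => (fderiv ℝ T y).flip (f y)) Ω :=
    locallyIntegrableOn_clm_apply (T := fun y => (fderiv ℝ T y).flip) hΩ
      ((ContinuousLinearMap.flipₗᵢ ℝ E6 (E6 →L[ℝ] E6)
        (E6 →L[ℝ] E6)).continuous.comp_continuousOn hT1) h.1
  refine ⟨locallyIntegrableOn_clm_apply hΩ hT.continuousOn h.1, hl1.add hl2,
    fun φ hφ hc hs v => ?_⟩
  have h0 : ∀ y ∉ tsupport φ, φ y = 0 := fun y hy => image_eq_zero_of_notMem_tsupport hy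
  have hψ0 : ∀ y ∉ tsupport φ, φ y • T y = 0 := fun y hy => by rw [h0 y hy, zero_smul]
  -- T is smooth on Ω only, but its product with φ vanishes off a compact subset of Ω and is a
  -- smooth operator-valued test function on ℝ⁶.
  have hψ : ContDiff ℝ ∞ fun y => φ y • T y :=
    contDiff_of_eq_zero_off_compact hΩ hc hs (hφ.contDiffOn.smul hT) hψ0
  have htest := h.test_clm hΩ hc hs hψ hψ0 v
  have e1 : ∀ y, fderiv ℝ (fun y => φ y • T y) y v (f y) =
      fderiv ℝ φ y v • T y (f y) + φ y • fderiv ℝ T y v (f y) := by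
    intro y
    by_cases hy : y ∈ tsupport φ
    · have hTy := (hT.contDiffAt (hΩ.mem_nhds (hs hy))).differentiableAt (by simp)
      rw [fderiv_fun_smul (hφ.differentiable (by simp) y) hTy]
      simp [add_comm]
    · rw [fderiv_eq_zero_off_compact hc hψ0 y hy, fderiv_eq_zero_off_compact hc h0 y hy, h0 y hy]
      simp
  have hi1 : Integrable fun y => fderiv ℝ φ y v • T y (f y) :=
    integrable_smul_of_compact hc hs
      ((hφ.continuous_fderiv (by simp)).clm_apply continuous_const)
      (fun y hy => by rw [fderiv_eq_zero_off_compact hc h0 y hy]; rfl)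
      (locallyIntegrableOn_clm_apply hΩ hT.continuousOn h.1)
  have hi2 : Integrable fun y => φ y • fderiv ℝ T y v (f y) :=
    integrable_smul_of_compact hc hs hφ.continuous h0 (locallyIntegrableOn_apply hΩ hl2 v)
  have hi3 : Integrable fun y => φ y • T y (D y v) :=
    integrable_smul_of_compact hc hs hφ.continuous h0 (locallyIntegrableOn_apply hΩ hl1 v)
  simp only [e1] at htest
  rw [integral_add hi1 hi2] at htest
  have e2 : ∀ y, φ y • ((T y).comp (D y) + (fderiv ℝ T y).flip (f y)) v =
      φ y • T y (D y v) + φ y • fderiv ℝ T y v (f y) := fun y => by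
    rw [← smul_add]; rfl
  simp only [e2]
  rw [integral_add hi3 hi2, neg_add]
  exact eq_add_neg_of_add_eq htest

end WeakDerivatives

/-! ### Changes of coordinates and the chain rule for weak derivatives. -/

section Transitions

variable {X Y : Type*} [NormedAddCommGroup X] [NormedSpace ℝ X] [NormedAddCommGroup Y]
  [NormedSpace ℝ Y]

/-- `Φ` and `Ψ` are inverse diffeomorphisms between open subsets `Ω`, `Ω'` of `ℝ⁶`. -/
structure SmoothTransition (Φ Ψ : E6 → E6) (Ω Ω' : Set E6) : Prop where
  isOpen_source : IsOpen Ω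
  isOpen_target : IsOpen Ω'
  contDiffOn : ContDiffOn ℝ ∞ Φ Ω
  contDiffOn_symm : ContDiffOn ℝ ∞ Ψ Ω'
  mapsTo : MapsTo Φ Ω Ω'
  mapsTo_symm : MapsTo Ψ Ω' Ω
  left_inv : ∀ x ∈ Ω, Ψ (Φ x) = x
  right_inv : ∀ x ∈ Ω', Φ (Ψ x) = x

namespace SmoothTransition

variable {Φ Ψ : E6 → E6} {Ω Ω' : Set E6}

theorem symm (h : SmoothTransition Φ Ψ Ω Ω') : SmoothTransition Ψ Φ Ω' Ω :=
  ⟨h.isOpen_target, h.isOpen_source, h.contDiffOn_symm, h.contDiffOn, h.mapsTo_symm, h.mapsTo,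
    h.right_inv, h.left_inv⟩

theorem differentiableAt (h : SmoothTransition Φ Ψ Ω Ω') {x : E6} (hx : x ∈ Ω) :
    DifferentiableAt ℝ Φ x :=
  (h.contDiffOn.contDiffAt (h.isOpen_source.mem_nhds hx)).differentiableAt (by simp)

theorem contDiffOn_fderiv (h : SmoothTransition Φ Ψ Ω Ω') : ContDiffOn ℝ ∞ (fderiv ℝ Φ) Ω :=
  h.contDiffOn.fderiv_of_isOpen h.isOpen_source (by simp)

theorem image_eq (h : SmoothTransition Φ Ψ Ω Ω') : Φ '' Ω = Ω' := by
  refine Subset.antisymm h.mapsTo.image_subset fun x hx => ⟨Ψ x, h.mapsTo_symm hx, h.right_inv x hx⟩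

theorem injOn (h : SmoothTransition Φ Ψ Ω Ω') : InjOn Φ Ω := fun x hx y hy hxy => by
  rw [← h.left_inv x hx, hxy, h.left_inv y hy]

theorem fderiv_comp_fderiv (h : SmoothTransition Φ Ψ Ω Ω') {x : E6} (hx : x ∈ Ω) :
    (fderiv ℝ Ψ (Φ x)).comp (fderiv ℝ Φ x) = ContinuousLinearMap.id ℝ E6 := by
  rw [← fderiv_comp x (h.symm.differentiableAt (h.mapsTo hx)) (h.differentiableAt hx)]
  have hev : Ψ ∘ Φ =ᶠ[𝓝 x] id := by
    filter_upwards [h.isOpen_source.mem_nhds hx] with z hz using h.left_inv z hz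
  rw [hev.fderiv_eq, fderiv_id]

theorem det_fderiv_ne_zero (h : SmoothTransition Φ Ψ Ω Ω') {x : E6} (hx : x ∈ Ω) :
    (fderiv ℝ Φ x).det ≠ 0 := by
  have h1 : LinearMap.det ((fderiv ℝ Ψ (Φ x) : E6 →ₗ[ℝ] E6) ∘ₗ (fderiv ℝ Φ x : E6 →ₗ[ℝ] E6)) =
      LinearMap.det (LinearMap.id : E6 →ₗ[ℝ] E6) :=
    congrArg (fun A : E6 →L[ℝ] E6 => LinearMap.det (A : E6 →ₗ[ℝ] E6)) (h.fderiv_comp_fderiv hx)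
  rw [LinearMap.det_comp, LinearMap.det_id] at h1
  exact right_ne_zero_of_mul_eq_one h1

theorem setIntegral_eq (h : SmoothTransition Φ Ψ Ω Ω') (g : E6 → Y) :
    ∫ x in Ω', g x = ∫ x in Ω, |(fderiv ℝ Φ x).det| • g (Φ x) := by
  rw [← h.image_eq]
  exact integral_image_eq_integral_abs_det_fderiv_smul volume h.isOpen_source.measurableSet
    (fun x hx => (h.differentiableAt hx).hasFDerivAt.hasFDerivWithinAt) h.injOn g

theorem locallyIntegrableOn_comp (h : SmoothTransition Φ Ψ Ω Ω') {f : E6 → X}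
    (hf : LocallyIntegrableOn f Ω') : LocallyIntegrableOn (fun x => f (Φ x)) Ω := by
  rw [locallyIntegrableOn_iff h.isOpen_source.isLocallyClosed]
  intro K hK hKc
  have hcont : ContinuousOn Φ K := h.contDiffOn.continuousOn.mono hK
  have hint := hf.integrableOn_compact_subset (h.mapsTo.mono_left hK).image_subset
    (hKc.image_of_continuousOn hcont)
  rw [integrableOn_image_iff_integrableOn_abs_det_fderiv_smul volume hKc.measurableSet
    (fun x hx => (h.differentiableAt (hK hx)).hasFDerivAt.hasFDerivWithinAt)
    (h.injOn.mono hK)] at hint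
  -- The change of variables gives integrability of f∘Φ weighted by the Jacobian; the Jacobian is
  -- continuous and nonzero on K, so it can be divided out.
  have hdet : ContinuousOn (fun x => |(fderiv ℝ Φ x).det|⁻¹) K := by
    refine ContinuousOn.inv₀ ?_ fun x hx => abs_ne_zero.2 (h.det_fderiv_ne_zero (hK hx))
    exact (ContinuousLinearMap.continuous_det.comp_continuousOn
      (h.contDiffOn_fderiv.continuousOn.mono hK)).abs
  have := hint.continuousOn_smul hdet hKc
  refine this.congr_fun (fun x hx => ?_) hKc.measurableSet
  change |(fderiv ℝ Φ x).det|⁻¹ • |(fderiv ℝ Φ x).det| • f (Φ x) = f (Φ x)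
  rw [inv_smul_smul₀ (abs_ne_zero.2 (h.det_fderiv_ne_zero (hK hx)))]

end SmoothTransition

theorem contDiff_det : ContDiff ℝ ∞ fun A : E6 →L[ℝ] E6 => A.det := by
  have h : (fun A : E6 →L[ℝ] E6 => A.det) = fun A : E6 →L[ℝ] E6 => ∑ σ : Equiv.Perm (Fin 6),
      ((Equiv.Perm.sign σ : ℤ) : ℝ) *
        ∏ i, LinearMap.toMatrix stdBasis stdBasis (A : E6 →ₗ[ℝ] E6) (σ i) i := by
    ext A
    rw [ContinuousLinearMap.det, ← LinearMap.det_toMatrix stdBasis, Matrix.det_apply']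
  rw [h]
  refine ContDiff.sum fun σ _ => contDiff_const.mul (contDiff_prod fun i _ => ?_)
  let c : (E6 →L[ℝ] E6) →ₗ[ℝ] ℝ :=
    { toFun := fun A => LinearMap.toMatrix stdBasis stdBasis (A : E6 →ₗ[ℝ] E6) (σ i) i
      map_add' := fun A B => by simp
      map_smul' := fun r A => by simp }
  exact (LinearMap.toContinuousLinearMap c).contDiff

namespace SmoothTransition

variable {Φ Ψ : E6 → E6} {Ω Ω' : Set E6}

theorem contDiffOn_abs_det (h : SmoothTransition Φ Ψ Ω Ω') :
    ContDiffOn ℝ ∞ (fun x => |(fderiv ℝ Φ x).det|) Ω := fun x hx =>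
  ContDiffAt.comp_contDiffWithinAt (g := fun t : ℝ => |t|) x
    (contDiffAt_abs (h.det_fderiv_ne_zero hx))
    (contDiff_det.contDiffAt.comp_contDiffWithinAt x (h.contDiffOn_fderiv x hx))

/-- Change of variables for an integrand supported in a compact subset of the domain. -/
theorem integral_indicator_eq (h : SmoothTransition Φ Ψ Ω Ω') (G : E6 → Y)
    (h0 : ∀ z ∉ Ω, G z = 0) :
    ∫ x, Ω'.indicator (fun x => |(fderiv ℝ Ψ x).det| • G (Ψ x)) x = ∫ z, G z := by
  rw [integral_indicator h.isOpen_target.measurableSet, ← h.symm.setIntegral_eq,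
    setIntegral_eq_integral_of_forall_compl_eq_zero h0]

/-- The pushforward of the vector field `φ v` as a density, and its divergence. -/
theorem exists_pushforward (h : SmoothTransition Φ Ψ Ω Ω') {K : Set E6} (hK : IsCompact K)
    (hKΩ : K ⊆ Ω) {φ : E6 → ℝ} (hφ : ContDiff ℝ ∞ φ) (h0 : ∀ y ∉ K, φ y = 0) (v : E6) :
    ∃ Z : E6 → E6, ContDiff ℝ ∞ Z ∧ (∀ x ∉ Φ '' K, Z x = 0) ∧
      (∀ {Y : Type} [NormedAddCommGroup Y] [NormedSpace ℝ Y] (w : E6 → E6 →L[ℝ] Y),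
        ∫ x, w x (Z x) = ∫ z, φ z • w (Φ z) (fderiv ℝ Φ z v)) ∧
      ∀ {Y : Type} [NormedAddCommGroup Y] [NormedSpace ℝ Y] [CompleteSpace Y] (u : E6 → Y),
        ∫ x, (∑ i, fderiv ℝ (fun x => Z x i) x (stdFrame i)) • u x =
          ∫ z, fderiv ℝ φ z v • u (Φ z) := by
  set K' := Φ '' K with hK'def
  have hK' : IsCompact K' := hK.image_of_continuousOn (h.contDiffOn.continuousOn.mono hKΩ)
  have hK'Ω : K' ⊆ Ω' := (h.mapsTo.mono_left hKΩ).image_subset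
  have hoff : ∀ x ∈ Ω', x ∉ K' → Ψ x ∉ K := fun x hx hxK hΨ =>
    hxK ⟨Ψ x, hΨ, h.right_inv x hx⟩
  have hdφ0 := fderiv_eq_zero_off_compact hK h0
  -- Z is the image of the vector field φ v, multiplied by the Jacobian of the inverse map so that
  -- integrals against it transform without a weight.
  set Z : E6 → E6 := Ω'.indicator fun x =>
    |(fderiv ℝ Ψ x).det| • φ (Ψ x) • fderiv ℝ Φ (Ψ x) v with hZdef
  have hZ0 : ∀ x ∉ K', Z x = 0 := by
    intro x hx
    by_cases hxΩ : x ∈ Ω'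
    · rw [hZdef, indicator_of_mem hxΩ, h0 _ (hoff x hxΩ hx), zero_smul, smul_zero]
    · rw [hZdef, indicator_of_notMem hxΩ]
  have hZsm : ContDiff ℝ ∞ Z := by
    refine contDiff_of_eq_zero_off_compact h.isOpen_target hK' hK'Ω ?_ hZ0
    refine ContDiffOn.congr ?_ fun x hx => indicator_of_mem hx _
    refine h.symm.contDiffOn_abs_det.smul ((hφ.comp_contDiffOn h.contDiffOn_symm).smul ?_)
    exact (h.contDiffOn_fderiv.comp h.contDiffOn_symm h.mapsTo_symm).clm_apply contDiffOn_const
  have hI2 : ∀ {Y : Type} [NormedAddCommGroup Y] [NormedSpace ℝ Y] (w : E6 → E6 →L[ℝ] Y),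
      ∫ x, w x (Z x) = ∫ z, φ z • w (Φ z) (fderiv ℝ Φ z v) := by
    intro Y _ _ w
    rw [← h.integral_indicator_eq (fun z => φ z • w (Φ z) (fderiv ℝ Φ z v))
      fun z hz => by rw [h0 z fun hzK => hz (hKΩ hzK), zero_smul]]
    refine integral_congr_ae (ae_of_all _ fun x => ?_)
    by_cases hx : x ∈ Ω'
    · simp only [hZdef, indicator_of_mem hx, map_smul, h.right_inv x hx]
    · simp only [hZdef, indicator_of_notMem hx, map_zero]
  -- H is what the divergence of Z has to be: the divergence of φ v, transported as a density.
  set H : E6 → ℝ := Ω'.indicator fun x => |(fderiv ℝ Ψ x).det| • fderiv ℝ φ (Ψ x) v with hHdef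
  have hI1 : ∀ {Y : Type} [NormedAddCommGroup Y] [NormedSpace ℝ Y] (u : E6 → Y),
      ∫ x, H x • u x = ∫ z, fderiv ℝ φ z v • u (Φ z) := by
    intro Y _ _ u
    rw [← h.integral_indicator_eq (fun z => fderiv ℝ φ z v • u (Φ z))
      fun z hz => by rw [hdφ0 z fun hzK => hz (hKΩ hzK), _root_.zero_apply, zero_smul]]
    refine integral_congr_ae (ae_of_all _ fun x => ?_)
    by_cases hx : x ∈ Ω'
    · simp only [hHdef, indicator_of_mem hx, h.right_inv x hx, smul_assoc]
    · simp only [hHdef, indicator_of_notMem hx, zero_smul]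
  have hH0 : ∀ x ∉ K', H x = 0 := by
    intro x hx
    by_cases hxΩ : x ∈ Ω'
    · rw [hHdef, indicator_of_mem hxΩ, hdφ0 _ (hoff x hxΩ hx), _root_.zero_apply, smul_zero]
    · rw [hHdef, indicator_of_notMem hxΩ]
  have hHcont : ContinuousOn H Ω' := by
    have hc : ContinuousOn (fun x => |(fderiv ℝ Ψ x).det| • fderiv ℝ φ (Ψ x) v) Ω' :=
      h.symm.contDiffOn_abs_det.continuousOn.smul
        (((hφ.continuous_fderiv (by simp)).comp_continuousOn
          h.contDiffOn_symm.continuousOn).clm_apply continuousOn_const)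
    exact hc.congr fun x hx => indicator_of_mem hx _
  have hZi : ∀ i : Fin 6, ContDiff ℝ ∞ fun x => Z x i := fun i =>
    (EuclideanSpace.proj (𝕜 := ℝ) i).contDiff.comp hZsm
  have hZi0 : ∀ i : Fin 6, ∀ x ∉ K', Z x i = 0 := fun i x hx => by rw [hZ0 x hx]; rfl
  set dv : E6 → ℝ := fun x => ∑ i, fderiv ℝ (fun x => Z x i) x (stdFrame i) with hdv
  have hdvi : ∀ i : Fin 6, Continuous fun x => fderiv ℝ (fun x => Z x i) x (stdFrame i) :=
    fun i => ((hZi i).continuous_fderiv (by simp)).clm_apply continuous_const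
  have hdvc : Continuous dv := continuous_finsetSum _ fun i _ => hdvi i
  have hdv0 : ∀ x ∉ K', dv x = 0 := fun x hx => by
    simp only [hdv]
    exact Finset.sum_eq_zero fun i _ => by
      rw [fderiv_eq_zero_off_compact hK' (hZi0 i) x hx]; rfl
  have hHl : LocallyIntegrableOn H Ω' := hHcont.locallyIntegrableOn h.isOpen_target.measurableSet
  have hdvl : LocallyIntegrableOn dv Ω' :=
    hdvc.continuousOn.locallyIntegrableOn h.isOpen_target.measurableSet
  -- Instead of differentiating the Jacobian determinant, both functions are paired with a test
  -- function g. Integration by parts on Ω gives ∫ gH = -∫ Dg(Z), and integration by parts on Ω' in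
  -- each coordinate gives the same value for the divergence.
  have hae : ∀ᵐ x, x ∈ Ω' → H x - dv x = 0 := by
    refine h.isOpen_target.ae_eq_zero_of_integral_contDiff_smul_eq_zero (hHl.sub hdvl)
      fun g hg hgc hgs => ?_
    have hg0 : ∀ y ∉ tsupport g, g y = 0 := fun y hy => image_eq_zero_of_notMem_tsupport hy
    have hgdi : ∀ i : Fin 6, Integrable fun x =>
        fderiv ℝ (fun x => Z x i) x (stdFrame i) • g x := fun i =>
      integrable_smul_of_compact hK' hK'Ω (hdvi i)
        (fun x hx => by rw [fderiv_eq_zero_off_compact hK' (hZi0 i) x hx]; rfl)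
        (hg.continuous.continuousOn.locallyIntegrableOn h.isOpen_target.measurableSet)
    have hgi : ∀ i : Fin 6, Integrable fun x => Z x i • fderiv ℝ g x (stdFrame i) := fun i =>
      integrable_smul_of_compact hK' hK'Ω (hZi i).continuous (hZi0 i)
        (((hg.continuous_fderiv (by simp)).clm_apply
          continuous_const).continuousOn.locallyIntegrableOn h.isOpen_target.measurableSet)
    have e1 : ∫ x, g x • H x = -∫ x, fderiv ℝ g x (Z x) := by
      rw [hI2 (fderiv ℝ g)]
      have e2 : ∫ x, g x • H x = ∫ x, H x • g x := by simp only [smul_eq_mul, mul_comm]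
      rw [e2, hI1 g]
      refine (integral_fderiv_smul_of_compact h.isOpen_source hK hKΩ hφ h0
        (hg.comp_contDiffOn h.contDiffOn) v).trans ?_
      congr 1
      refine integral_congr_ae (ae_of_all _ fun z => ?_)
      by_cases hz : z ∈ K
      · have hc : fderiv ℝ (g ∘ Φ) z = (fderiv ℝ g (Φ z)).comp (fderiv ℝ Φ z) :=
          fderiv_comp z (hg.differentiable (by simp) _) (h.differentiableAt (hKΩ hz))
        change φ z • fderiv ℝ (g ∘ Φ) z v = _
        rw [hc]
        rfl
      · simp only [h0 z hz, zero_smul]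
    have e3 : ∫ x, fderiv ℝ g x (Z x) = ∑ i, ∫ x, Z x i • fderiv ℝ g x (stdFrame i) := by
      rw [← integral_finsetSum _ fun i _ => hgi i]
      refine integral_congr_ae (ae_of_all _ fun x => ?_)
      have hx : Z x = ∑ i, Z x i • stdFrame i := by
        have := stdBasis.sum_repr (Z x)
        rw [coe_stdBasis] at this
        exact this.symm
      change fderiv ℝ g x (Z x) = _
      conv_lhs => rw [hx, map_sum]
      exact Finset.sum_congr rfl fun i _ => map_smul _ _ _
    have e4 : ∀ i : Fin 6, ∫ x, Z x i • fderiv ℝ g x (stdFrame i) =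
        -∫ x, fderiv ℝ (fun x => Z x i) x (stdFrame i) • g x := fun i => by
      rw [integral_fderiv_smul_of_compact h.isOpen_target hK' hK'Ω (hZi i) (hZi0 i)
        hg.contDiffOn, neg_neg]
    have e5 : ∫ x, g x • dv x = ∑ i, ∫ x, fderiv ℝ (fun x => Z x i) x (stdFrame i) • g x := by
      rw [← integral_finsetSum _ fun i _ => hgdi i]
      refine integral_congr_ae (ae_of_all _ fun x => ?_)
      simp only [hdv, smul_eq_mul, Finset.mul_sum, mul_comm]
    simp only [smul_sub]
    rw [integral_sub (integrable_smul_of_compact hgc hgs hg.continuous hg0 hHl)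
      (integrable_smul_of_compact hgc hgs hg.continuous hg0 hdvl), e1, e3, e5,
      Finset.sum_congr rfl fun i _ => e4 i, Finset.sum_neg_distrib, neg_neg, sub_self]
  refine ⟨Z, hZsm, hZ0, hI2, fun {Y} _ _ _ u => ?_⟩
  rw [← hI1 u]
  refine integral_congr_ae ?_
  filter_upwards [hae] with x hx
  by_cases hxΩ : x ∈ Ω'
  · change dv x • u x = H x • u x
    rw [sub_eq_zero.1 (hx hxΩ)]
  · have hxK : x ∉ K' := fun hxK => hxΩ (hK'Ω hxK)
    change dv x • u x = H x • u x
    rw [hdv0 x hxK, hH0 x hxK]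

/-- The chain rule for weak derivatives. -/
theorem isWeakDerivOn_comp (h : SmoothTransition Φ Ψ Ω Ω') {f : E6 → E6 →L[ℝ] E6}
    {D : E6 → E6 →L[ℝ] E6 →L[ℝ] E6} (hD : IsWeakDerivOn Ω' f D) :
    IsWeakDerivOn Ω (fun z => f (Φ z)) fun z => (D (Φ z)).comp (fderiv ℝ Φ z) := by
  refine ⟨h.locallyIntegrableOn_comp hD.1, ?_, fun φ hφ hc hs v => ?_⟩
  · exact locallyIntegrableOn_clm_apply (T := fun z =>
      (ContinuousLinearMap.compL ℝ E6 E6 (E6 →L[ℝ] E6)).flip (fderiv ℝ Φ z)) h.isOpen_source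
      ((ContinuousLinearMap.continuous _).comp_continuousOn h.contDiffOn_fderiv.continuousOn)
      (h.locallyIntegrableOn_comp hD.2.1)
  have h0 : ∀ y ∉ tsupport φ, φ y = 0 := fun y hy => image_eq_zero_of_notMem_tsupport hy
  -- The integral of ∂ᵥφ against f∘Φ becomes that of div Z against f, and each component of Z is an
  -- admissible test function on Ω'.
  obtain ⟨Z, hZ, hZ0, hI2, hI1⟩ := h.exists_pushforward hc hs hφ h0 v
  have hK' : IsCompact (Φ '' tsupport φ) :=
    IsCompact.image_of_continuousOn hc (h.contDiffOn.continuousOn.mono hs)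
  have hK'Ω : Φ '' tsupport φ ⊆ Ω' := (h.mapsTo.mono_left hs).image_subset
  have hZi : ∀ i : Fin 6, ContDiff ℝ ∞ fun x => Z x i := fun i =>
    (EuclideanSpace.proj (𝕜 := ℝ) i).contDiff.comp hZ
  have hZi0 : ∀ i : Fin 6, ∀ x ∉ Φ '' tsupport φ, Z x i = 0 := fun i x hx => by
    rw [hZ0 x hx]; rfl
  have hDi : ∀ i : Fin 6, Integrable fun x => Z x i • D x (stdFrame i) := fun i =>
    integrable_smul_of_compact hK' hK'Ω (hZi i).continuous (hZi0 i)
      (locallyIntegrableOn_apply h.isOpen_target hD.2.1 _)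
  have hfi : ∀ i : Fin 6, Integrable fun x =>
      fderiv ℝ (fun x => Z x i) x (stdFrame i) • f x := fun i =>
    integrable_smul_of_compact hK' hK'Ω
      (((hZi i).continuous_fderiv (by simp)).clm_apply continuous_const)
      (fun x hx => by rw [fderiv_eq_zero_off_compact hK' (hZi0 i) x hx]; rfl) hD.1
  have e1 : ∫ x, D x (Z x) = ∑ i, ∫ x, Z x i • D x (stdFrame i) := by
    rw [← integral_finsetSum _ fun i _ => hDi i]
    refine integral_congr_ae (ae_of_all _ fun x => ?_)
    have hx : Z x = ∑ i, Z x i • stdFrame i := by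
      have := stdBasis.sum_repr (Z x)
      rw [coe_stdBasis] at this
      exact this.symm
    change D x (Z x) = _
    conv_lhs => rw [hx, map_sum]
    exact Finset.sum_congr rfl fun i _ => map_smul _ _ _
  rw [← hI1 f]
  simp only [Finset.sum_smul]
  rw [integral_finsetSum _ fun i _ => hfi i]
  have e2 : ∫ z, φ z • ((D (Φ z)).comp (fderiv ℝ Φ z)) v = ∫ x, D x (Z x) := (hI2 D).symm
  rw [e2, e1, ← Finset.sum_neg_distrib]
  exact Finset.sum_congr rfl fun i _ => hD.test hK' hK'Ω (hZi i) (hZi0 i) _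

end SmoothTransition

end Transitions

/-! ### Integrability of the Lagrangian and its continuity in L⁶. -/

section LagrangianIntegrals

variable {μ : Measure E6} {J : E6 → E6 →L[ℝ] E6} {D : E6 → E6 →L[ℝ] E6 →L[ℝ] E6}

/-- Measurability is known only on `complexJets`; as this set is closed, the Lagrangian can be
replaced by 0 off it without changing the composite almost everywhere. -/
theorem aestronglyMeasurable_lagrangian (c₁ c₂ : ℂ) (hJ : AEStronglyMeasurable J μ)
    (hD : AEStronglyMeasurable D μ) (hq : ∀ᵐ y ∂μ, (J y, D y) ∈ complexJets) :
    AEStronglyMeasurable (fun y => lagrangian c₁ c₂ (J y, D y)) μ := by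
  classical
  have hm : Measurable (complexJets.piecewise (lagrangian c₁ c₂) 0) :=
    (contDiffOn_lagrangian c₁ c₂).continuousOn.measurable_piecewise continuousOn_const
      isClosed_complexJets.measurableSet
  have h1 : AEStronglyMeasurable
      (fun y => complexJets.piecewise (lagrangian c₁ c₂) 0 (J y, D y)) μ :=
    (hm.comp_aemeasurable (hJ.prodMk hD).aemeasurable).aestronglyMeasurable
  refine h1.congr ?_
  filter_upwards [hq] with y hy
  exact piecewise_eq_of_mem _ _ _ hy

theorem integrable_norm_pow_six (hD : MemLp D 6 μ) : Integrable (fun y => ‖D y‖ ^ 6) μ := by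
  have := hD.integrable_norm_pow (by norm_num)
  exact_mod_cast this

/-- The essential bound of J fixes the constant in `exists_lagrangian_bound`, and the sixth power of
|D| is integrable. -/
theorem integrable_lagrangian (c₁ c₂ : ℂ) (hJ : MemLp J ⊤ μ) (hD : MemLp D 6 μ)
    (hq : ∀ᵐ y ∂μ, (J y, D y) ∈ complexJets) :
    Integrable (fun y => lagrangian c₁ c₂ (J y, D y)) μ := by
  obtain ⟨C, -, hC⟩ := exists_lagrangian_bound c₁ c₂ (eLpNorm J ⊤ μ).toReal
  refine Integrable.mono' ((integrable_norm_pow_six hD).const_mul C)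
    (aestronglyMeasurable_lagrangian c₁ c₂ hJ.1 hD.1 hq) ?_
  have hb : ∀ᵐ y ∂μ, ‖J y‖ ≤ (eLpNorm J ⊤ μ).toReal := by
    rw [eLpNorm_exponent_top]
    filter_upwards [ae_le_eLpNormEssSup (f := J) (μ := μ)] with y hy
    rw [← toReal_enorm]
    refine ENNReal.toReal_mono ?_ hy
    rw [← eLpNorm_exponent_top]
    exact hJ.2.ne
  filter_upwards [hq, hb] with y hy hy'
  exact hC _ hy hy'

/-- The Lagrangian is continuous along bounded sequences that converge in `L⁶` together with
their first derivatives. -/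
theorem tendsto_integral_lagrangian [IsFiniteMeasure μ] (c₁ c₂ : ℂ)
    {Js : ℕ → E6 → E6 →L[ℝ] E6} {Ds : ℕ → E6 → E6 →L[ℝ] E6 →L[ℝ] E6}
    (hJs : ∀ n, MemLp (Js n) ⊤ μ) (hDs : ∀ n, MemLp (Ds n) 6 μ) (hJ : MemLp J ⊤ μ)
    (hD : MemLp D 6 μ) (hqs : ∀ n, ∀ᵐ y ∂μ, (Js n y, Ds n y) ∈ complexJets)
    (hq : ∀ᵐ y ∂μ, (J y, D y) ∈ complexJets)
    {R : NNReal} (hR : ∀ n, eLpNorm (Js n) ⊤ μ ≤ R)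
    (hJlim : Tendsto (fun n => eLpNorm (fun y => Js n y - J y) 6 μ) atTop (𝓝 0))
    (hDlim : Tendsto (fun n => eLpNorm (fun y => Ds n y - D y) 6 μ) atTop (𝓝 0))
    {w : E6 → ℂ} (hw : AEStronglyMeasurable w μ) {W : ℝ} (hW : ∀ᵐ y ∂μ, ‖w y‖ ≤ W) :
    Tendsto (fun n => ∫ y, w y * lagrangian c₁ c₂ (Js n y, Ds n y) ∂μ) atTop
      (𝓝 (∫ y, w y * lagrangian c₁ c₂ (J y, D y) ∂μ)) := by
  obtain ⟨C, hC0, hC⟩ := exists_lagrangian_bound c₁ c₂ R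
  have hbound : ∀ n, ∀ᵐ y ∂μ, ‖lagrangian c₁ c₂ (Js n y, Ds n y)‖ ≤ C * ‖Ds n y‖ ^ 6 := by
    intro n
    have hn := hR n
    rw [eLpNorm_exponent_top] at hn
    filter_upwards [hqs n, ae_le_eLpNormEssSup (f := Js n) (μ := μ)] with y hy hy'
    refine hC _ hy ?_
    have := hy'.trans hn
    rw [← ofReal_norm, ← ENNReal.ofReal_coe_nnreal] at this
    exact (ENNReal.ofReal_le_ofReal_iff R.coe_nonneg).1 this
  have hmeas := fun n => aestronglyMeasurable_lagrangian c₁ c₂ (hJs n).1 (hDs n).1 (hqs n)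
  have hint := fun n => integrable_lagrangian c₁ c₂ (hJs n) (hDs n) (hqs n)
  have hint0 := integrable_lagrangian c₁ c₂ hJ hD hq
  -- The convergent sequence `Ds` is uniformly integrable in L⁶, and the bound by C|D|⁶ transfers
  -- this to the Lagrangians in L¹.
  have hui : UnifIntegrable (fun n y => lagrangian c₁ c₂ (Js n y, Ds n y)) 1 μ := by
    have hD6 : UnifIntegrable Ds 6 μ :=
      unifIntegrable_of_tendsto_Lp (by norm_num) (by norm_num) hDs hD hDlim
    intro ε hε
    -- η ≤ 1 gives η⁶ ≤ η, and then η ≤ ε/(C + 1) gives Cη⁶ ≤ ε; adding 1 covers C = 0.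
    set η : ℝ := min 1 (ε / (C + 1)) with hη
    have hη0 : 0 < η := lt_min one_pos (by positivity)
    obtain ⟨δ, hδ, hδ'⟩ := hD6 hη0
    refine ⟨δ, hδ, fun n s hs hμs => ?_⟩
    have h1 := hδ' n s hs hμs
    have h2 : ∫⁻ y, ‖s.indicator (Ds n) y‖ₑ ^ 6 ∂μ ≤ ENNReal.ofReal η ^ 6 := by
      rw [eLpNorm_eq_lintegral_rpow_enorm_toReal (by norm_num) (by norm_num)] at h1
      have h3 := pow_le_pow_left' h1 6
      rw [← ENNReal.rpow_natCast, ← ENNReal.rpow_mul] at h3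
      norm_num at h3
      exact h3
    rw [eLpNorm_one_eq_lintegral_enorm]
    calc ∫⁻ y, ‖s.indicator (fun y => lagrangian c₁ c₂ (Js n y, Ds n y)) y‖ₑ ∂μ
        ≤ ∫⁻ y, ENNReal.ofReal C * ‖s.indicator (Ds n) y‖ₑ ^ 6 ∂μ := by
          refine lintegral_mono_ae ?_
          filter_upwards [hbound n] with y hy
          by_cases hys : y ∈ s
          · simp only [indicator_of_mem hys]
            rw [← ofReal_norm, ← ofReal_norm,
              ← ENNReal.ofReal_pow (norm_nonneg _), ← ENNReal.ofReal_mul hC0]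
            exact ENNReal.ofReal_le_ofReal hy
          · simp [indicator_of_notMem hys]
      _ = ENNReal.ofReal C * ∫⁻ y, ‖s.indicator (Ds n) y‖ₑ ^ 6 ∂μ := by
          refine lintegral_const_mul'' _ ?_
          exact (((hDs n).1.indicator hs).enorm).pow_const 6
      _ ≤ ENNReal.ofReal C * ENNReal.ofReal η ^ 6 := by gcongr
      _ = ENNReal.ofReal (C * η ^ 6) := by
          rw [ENNReal.ofReal_mul hC0, ENNReal.ofReal_pow hη0.le]
      _ ≤ ENNReal.ofReal ε := by
          refine ENNReal.ofReal_le_ofReal ?_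
          have h4 : η ^ 6 ≤ η := by
            calc η ^ 6 ≤ η ^ 1 := pow_le_pow_of_le_one hη0.le (min_le_left _ _) (by norm_num)
              _ = η := pow_one η
          calc C * η ^ 6 ≤ C * (ε / (C + 1)) := by
                gcongr
                exact h4.trans (min_le_right _ _)
            _ = ε * (C / (C + 1)) := by ring
            _ ≤ ε * 1 := by
                gcongr
                exact (div_le_one (by positivity)).2 (by linarith)
            _ = ε := mul_one ε
  -- Convergence in L⁶ gives pointwise convergence only along subsequences. It therefore suffices to
  -- extract from every subsequence a further one, here in two rounds, for J and then for D.
  refine tendsto_of_subseq_tendsto fun ns hns => ?_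
  have hJm : TendstoInMeasure μ (fun k => Js (ns k)) atTop J :=
    tendstoInMeasure_of_tendsto_eLpNorm (by norm_num) (fun k => (hJs _).1) hJ.1 (hJlim.comp hns)
  obtain ⟨ms, hms, hJae⟩ := hJm.exists_seq_tendsto_ae
  have hDm : TendstoInMeasure μ (fun k => Ds (ns (ms k))) atTop D :=
    tendstoInMeasure_of_tendsto_eLpNorm (by norm_num) (fun k => (hDs _).1) hD.1
      (hDlim.comp (hns.comp hms.tendsto_atTop))
  obtain ⟨ls, hls, hDae⟩ := hDm.exists_seq_tendsto_ae
  refine ⟨fun k => ms (ls k), ?_⟩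
  set ps : ℕ → ℕ := fun k => ns (ms (ls k)) with hps
  have hae : ∀ᵐ y ∂μ, Tendsto (fun k => lagrangian c₁ c₂ (Js (ps k) y, Ds (ps k) y)) atTop
      (𝓝 (lagrangian c₁ c₂ (J y, D y))) := by
    filter_upwards [hJae, hDae, hq, ae_all_iff.2 hqs] with y h1 h2 h3 h4
    have hcont := (contDiffOn_lagrangian c₁ c₂).continuousOn _ h3
    have hcont' : Tendsto (lagrangian c₁ c₂) (𝓝[complexJets] (J y, D y))
        (𝓝 (lagrangian c₁ c₂ (J y, D y))) := hcont
    have hlim : Tendsto (fun k => ((Js (ps k) y, Ds (ps k) y) : EndJet)) atTop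
        (𝓝[complexJets] ((J y, D y) : EndJet)) := by
      refine tendsto_nhdsWithin_iff.2 ⟨?_, Eventually.of_forall fun k => h4 (ps k)⟩
      have hJy : Tendsto (fun k => Js (ps k) y) atTop (𝓝 (J y)) := h1.comp hls.tendsto_atTop
      have hDy : Tendsto (fun k => Ds (ps k) y) atTop (𝓝 (D y)) := h2
      exact hJy.prodMk_nhds hDy
    have h5 := hcont'.comp hlim
    simp only [Function.comp_def] at h5
    exact h5
  have hL1 : Tendsto (fun k => eLpNorm ((fun y => lagrangian c₁ c₂ (Js (ps k) y, Ds (ps k) y)) -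
      fun y => lagrangian c₁ c₂ (J y, D y)) 1 μ) atTop (𝓝 0) := by
    -- Vitali's theorem: on a finite measure space, convergence almost everywhere and uniform
    -- integrability give convergence in L¹.
    refine tendsto_Lp_finite_of_tendsto_ae le_rfl (by norm_num) (fun k => hmeas _)
      (memLp_one_iff_integrable.2 hint0) (fun ε hε => ?_) hae
    obtain ⟨δ, hδ, h⟩ := hui hε
    exact ⟨δ, hδ, fun k => h (ps k)⟩
  have hw' : ∀ {g : E6 → ℂ}, Integrable g μ → Integrable (fun y => w y * g y) μ := fun hg =>
    hg.bdd_mul hw hW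
  refine tendsto_integral_of_L1' _ (hw' hint0).aestronglyMeasurable
    (Eventually.of_forall fun k => hw' (hint _)) ?_
  have hle : ∀ k, eLpNorm ((fun y => w y * lagrangian c₁ c₂ (Js (ps k) y, Ds (ps k) y)) -
      fun y => w y * lagrangian c₁ c₂ (J y, D y)) 1 μ ≤ ENNReal.ofReal W *
      eLpNorm ((fun y => lagrangian c₁ c₂ (Js (ps k) y, Ds (ps k) y)) -
      fun y => lagrangian c₁ c₂ (J y, D y)) 1 μ := by
    intro k
    refine eLpNorm_le_mul_eLpNorm_of_ae_le_mul ?_ 1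
    filter_upwards [hW] with y hy
    simp only [Pi.sub_apply, ← mul_sub, norm_mul]
    gcongr
  refine tendsto_of_tendsto_of_tendsto_of_le_of_le tendsto_const_nhds ?_ (fun _ => zero_le) hle
  have := ENNReal.Tendsto.const_mul (a := ENNReal.ofReal W) hL1 (Or.inr ENNReal.ofReal_ne_top)
  rwa [mul_zero] at this

end LagrangianIntegrals

/-! ### Naturality of the Lagrangian along coordinate changes. -/

section JetTransitions

namespace SmoothTransition

variable {Φ Ψ : E6 → E6} {Ω Ω' : Set E6}

theorem fderiv_fderiv_symm (h : SmoothTransition Φ Ψ Ω Ω') {y : E6} (hy : y ∈ Ω) (v w : E6) :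
    fderiv ℝ (fderiv ℝ Φ) y v w = fderiv ℝ (fderiv ℝ Φ) y w v := by
  have hc := h.contDiffOn.contDiffAt (h.isOpen_source.mem_nhds hy)
  refine (hc.isSymmSndFDerivAt ?_).eq v w
  rw [minSmoothness_of_isRCLikeNormedField]
  exact WithTop.coe_le_coe.2 le_top

theorem differentiableAt_fderiv (h : SmoothTransition Φ Ψ Ω Ω') {y : E6} (hy : y ∈ Ω) :
    DifferentiableAt ℝ (fderiv ℝ Φ) y :=
  (h.contDiffOn_fderiv.contDiffAt (h.isOpen_source.mem_nhds hy)).differentiableAt (by simp)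

/-- The second-order hypothesis of `lagrangian_naturality`, with A = DΦ and B = D²Φ, is the
derivative of the intertwining relation DΦ∘j = (j'∘Φ)∘DΦ. -/
theorem lagrangian_eq (h : SmoothTransition Φ Ψ Ω Ω') (c₁ c₂ : ℂ) {j j' : E6 → E6 →L[ℝ] E6}
    (hj : ∀ z ∈ Ω, ∀ v, j z (j z v) = -v) (hj' : ∀ z ∈ Ω', ∀ v, j' z (j' z v) = -v)
    (hjj : ∀ z ∈ Ω, ∀ v, fderiv ℝ Φ z (j z v) = j' (Φ z) (fderiv ℝ Φ z v)) {y : E6} (hy : y ∈ Ω)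
    (hd : DifferentiableAt ℝ j y) (hd' : DifferentiableAt ℝ j' (Φ y)) :
    lagrangian c₁ c₂ (j y, fderiv ℝ j y) =
      (fderiv ℝ Φ y).det * lagrangian c₁ c₂ (j' (Φ y), fderiv ℝ j' (Φ y)) := by
  refine lagrangian_naturality c₁ c₂ (q := (j y, fderiv ℝ j y))
    (q' := (j' (Φ y), fderiv ℝ j' (Φ y))) (hj y hy) (hj' _ (h.mapsTo hy)) (h.det_fderiv_ne_zero hy)
    (h.fderiv_fderiv_symm hy) (hjj y hy) fun v w => ?_
  have hΦ := (h.differentiableAt hy).hasFDerivAt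
  have hdΦ := (h.differentiableAt_fderiv hy).hasFDerivAt
  have h1 : HasFDerivAt (fun z => fderiv ℝ Φ z (j z w)) _ y :=
    hdΦ.clm_apply (hd.hasFDerivAt.clm_apply (hasFDerivAt_const w y))
  have h2 : HasFDerivAt (fun z => j' (Φ z) (fderiv ℝ Φ z w)) _ y :=
    (hd'.hasFDerivAt.comp y hΦ).clm_apply (hdΦ.clm_apply (hasFDerivAt_const w y))
  have h3 : (fun z => fderiv ℝ Φ z (j z w)) =ᶠ[𝓝 y] fun z => j' (Φ z) (fderiv ℝ Φ z w) := by
    filter_upwards [h.isOpen_source.mem_nhds hy] with z hz using hjj z hz w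
  have h4 := congrArg (fun L : E6 →L[ℝ] E6 => L v) ((h3.hasFDerivAt_iff.1 h1).unique h2)
  simp at h4
  rw [add_comm, h4, add_comm]

/-- Both sides of the intertwining relation have weak derivatives by the product and chain rules;
uniqueness equates them almost everywhere, which supplies the second-order relation without
differentiability. -/
theorem ae_lagrangian_eq (h : SmoothTransition Φ Ψ Ω Ω') (c₁ c₂ : ℂ) {j j' : E6 → E6 →L[ℝ] E6}
    (hj : ∀ z ∈ Ω, ∀ v, j z (j z v) = -v) (hj' : ∀ z ∈ Ω', ∀ v, j' z (j' z v) = -v)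
    (hjj : ∀ z ∈ Ω, ∀ v, fderiv ℝ Φ z (j z v) = j' (Φ z) (fderiv ℝ Φ z v))
    {D D' : E6 → E6 →L[ℝ] E6 →L[ℝ] E6} (hD : IsWeakDerivOn Ω j D)
    (hD' : IsWeakDerivOn Ω' j' D') :
    ∀ᵐ y, y ∈ Ω → lagrangian c₁ c₂ (j y, D y) =
      (fderiv ℝ Φ y).det * lagrangian c₁ c₂ (j' (Φ y), D' (Φ y)) := by
  let C := ContinuousLinearMap.compL ℝ E6 E6 E6
  have hT : ContDiffOn ℝ ∞ (fun z => C (fderiv ℝ Φ z)) Ω :=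
    C.contDiff.comp_contDiffOn h.contDiffOn_fderiv
  have hT' : ContDiffOn ℝ ∞ (fun z => C.flip (fderiv ℝ Φ z)) Ω :=
    C.flip.contDiff.comp_contDiffOn h.contDiffOn_fderiv
  have h1 := hD.clm_apply h.isOpen_source hT
  have h2 := (h.isWeakDerivOn_comp hD').clm_apply h.isOpen_source hT'
  have hEq : EqOn (fun z => C (fderiv ℝ Φ z) (j z)) (fun z => C.flip (fderiv ℝ Φ z) (j' (Φ z)))
      Ω := fun z hz => ContinuousLinearMap.ext fun v => hjj z hz v
  filter_upwards [h1.ae_eq h.isOpen_source h2 hEq] with y hy hyΩ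
  refine lagrangian_naturality c₁ c₂ (q := (j y, D y))
    (q' := (j' (Φ y), D' (Φ y))) (hj y hyΩ) (hj' _ (h.mapsTo hyΩ)) (h.det_fderiv_ne_zero hyΩ)
    (h.fderiv_fderiv_symm hyΩ) (hjj y hyΩ) fun v w => ?_
  have hdΦ := (h.differentiableAt_fderiv hyΩ).hasFDerivAt
  have e1 : fderiv ℝ (fun z => C (fderiv ℝ Φ z)) y = C.comp (fderiv ℝ (fderiv ℝ Φ) y) :=
    (C.hasFDerivAt.comp y hdΦ).fderiv
  have e2 : fderiv ℝ (fun z => C.flip (fderiv ℝ Φ z)) y =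
      C.flip.comp (fderiv ℝ (fderiv ℝ Φ) y) := (C.flip.hasFDerivAt.comp y hdΦ).fderiv
  have h3 := congrArg (fun L : E6 →L[ℝ] E6 →L[ℝ] E6 => L v w) (hy hyΩ)
  rw [e1, e2] at h3
  simp [C] at h3
  rw [add_comm, h3]

end SmoothTransition

end JetTransitions

/-! ### Charts, coordinate frames and diffeomorphisms in charts. -/

section Coordinates

variable {M : Type*} [TopologicalSpace M] [ChartedSpace E6 M]

theorem finrank_tangentSpace (x : M) : Module.finrank ℝ (TangentSpace (𝓡 6) x) = 6 := finrank_E6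

theorem exists_coord {p x : M} (hx : x ∈ (chartAt E6 p).source) :
    ∃ y ∈ (chartAt E6 p).target, (chartAt E6 p).symm y = x :=
  ⟨chartAt E6 p x, (chartAt E6 p).map_source hx, (chartAt E6 p).left_inv hx⟩

/-- `f` in the charts at `p` and `q`. -/
def chartTransition (f : M → M) (p q : M) (y : E6) : E6 :=
  chartAt E6 q (f ((chartAt E6 p).symm y))

/-- The domain of `chartTransition`. -/
def chartOverlap (f : M → M) (p q : M) : Set E6 :=
  (chartAt E6 p).target ∩ (chartAt E6 p).symm ⁻¹' (f ⁻¹' (chartAt E6 q).source)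

theorem chartAt_symm_chartTransition (f : Diffeomorph (𝓡 6) (𝓡 6) M M ∞) {p q : M} {y : E6}
    (hy : y ∈ chartOverlap f p q) :
    (chartAt E6 q).symm (chartTransition f p q y) = f ((chartAt E6 p).symm y) :=
  (chartAt E6 q).left_inv hy.2

/-- `J' = f^* J`. -/
def IsPullback (f : M → M) (J J' : ComplexField M) : Prop :=
  ∀ (x : M) (v : TangentSpace (𝓡 6) x),
    mfderiv (𝓡 6) (𝓡 6) f x (J'.toFun x v) = J.toFun (f x) (mfderiv (𝓡 6) (𝓡 6) f x v)

/-- With f = id, a change of charts is a special case of a diffeomorphism read in charts, so both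
are handled by the same lemmas. -/
theorem isPullback_refl (J : ComplexField M) :
    IsPullback (Diffeomorph.refl (𝓡 6) M ∞) J J := by
  intro x v
  have h : mfderiv (𝓡 6) (𝓡 6) (Diffeomorph.refl (𝓡 6) M ∞) x =
      ContinuousLinearMap.id ℝ (TangentSpace (𝓡 6) x) := mfderiv_id
  rw [h]
  rfl

variable [IsManifold (𝓡 6) ∞ M]

theorem mdifferentiableAt_chart {p x : M} (hx : x ∈ (chartAt E6 p).source) :
    MDifferentiableAt (𝓡 6) 𝓘(ℝ, E6) (chartAt E6 p) x :=
  ((contMDiffOn_chart (I := 𝓡 6) (n := ∞)).contMDiffAt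
    ((chartAt E6 p).open_source.mem_nhds hx)).mdifferentiableAt (by simp)

theorem mdifferentiableAt_chart_symm {p : M} {y : E6} (hy : y ∈ (chartAt E6 p).target) :
    MDifferentiableAt 𝓘(ℝ, E6) (𝓡 6) (chartAt E6 p).symm y :=
  ((contMDiffOn_chart_symm (I := 𝓡 6) (n := ∞)).contMDiffAt
    ((chartAt E6 p).open_target.mem_nhds hy)).mdifferentiableAt (by simp)

theorem coordInv_coordMap {p : M} {y : E6} (hy : y ∈ (chartAt E6 p).target) (v : E6) :
    coordInv p ((chartAt E6 p).symm y) (coordMap p y v) = v := by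
  have h1 : HasMFDerivAt 𝓘(ℝ, E6) 𝓘(ℝ, E6) (chartAt E6 p ∘ (chartAt E6 p).symm) y
      ((coordInv p ((chartAt E6 p).symm y)).comp (coordMap p y)) :=
    (mdifferentiableAt_chart ((chartAt E6 p).map_target hy)).hasMFDerivAt.comp y
      (mdifferentiableAt_chart_symm hy).hasMFDerivAt
  have h2 : chartAt E6 p ∘ (chartAt E6 p).symm =ᶠ[𝓝 y] id := by
    filter_upwards [(chartAt E6 p).open_target.mem_nhds hy] with z hz
    exact (chartAt E6 p).right_inv hz
  have h3 : HasFDerivAt (chartAt E6 p ∘ (chartAt E6 p).symm)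
      ((coordInv p ((chartAt E6 p).symm y)).comp (coordMap p y) : E6 →L[ℝ] E6) y := h1.hasFDerivAt
  have h4 := (h3.congr_of_eventuallyEq h2.symm).unique (hasFDerivAt_id y)
  exact congrArg (fun L : E6 →L[ℝ] E6 => L v) h4

theorem coordMap_coordInv {p : M} {y : E6} (hy : y ∈ (chartAt E6 p).target)
    (w : TangentSpace (𝓡 6) ((chartAt E6 p).symm y)) :
    coordMap p y (coordInv p ((chartAt E6 p).symm y) w) = w := by
  have hinj : Function.Injective
      (coordMap p y : E6 →ₗ[ℝ] TangentSpace (𝓡 6) ((chartAt E6 p).symm y)) :=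
    Function.LeftInverse.injective (g := coordInv p ((chartAt E6 p).symm y))
      (coordInv_coordMap hy)
  have hfin : Module.finrank ℝ E6 =
      Module.finrank ℝ (TangentSpace (𝓡 6) ((chartAt E6 p).symm y)) := by
    rw [finrank_tangentSpace, finrank_E6]
  have : FiniteDimensional ℝ (TangentSpace (𝓡 6) ((chartAt E6 p).symm y)) :=
    Module.finite_of_finrank_pos (by rw [finrank_tangentSpace]; norm_num)
  obtain ⟨v, rfl⟩ := (LinearMap.injective_iff_surjective_of_finrank_eq_finrank hfin).1 hinj w
  exact congrArg (coordMap p y) (coordInv_coordMap hy v)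

/-- The inverse of the differential of the preferred chart at `p`, at a point `x`. -/
def coordLift (p x : M) : E6 →L[ℝ] TangentSpace (𝓡 6) x := (coordInv p x).inverse

/-- `coordMap` has values in the tangent space at `(chartAt E6 p).symm y`, `coordLift` in that at a
free point x; the latter avoids transport along equalities of base points. -/
theorem coordMap_eq_coordLift {p : M} {y : E6} (hy : y ∈ (chartAt E6 p).target) :
    coordMap p y = coordLift p ((chartAt E6 p).symm y) := by
  rw [coordLift, ContinuousLinearMap.inverse_eq (g := coordMap p y)]
  · ext v : 1
    exact coordInv_coordMap hy v
  · ext w : 1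
    exact coordMap_coordInv hy w

theorem coordInv_coordLift {p x : M} (hx : x ∈ (chartAt E6 p).source) (v : E6) :
    coordInv p x (coordLift p x v) = v := by
  obtain ⟨y, hy, rfl⟩ := exists_coord hx
  rw [← coordMap_eq_coordLift hy, coordInv_coordMap hy]

theorem coordLift_coordInv {p x : M} (hx : x ∈ (chartAt E6 p).source)
    (w : TangentSpace (𝓡 6) x) : coordLift p x (coordInv p x w) = w := by
  obtain ⟨y, hy, rfl⟩ := exists_coord hx
  rw [← coordMap_eq_coordLift hy, coordMap_coordInv hy]

theorem contDiffOn_chartTransition (f : Diffeomorph (𝓡 6) (𝓡 6) M M ∞) (p q : M) :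
    ContDiffOn ℝ ∞ (chartTransition f p q) (chartOverlap f p q) := by
  rw [← contMDiffOn_iff_contDiffOn]
  refine ContMDiffOn.comp (t := (chartAt E6 q).source) contMDiffOn_chart ?_ fun y hy => hy.2
  exact f.contMDiff.comp_contMDiffOn (contMDiffOn_chart_symm.mono inter_subset_left)

theorem smoothTransition_chartTransition (f : Diffeomorph (𝓡 6) (𝓡 6) M M ∞) (p q : M) :
    SmoothTransition (chartTransition f p q) (chartTransition f.symm q p) (chartOverlap f p q)
      (chartOverlap f.symm q p) := by
  have hopen : ∀ (f : Diffeomorph (𝓡 6) (𝓡 6) M M ∞) (p q : M), IsOpen (chartOverlap f p q) :=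
    fun f p q => (chartAt E6 p).isOpen_inter_preimage_symm
      ((chartAt E6 q).open_source.preimage f.continuous)
  have hinv : ∀ (f : Diffeomorph (𝓡 6) (𝓡 6) M M ∞) (p q : M), ∀ y ∈ chartOverlap f p q,
      chartTransition f.symm q p (chartTransition f p q y) = y := by
    intro f p q y hy
    simp only [chartTransition]
    rw [(chartAt E6 q).left_inv hy.2, f.symm_apply_apply, (chartAt E6 p).right_inv hy.1]
  have hmaps : ∀ (f : Diffeomorph (𝓡 6) (𝓡 6) M M ∞) (p q : M),
      MapsTo (chartTransition f p q) (chartOverlap f p q) (chartOverlap f.symm q p) := by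
    intro f p q y hy
    refine ⟨(chartAt E6 q).map_source hy.2, ?_⟩
    simp only [chartTransition, mem_preimage]
    rw [(chartAt E6 q).left_inv hy.2, f.symm_apply_apply]
    exact (chartAt E6 p).map_target hy.1
  exact ⟨hopen f p q, hopen f.symm q p, contDiffOn_chartTransition f p q,
    contDiffOn_chartTransition f.symm q p, hmaps f p q, hmaps f.symm q p, hinv f p q,
    hinv f.symm q p⟩

theorem fderiv_chartTransition (f : Diffeomorph (𝓡 6) (𝓡 6) M M ∞) {p q : M} {y : E6}
    (hy : y ∈ chartOverlap f p q) (v : E6) :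
    fderiv ℝ (chartTransition f p q) y v =
      coordInv q (f ((chartAt E6 p).symm y))
        (mfderiv (𝓡 6) (𝓡 6) f ((chartAt E6 p).symm y) (coordMap p y v)) := by
  have h1 : HasMFDerivAt 𝓘(ℝ, E6) 𝓘(ℝ, E6) (chartAt E6 q ∘ f ∘ (chartAt E6 p).symm) y
      ((coordInv q (f ((chartAt E6 p).symm y))).comp
        ((mfderiv (𝓡 6) (𝓡 6) f ((chartAt E6 p).symm y)).comp (coordMap p y))) :=
    (mdifferentiableAt_chart hy.2).hasMFDerivAt.comp y
      ((f.mdifferentiable (by simp) _).hasMFDerivAt.comp y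
        (mdifferentiableAt_chart_symm hy.1).hasMFDerivAt)
  have h2 : HasFDerivAt (chartAt E6 q ∘ f ∘ (chartAt E6 p).symm)
      ((coordInv q (f ((chartAt E6 p).symm y))).comp
        ((mfderiv (𝓡 6) (𝓡 6) f ((chartAt E6 p).symm y)).comp (coordMap p y)) : E6 →L[ℝ] E6) y :=
    h1.hasFDerivAt
  exact congrArg (fun L : E6 →L[ℝ] E6 => L v) h2.fderiv

theorem coordLift_fderiv_chartTransition (f : Diffeomorph (𝓡 6) (𝓡 6) M M ∞) {p q : M} {y : E6}
    (hy : y ∈ chartOverlap f p q) (v : E6) :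
    coordLift q (f ((chartAt E6 p).symm y)) (fderiv ℝ (chartTransition f p q) y v) =
      mfderiv (𝓡 6) (𝓡 6) f ((chartAt E6 p).symm y) (coordMap p y v) := by
  rw [fderiv_chartTransition f hy, coordLift_coordInv hy.2]

/-! ### Complex fields in charts -/

theorem ComplexField.inChart_coordInv (J : ComplexField M) {q : M} {z : E6}
    (hz : z ∈ (chartAt E6 q).target) {x : M} (hx : (chartAt E6 q).symm z = x)
    (w : TangentSpace (𝓡 6) x) :
    J.inChart q z (coordInv q x w) = coordInv q x (J.toFun x w) := by
  subst hx
  change coordInv q _ (J.toFun _ (coordMap q z (coordInv q _ w))) = _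
  rw [coordMap_coordInv hz]

theorem ComplexField.inChart_sq (J : ComplexField M) {p : M} {y : E6}
    (hy : y ∈ (chartAt E6 p).target) (v : E6) :
    J.inChart p y (J.inChart p y v) = -v := by
  have h1 : J.inChart p y v =
      coordInv p ((chartAt E6 p).symm y) (J.toFun _ (coordMap p y v)) := rfl
  rw [h1, J.inChart_coordInv hy rfl, J.sq_eq_neg, map_neg, coordInv_coordMap hy]

theorem IsPullback.fderiv_inChart {f : Diffeomorph (𝓡 6) (𝓡 6) M M ∞} {J J' : ComplexField M}
    (h : IsPullback f J J') (p q : M) {y : E6} (hy : y ∈ chartOverlap f p q) (v : E6) :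
    fderiv ℝ (chartTransition f p q) y (J'.inChart p y v) =
      J.inChart q (chartTransition f p q y) (fderiv ℝ (chartTransition f p q) y v) := by
  have h1 : coordMap p y (J'.inChart p y v) = J'.toFun _ (coordMap p y v) :=
    coordMap_coordInv hy.1 _
  rw [fderiv_chartTransition f hy, fderiv_chartTransition f hy, h1, h,
    J.inChart_coordInv ((smoothTransition_chartTransition f p q).mapsTo hy).1
      (chartAt_symm_chartTransition f hy)]

end Coordinates

theorem alternatingMap_comp_map {V : Type*} [AddCommGroup V] [Module ℝ V]
    (η : V [⋀^Fin 6]→ₗ[ℝ] ℂ) (ι : E6 →ₗ[ℝ] V) (A : E6 →L[ℝ] E6) (v : Fin 6 → E6) :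
    η (fun i => ι (A (v i))) = (A.det : ℂ) * η (fun i => ι (v i)) :=
  complexAlternatingMap_map_linearMap stdBasis (η.compLinearMap ι) (A : E6 →ₗ[ℝ] E6) v

/-! ### Smooth sections in charts, local coframings and the global forms. -/

section SmoothSections

variable {M : Type*} [TopologicalSpace M] [ChartedSpace E6 M] [IsManifold (𝓡 6) ∞ M]

theorem continuousLinearMapAt_trivializationAt_eq_coordInv {p x : M}
    (hx : x ∈ (chartAt E6 p).source) :
    (trivializationAt E6 (TangentSpace (𝓡 6)) p).continuousLinearMapAt ℝ x = coordInv p x :=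
  TangentBundle.continuousLinearMapAt_trivializationAt (I := 𝓡 6) hx

theorem symmL_trivializationAt_eq_coordLift {p x : M} (hx : x ∈ (chartAt E6 p).source) :
    (trivializationAt E6 (TangentSpace (𝓡 6)) p).symmL ℝ x = coordLift p x := by
  ext v : 1
  have h : x ∈ (trivializationAt E6 (TangentSpace (𝓡 6)) p).baseSet := hx
  have h1 := (trivializationAt E6 (TangentSpace (𝓡 6)) p).continuousLinearMapAt_symmL
    (R := ℝ) h v
  rw [continuousLinearMapAt_trivializationAt_eq_coordInv hx] at h1
  have h2 := congrArg (coordLift p x) h1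
  rw [coordLift_coordInv hx] at h2
  exact h2

theorem contMDiffOn_endomorphism_iff {p : M} {U : Set M} (hU : IsOpen U)
    (hUp : U ⊆ (chartAt E6 p).source)
    (s : ∀ x : M, TangentSpace (𝓡 6) x →L[ℝ] TangentSpace (𝓡 6) x) :
    ContMDiffOn (𝓡 6) ((𝓡 6).prod 𝓘(ℝ, E6 →L[ℝ] E6)) ∞
      (fun x => Bundle.TotalSpace.mk' (E6 →L[ℝ] E6)
        (E := fun x : M => TangentSpace (𝓡 6) x →L[ℝ] TangentSpace (𝓡 6) x) x (s x)) U ↔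
    ContMDiffOn (𝓡 6) 𝓘(ℝ, E6 →L[ℝ] E6) ∞
      (fun x => (coordInv p x).comp ((s x).comp (coordLift p x))) U := by
  rw [(trivializationAt (E6 →L[ℝ] E6)
    (fun x : M => TangentSpace (𝓡 6) x →L[ℝ] TangentSpace (𝓡 6) x) p).contMDiffOn_section_iff hU
    (fun x hx => ⟨hUp hx, hUp hx⟩)]
  refine contMDiffOn_congr fun x hx => ?_
  rw [← continuousLinearMapAt_trivializationAt_eq_coordInv (hUp hx),
    ← symmL_trivializationAt_eq_coordLift (hUp hx)]
  rfl

theorem contMDiffOn_oneForm_iff {p : M} {U : Set M} (hU : IsOpen U)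
    (hUp : U ⊆ (chartAt E6 p).source) (a : ∀ x : M, TangentSpace (𝓡 6) x →L[ℝ] ℂ) :
    IsSmoothOneFormOn a U ↔
    ContMDiffOn (𝓡 6) 𝓘(ℝ, E6 →L[ℝ] ℂ) ∞ (fun x => (a x).comp (coordLift p x)) U := by
  rw [IsSmoothOneFormOn, (trivializationAt (E6 →L[ℝ] ℂ)
    (fun x : M => TangentSpace (𝓡 6) x →L[ℝ] Bundle.Trivial M ℂ x) p).contMDiffOn_section_iff hU
    (fun x hx => ⟨hUp hx, mem_univ x⟩)]
  refine contMDiffOn_congr fun x hx => ?_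
  rw [← symmL_trivializationAt_eq_coordLift (hUp hx)]
  refine ContinuousLinearMap.ext fun v => ?_
  change (Bundle.Trivial.trivialization M ℂ).continuousLinearMapAt ℝ x (a x _) = _
  rw [Bundle.Trivial.continuousLinearMapAt_trivialization]
  rfl

theorem ComplexField.IsSmooth.contDiffOn_inChart {J : ComplexField M} (hJ : J.IsSmooth) (p : M) :
    ContDiffOn ℝ ∞ (J.inChart p) (chartAt E6 p).target := by
  have h := (contMDiffOn_endomorphism_iff (chartAt E6 p).open_source Subset.rfl J.toFun).1
    hJ.contMDiffOn
  have h2 := h.comp (contMDiffOn_chart_symm (I := 𝓡 6) (n := ∞) (x := p))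
    fun y hy => (chartAt E6 p).map_target hy
  refine (contMDiffOn_iff_contDiffOn.1 h2).congr fun y hy => ?_
  rw [ComplexField.inChart, coordMap_eq_coordLift hy]
  rfl

theorem IsSmoothOneFormOn.contDiffAt {a : ∀ x : M, TangentSpace (𝓡 6) x →L[ℝ] ℂ} {U : Set M}
    (hU : IsOpen U) (ha : IsSmoothOneFormOn a U) {p : M} {y : E6}
    (hy : y ∈ (chartAt E6 p).target) (hyU : (chartAt E6 p).symm y ∈ U) :
    ContDiffAt ℝ ∞ (fun z => (a ((chartAt E6 p).symm z)).comp (coordMap p z)) y := by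
  set W := U ∩ (chartAt E6 p).source
  have hW : IsOpen W := hU.inter (chartAt E6 p).open_source
  have haW : IsSmoothOneFormOn a W := ContMDiffOn.mono ha inter_subset_left
  have h := (contMDiffOn_oneForm_iff hW inter_subset_right a).1 haW
  have hO : IsOpen ((chartAt E6 p).target ∩ (chartAt E6 p).symm ⁻¹' W) :=
    (chartAt E6 p).isOpen_inter_preimage_symm hW
  have h2 := h.comp ((contMDiffOn_chart_symm (I := 𝓡 6) (n := ∞) (x := p)).mono
    (inter_subset_left (t := (chartAt E6 p).symm ⁻¹' W))) fun y hy => hy.2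
  have h3 : ContDiffOn ℝ ∞ (fun z => (a ((chartAt E6 p).symm z)).comp (coordMap p z))
      ((chartAt E6 p).target ∩ (chartAt E6 p).symm ⁻¹' W) := by
    refine (contMDiffOn_iff_contDiffOn.1 h2).congr fun z hz => ?_
    rw [coordMap_eq_coordLift hz.1]
    rfl
  exact h3.contDiffAt (hO.mem_nhds ⟨hy, hyU, (chartAt E6 p).map_target hy⟩)

/-! ### Local coframings -/

/-- A complex field in the coordinates of the chart at `p`, at a point `x`. -/
theorem ComplexField.inChart_eq (J : ComplexField M) {p : M} {z : E6}
    (hz : z ∈ (chartAt E6 p).target) {x : M} (hx : (chartAt E6 p).symm z = x) (v : E6) :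
    J.inChart p z v = coordInv p x (J.toFun x (coordLift p x v)) := by
  subst hx
  rw [ComplexField.inChart, coordMap_eq_coordLift hz]
  rfl

/-- A coframe at x, extended with constant coefficients in the chart, is projected to its (1,0)-part
at each nearby point; U is the open set on which the projections remain a coframe. -/
theorem exists_isCoframing {J : ComplexField M} (hJ : J.IsSmooth) (x : M) :
    ∃ (U : Set M) (α : Fin 3 → ∀ x : M, TangentSpace (𝓡 6) x →L[ℝ] ℂ),
      x ∈ U ∧ IsCoframing J U α := by
  set c := chartAt E6 x with hc
  have hx0 : c x ∈ c.target := c.map_source (mem_chart_source E6 x)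
  obtain ⟨α, hα⟩ := exists_isCoframe (j := J.inChart x (c x)) (J.inChart_sq hx0)
  have hinv := part10Map_isInvertible hα
  have hJc : ContDiffOn ℝ ∞ (J.inChart x) c.target := hJ.contDiffOn_inChart x
  have hcont : ContinuousOn (fun x' => part10Map α (J.inChart x (c x'))) c.source :=
    (contDiff_part10Map α).continuous.comp_continuousOn
      (hJc.continuousOn.comp c.continuousOn fun x' hx' => c.map_source hx')
  let S : Set (E6 →L[ℝ] (Fin 3 → ℂ)) := {A | A.IsInvertible}
  have hS : IsOpen S := ContinuousLinearEquiv.isOpen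
  set U : Set M := c.source ∩ (fun x' => part10Map α (J.inChart x (c x'))) ⁻¹' S with hU
  have hUo : IsOpen U := hcont.isOpen_inter_preimage c.open_source hS
  refine ⟨U, fun k x' => (part10 (J.inChart x (c x')) (α k)).comp (coordInv x x'),
    ⟨mem_chart_source E6 x, hinv⟩, hUo, fun k => ?_, fun x' hx' => ?_⟩
  · rw [contMDiffOn_oneForm_iff hUo inter_subset_left]
    have h1 : ContDiffOn ℝ ∞ (fun z => part10 (J.inChart x z) (α k)) c.target :=
      (contDiff_part10 (α k)).comp_contDiffOn hJc
    have h2 := (contMDiffOn_iff_contDiffOn.2 h1).comp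
      ((contMDiffOn_chart (I := 𝓡 6) (n := ∞) (x := x)).mono
        (inter_subset_left (t := (fun x' => part10Map α (J.inChart x (c x'))) ⁻¹' S)))
      fun x' hx' => c.map_source hx'.1
    refine h2.congr fun x' hx' => ?_
    ext v
    change part10 (J.inChart x (c x')) (α k) (coordInv x x' (coordLift x x' v)) = _
    rw [coordInv_coordLift hx'.1]
    rfl
  · have hz : c x' ∈ c.target := c.map_source hx'.1
    have hzx : c.symm (c x') = x' := c.left_inv hx'.1
    refine IsDualFrame.isCoframe
      (e := fun l => coordLift x x' (part10Frame α (J.inChart x (c x')) l)) (fun k v => ?_)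
      fun k l => ?_
    · change part10 (J.inChart x (c x')) (α k) (coordInv x x' (J.toFun x' v)) =
        Complex.I * part10 (J.inChart x (c x')) (α k) (coordInv x x' v)
      rw [← J.inChart_coordInv hz hzx, part10_map (J.inChart_sq hz)]
    · change part10 (J.inChart x (c x')) (α k) (coordInv x x' (coordLift x x' _)) = _
      rw [coordInv_coordLift hx'.1, part10_part10Frame hx'.2]

/-- The 1-jet of `J` at `x`, in the preferred chart at `x`. -/
def ComplexField.jetAt (J : ComplexField M) (x : M) : EndJet :=
  (J.inChart x (chartAt E6 x x), fderiv ℝ (J.inChart x) (chartAt E6 x x))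

theorem ComplexField.jetAt_mem (J : ComplexField M) (x : M) : J.jetAt x ∈ complexJets :=
  J.inChart_sq ((chartAt E6 x).map_source (mem_chart_source E6 x))

theorem coordLift_jetAt (J : ComplexField M) (x : M) (v : E6) :
    coordLift x x ((J.jetAt x).1 v) = J.toFun x (coordLift x x v) := by
  have hx := mem_chart_source E6 x
  rw [ComplexField.jetAt, J.inChart_eq ((chartAt E6 x).map_source hx)
    ((chartAt E6 x).left_inv hx), coordLift_coordInv hx]

variable {J : ComplexField M} {U : Set M} {α : Fin 3 → ∀ x : M, TangentSpace (𝓡 6) x →L[ℝ] ℂ}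
  {x : M}

theorem IsCoframing.isCoframe_jetAt (hα : IsCoframing J U α) (hx : x ∈ U) :
    IsCoframe (J.jetAt x).1 fun k => (α k x).comp (coordLift x x) := by
  have hxs := mem_chart_source E6 x
  obtain ⟨e, he⟩ := (hα.2.2 x hx).exists_isDualFrame (finrank_tangentSpace x)
  refine IsDualFrame.isCoframe (e := fun l => coordInv x x (e l)) (fun k v => ?_) fun k l => ?_
  · change α k x (coordLift x x _) = Complex.I * α k x (coordLift x x v)
    rw [coordLift_jetAt, (hα.2.2 x hx).1]
  · change α k x (coordLift x x (coordInv x x (e l))) = _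
    rw [coordLift_coordInv hxs]
    exact he.1 k l

/-- The exterior derivative of a coframing in terms of the 1-jet of `J`. -/
theorem IsCoframing.part02_extDerivAt (hJ : J.IsSmooth) (hα : IsCoframing J U α) (hx : x ∈ U)
    (k : Fin 3) (v w : E6) :
    part02 (J.toFun x) (extDerivAt (α k) x) (coordLift x x v) (coordLift x x w) =
      part02 (J.jetAt x).1 (jetExtDeriv (J.jetAt x) ((α k x).comp (coordLift x x))) v w := by
  have hxs := mem_chart_source E6 x
  set c := chartAt E6 x with hc
  have hy : c x ∈ c.target := c.map_source hxs
  have hyx : c.symm (c x) = x := c.left_inv hxs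
  set β : E6 → E6 →L[ℝ] ℂ := fun z => (α k (c.symm z)).comp (coordMap x z) with hβ
  have hβd : DifferentiableAt ℝ β (c x) :=
    ((hα.2.1 k).contDiffAt hα.1 hy (by rw [← hc, hyx]; exact hx)).differentiableAt (by simp)
  have hJd : DifferentiableAt ℝ (J.inChart x) (c x) :=
    ((hJ.contDiffOn_inChart x).contDiffAt (c.open_target.mem_nhds hy)).differentiableAt (by simp)
  have hev : ∀ᶠ z in 𝓝 (c x), ∀ v, β z (J.inChart x z v) = Complex.I * β z v := by
    have hO : IsOpen (c.target ∩ c.symm ⁻¹' U) := c.isOpen_inter_preimage_symm hα.1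
    filter_upwards [hO.mem_nhds ⟨hy, by rw [mem_preimage, hyx]; exact hx⟩] with z hz v
    have h1 : coordMap x z (J.inChart x z v) = J.toFun _ (coordMap x z v) :=
      coordMap_coordInv hz.1 _
    change α k (c.symm z) (coordMap x z (J.inChart x z v)) = _
    rw [h1]
    exact (hα.2.2 _ hz.2).1 k _
  have hβx : β (c x) = (α k x).comp (coordLift x x) := by
    -- The base point occurs in the types of the tangent spaces, so the equality is eliminated by
    -- substitution for a variable point.
    have : ∀ x' (h : c.symm (c x) = x'), β (c x) = (α k x').comp (coordLift x x') := by
      rintro x' rfl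
      change (α k _).comp (coordMap x (c x)) = _
      rw [coordMap_eq_coordLift hy]
    exact this x hyx
  have key := part02_extDerivOne hβd hJd (J.inChart_sq hy) hev v w
  rw [hβx] at key
  refine Eq.trans ?_ key
  have hl : ∀ v w, extDerivAt (α k) x (coordLift x x v) (coordLift x x w) =
      extDerivOne β (c x) v w := fun v w => by
    rw [extDerivAt, coordInv_coordLift hxs, coordInv_coordLift hxs]
  simp only [part02, ← coordLift_jetAt, hl]
  rfl

/-- This reduces existence and uniqueness on M to the algebra of a single 1-jet on ℝ⁶. -/
theorem isNijenhuisMatrixAt_iff (hJ : J.IsSmooth) (hα : IsCoframing J U α) (hx : x ∈ U)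
    (N : Matrix (Fin 3) (Fin 3) ℂ) :
    IsNijenhuisMatrixAt J α x N ↔
      IsNijenhuisMatrix (J.jetAt x).1 (fun k => (α k x).comp (coordLift x x))
        (fun k => jetExtDeriv (J.jetAt x) ((α k x).comp (coordLift x x))) N := by
  have hxs := mem_chart_source E6 x
  constructor
  · intro h i v w
    rw [← hα.part02_extDerivAt hJ hx, h]
    rfl
  · intro h i v w
    have := h i (coordInv x x v) (coordInv x x w)
    rw [← hα.part02_extDerivAt hJ hx, coordLift_coordInv hxs, coordLift_coordInv hxs] at this
    rw [this]
    simp only [ContinuousLinearMap.comp_apply, coordLift_coordInv hxs]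

theorem existsUnique_isNijenhuisMatrixAt (hJ : J.IsSmooth) (hα : IsCoframing J U α)
    (hx : x ∈ U) : ∃! N, IsNijenhuisMatrixAt J α x N := by
  obtain ⟨e, he⟩ := (hα.isCoframe_jetAt hx).exists_isDualFrame finrank_E6
  refine ⟨_, (isNijenhuisMatrixAt_iff hJ hα hx _).2 (exists_isNijenhuisMatrix (J.jetAt_mem x) he
    fun i => isSkewBilinear_jetExtDeriv _ _), fun N hN => ?_⟩
  exact IsNijenhuisMatrix.unique he ((isNijenhuisMatrixAt_iff hJ hα hx _).1 hN)
    (exists_isNijenhuisMatrix (J.jetAt_mem x) he fun i => isSkewBilinear_jetExtDeriv _ _)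

theorem isNijenhuisMatrixAt_nijenhuisMatrix (hJ : J.IsSmooth) (hα : IsCoframing J U α)
    (hx : x ∈ U) : IsNijenhuisMatrixAt J α x (nijenhuisMatrix J α x) :=
  Classical.epsilon_spec (existsUnique_isNijenhuisMatrixAt hJ hα hx).exists

theorem exists_isCoframing_someCoframing (hJ : J.IsSmooth) (x : M) :
    ∃ U : Set M, x ∈ U ∧ IsCoframing J U (someCoframing J x) := by
  obtain ⟨U, α, hx, hα⟩ := exists_isCoframing hJ x
  exact Classical.epsilon_spec (p := fun α => ∃ U : Set M, x ∈ U ∧ IsCoframing J U α)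
    ⟨α, U, hx, hα⟩

/-- Two coframings are compared at x by a constant matrix G. This suffices because the (0,2)-parts
involve only the values of the coframings at x and the 1-jet of J. -/
theorem formsWellDefined (hJ : J.IsSmooth) : FormsWellDefined J := by
  refine ⟨exists_isCoframing hJ, fun U α hα x hx =>
    ⟨existsUnique_isNijenhuisMatrixAt hJ hα hx, ?_⟩⟩
  obtain ⟨U', hx', hα'⟩ := exists_isCoframing_someCoframing hJ x
  refine phiOf_psiOf_change (finrank_tangentSpace x) (hα.2.2 x hx) (hα'.2.2 x hx')
    (fun G hG i v w => ?_) (isNijenhuisMatrixAt_nijenhuisMatrix hJ hα hx)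
    (isNijenhuisMatrixAt_nijenhuisMatrix hJ hα' hx')
  have hxs := mem_chart_source E6 x
  rw [← coordLift_coordInv hxs v, ← coordLift_coordInv hxs w]
  simp only [hα.part02_extDerivAt hJ hx, hα'.part02_extDerivAt hJ hx']
  refine part02_jetExtDeriv_linearCombination (J.jetAt x)
    (α := fun k => (α k x).comp (coordLift x x))
    (β := fun k => (someCoframing J x k x).comp (coordLift x x)) G (fun i => ?_) i _ _
  rw [hG i]
  ext v
  simp [_root_.sum_apply]

theorem integrandForm_coordLift (hJ : J.IsSmooth) (c₁ c₂ : ℂ) (x : M) :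
    integrandForm c₁ c₂ J x (fun i => coordLift x x (stdFrame i)) =
      lagrangian c₁ c₂ (J.jetAt x) := by
  obtain ⟨U, hx, hα⟩ := exists_isCoframing_someCoframing hJ x
  have hN := (isNijenhuisMatrixAt_iff hJ hα hx _).1 (isNijenhuisMatrixAt_nijenhuisMatrix hJ hα hx)
  rw [lagrangian_eq_density c₁ c₂ (J.jetAt_mem x) (hα.isCoframe_jetAt hx) hN, density_eq,
    wedgeSix_compLinearMap, integrandForm, phiForm, psiForm, integrandOf_phiOf_psiOf]
  rfl

/-- The forms at a point are computed in the preferred chart there, whereas the coefficient refers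
to the chart at p. Under the transition between these charts the Lagrangian and the coefficient of a
6-form acquire the same determinant. -/
theorem coefficient_integrandForm (hJ : J.IsSmooth) (c₁ c₂ : ℂ) (p : M) {y : E6}
    (hy : y ∈ (chartAt E6 p).target) :
    coefficient (integrandForm c₁ c₂ J) p y =
      lagrangian c₁ c₂ (J.inChart p y, fderiv ℝ (J.inChart p) y) := by
  set f := Diffeomorph.refl (𝓡 6) M ∞ with hf
  have hyo : y ∈ chartOverlap f p ((chartAt E6 p).symm y) := ⟨hy, mem_chart_source E6 _⟩
  have hT := smoothTransition_chartTransition f p ((chartAt E6 p).symm y)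
  have hd : ∀ (p : M) {z : E6}, z ∈ (chartAt E6 p).target → DifferentiableAt ℝ (J.inChart p) z :=
    fun p z hz => ((hJ.contDiffOn_inChart p).contDiffAt
      ((chartAt E6 p).open_target.mem_nhds hz)).differentiableAt (by simp)
  have h1 := hT.lagrangian_eq c₁ c₂ (fun z hz => J.inChart_sq hz.1)
    (fun z hz => J.inChart_sq hz.1) (fun z hz => (isPullback_refl J).fderiv_inChart p _ hz) hyo
    (hd p hy) (hd _ (hT.mapsTo hyo).1)
  -- By definition the transition sends y to the coordinate of its point in that point's own chart,
  -- which is where `jetAt` is taken.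
  have h2 : (J.inChart ((chartAt E6 p).symm y) (chartTransition f p ((chartAt E6 p).symm y) y),
      fderiv ℝ (J.inChart ((chartAt E6 p).symm y))
        (chartTransition f p ((chartAt E6 p).symm y) y)) = J.jetAt ((chartAt E6 p).symm y) := rfl
  rw [h1, h2, ← integrandForm_coordLift hJ]
  have h4 := alternatingMap_comp_map (integrandForm c₁ c₂ J ((chartAt E6 p).symm y))
    (coordLift ((chartAt E6 p).symm y) ((chartAt E6 p).symm y)).toLinearMap
    (fderiv ℝ (chartTransition f p ((chartAt E6 p).symm y)) y) stdFrame
  simp only [ContinuousLinearMap.coe_coe] at h4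
  rw [← h4, coefficient]
  refine congrArg (integrandForm c₁ c₂ J ((chartAt E6 p).symm y)) (funext fun i => ?_)
  have h5 := coordLift_fderiv_chartTransition f hyo (stdFrame i)
  have h6 : mfderiv (𝓡 6) (𝓡 6) f ((chartAt E6 p).symm y) =
      ContinuousLinearMap.id ℝ (TangentSpace (𝓡 6) ((chartAt E6 p).symm y)) := mfderiv_id
  rw [h6] at h5
  exact h5.symm

end SmoothSections

/-! ### Signs of frames. -/

section FrameSigns

variable {V : Type*} [AddCommGroup V] [Module ℝ V]

theorem frameSign_comp_map (o : Orientation ℝ V (Fin 6)) (ι : E6 →ₗ[ℝ] V) (A : E6 →L[ℝ] E6)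
    (v : Fin 6 → E6) :
    frameSign o (fun i => ι (A (v i))) =
      (SignType.sign A.det : ℝ) * frameSign o (fun i => ι (v i)) := by
  have h : Module.Ray.someVector o (fun i => ι (A (v i))) =
      A.det * Module.Ray.someVector o (fun i => ι (v i)) :=
    alternatingMap_map_linearMap stdBasis ((Module.Ray.someVector o).compLinearMap ι)
      (A : E6 →ₗ[ℝ] E6) v
  rw [frameSign, frameSign, h, sign_mul, SignType.coe_mul]

theorem abs_frameSign_le_one (o : Orientation ℝ V (Fin 6)) (v : Fin 6 → V) :
    |frameSign o v| ≤ 1 := by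
  rw [frameSign]
  cases SignType.sign (Module.Ray.someVector o v) <;> simp

theorem someVector_pos_of_frameSign_eq_one {o : Orientation ℝ V (Fin 6)} {v : Fin 6 → V}
    (h : frameSign o v = 1) : 0 < Module.Ray.someVector o v := by
  rw [frameSign] at h
  rw [← sign_eq_one_iff]
  cases hs : SignType.sign (Module.Ray.someVector o v) <;> rw [hs] at h <;> norm_num at h
  rfl

/-- A linear map that sends some positive basis to a positive family preserves all signs. -/
theorem frameSign_map_eq {W : Type*} [AddCommGroup W] [Module ℝ W]
    {o : Orientation ℝ V (Fin 6)} {o' : Orientation ℝ W (Fin 6)} (L : V →ₗ[ℝ] W)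
    (b : Module.Basis (Fin 6) ℝ V) (hb : frameSign o b = 1)
    (hLb : frameSign o' (fun i => L (b i)) = 1) (w : Fin 6 → V) :
    frameSign o' (fun i => L (w i)) = frameSign o w := by
  -- Top-degree forms are multiples of `b.det`, so one value on b fixes the sign on every family.
  have key : ∀ η : V [⋀^Fin 6]→ₗ[ℝ] ℝ, 0 < η b →
      SignType.sign (η w) = SignType.sign (b.det w) := by
    intro η hη
    rw [AlternatingMap.eq_smul_basis_det b η, AlternatingMap.smul_apply, smul_eq_mul, sign_mul,
      sign_pos hη, one_mul]
  have h1 := key (Module.Ray.someVector o) (someVector_pos_of_frameSign_eq_one hb)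
  have h2 := key ((Module.Ray.someVector o').compLinearMap L)
    (someVector_pos_of_frameSign_eq_one hLb)
  have h3 : SignType.sign (Module.Ray.someVector o' (fun i => L (w i))) =
      SignType.sign (b.det w) := h2
  rw [frameSign, frameSign, h1, h3]

/-- Applying α k to a relation leaves one complex number, whose real and imaginary parts are the
coefficients of `e k` and `j (e k)`. -/
theorem IsDualFrame.linearIndependent [TopologicalSpace V] {j : V →L[ℝ] V}
    {α : Fin 3 → V →L[ℝ] ℂ} {e : Fin 3 → V} (hj : ∀ k v, α k (j v) = Complex.I * α k v)
    (he : IsDualFrame j α e) :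
    LinearIndependent ℝ ![e 0, j (e 0), e 1, j (e 1), e 2, j (e 2)] := by
  refine Fintype.linearIndependent_iff.2 fun g hg => ?_
  have h := fun k => congrArg (α k) hg
  simp only [Fin.sum_univ_succ, Fin.isValue, map_add, map_smul, map_zero] at h
  have h0 := h 0
  have h1 := h 1
  have h2 := h 2
  simp [hj, he.1, Complex.ext_iff] at h0 h1 h2
  intro i
  fin_cases i <;> simp_all

end FrameSigns

/-! ### Orientations and diffeomorphisms. -/

section ManifoldOrientation

variable {M : Type*} [TopologicalSpace M] [ChartedSpace E6 M]

/-- The diffeomorphism `f` preserves the orientation `o`. -/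
def PreservesOrientation (o : ManifoldOrientation M) (f : M → M) : Prop :=
  ∀ (x : M) (w : Fin 6 → TangentSpace (𝓡 6) x),
    frameSign (o.at_point (f x)) (fun i => mfderiv (𝓡 6) (𝓡 6) f x (w i)) =
      frameSign (o.at_point x) w

theorem preservesOrientation_refl (o : ManifoldOrientation M) :
    PreservesOrientation o (Diffeomorph.refl (𝓡 6) M ∞) := by
  intro x w
  have h : mfderiv (𝓡 6) (𝓡 6) (Diffeomorph.refl (𝓡 6) M ∞) x =
      ContinuousLinearMap.id ℝ (TangentSpace (𝓡 6) x) := mfderiv_id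
  rw [h]
  rfl

/-- The sign of the coordinate frame of the chart at `p`. -/
def chartSign (o : ManifoldOrientation M) (p : M) (y : E6) : ℝ :=
  frameSign (o.at_point ((chartAt E6 p).symm y)) (coordFrame p y)

theorem abs_chartSign_le_one (o : ManifoldOrientation M) (p : M) (y : E6) :
    |chartSign o p y| ≤ 1 := abs_frameSign_le_one _ _

theorem continuousOn_chartSign (o : ManifoldOrientation M) (p : M) :
    ContinuousOn (chartSign o p) (chartAt E6 p).target := fun y hy =>
  (continuousAt_const.congr
    ((o.locally_constant p y hy).mono fun _ hz => hz.symm)).continuousWithinAt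

theorem injective_mfderiv (f : Diffeomorph (𝓡 6) (𝓡 6) M M ∞) (x : M) :
    Function.Injective (mfderiv (𝓡 6) (𝓡 6) f x) :=
  (f.mfderivToContinuousLinearEquiv (by simp) x).injective

/-- The differential of f carries a basis adapted to J' to one adapted to J, and both are positive;
hence f preserves the orientation without this being assumed. -/
theorem IsPullback.preservesOrientation {o : ManifoldOrientation M}
    {f : Diffeomorph (𝓡 6) (𝓡 6) M M ∞} {J J' : ComplexField M} (h : IsPullback f J J')
    (hJ : J.Induces o) (hJ' : J'.Induces o) : PreservesOrientation o f := by
  intro x w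
  obtain ⟨α, hα⟩ : ∃ α : Fin 3 → TangentSpace (𝓡 6) x →L[ℝ] ℂ, IsCoframe (J'.toFun x) α :=
    exists_isCoframe (j := J'.toFun x) (J'.sq_eq_neg x)
  obtain ⟨e, he⟩ := hα.exists_isDualFrame (finrank_tangentSpace x)
  have hli := he.linearIndependent hα.1
  let b := basisOfLinearIndependentOfCardEqFinrank hli
    (by rw [finrank_tangentSpace, Fintype.card_fin])
  have hb : ⇑b = ![e 0, J'.toFun x (e 0), e 1, J'.toFun x (e 1), e 2, J'.toFun x (e 2)] :=
    coe_basisOfLinearIndependentOfCardEqFinrank _ _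
  have hLb : (fun i => (mfderiv (𝓡 6) (𝓡 6) f x : _ →ₗ[ℝ] _) (b i)) =
      ![mfderiv (𝓡 6) (𝓡 6) f x (e 0), J.toFun (f x) (mfderiv (𝓡 6) (𝓡 6) f x (e 0)),
        mfderiv (𝓡 6) (𝓡 6) f x (e 1), J.toFun (f x) (mfderiv (𝓡 6) (𝓡 6) f x (e 1)),
        mfderiv (𝓡 6) (𝓡 6) f x (e 2), J.toFun (f x) (mfderiv (𝓡 6) (𝓡 6) f x (e 2))] := by
    rw [hb]
    ext1 i
    fin_cases i <;> simp [← h x]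
  refine frameSign_map_eq (mfderiv (𝓡 6) (𝓡 6) f x).toLinearMap b ?_ ?_ w
  · rw [hb]
    exact hJ' x e hli
  · rw [hLb]
    refine hJ (f x) (fun k => mfderiv (𝓡 6) (𝓡 6) f x (e k)) ?_
    rw [← hLb]
    exact b.linearIndependent.map' _ (LinearMap.ker_eq_bot.2 (injective_mfderiv f x))

variable [IsManifold (𝓡 6) ∞ M]

/-- This sign turns the absolute Jacobian of the change of variables into the determinant by which
6-forms transform. -/
theorem PreservesOrientation.chartSign_eq {o : ManifoldOrientation M}
    {f : Diffeomorph (𝓡 6) (𝓡 6) M M ∞} (hf : PreservesOrientation o f) {p q : M} {y : E6}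
    (hy : y ∈ chartOverlap f p q) :
    chartSign o p y = (SignType.sign (fderiv ℝ (chartTransition f p q) y).det : ℝ) *
      chartSign o q (chartTransition f p q y) := by
  have hz : chartTransition f p q y ∈ (chartAt E6 q).target :=
    ((smoothTransition_chartTransition f p q).mapsTo hy).1
  have h1 : ∀ x, (chartAt E6 q).symm (chartTransition f p q y) = x →
      chartSign o q (chartTransition f p q y) =
        frameSign (o.at_point x) (fun i => coordLift q x (stdFrame i)) := by
    rintro x rfl
    rw [chartSign, ← coordMap_eq_coordLift hz]
    rfl
  rw [h1 _ (chartAt_symm_chartTransition f hy), chartSign, ← hf]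
  have h2 := frameSign_comp_map (o.at_point (f ((chartAt E6 p).symm y)))
    (coordLift q (f ((chartAt E6 p).symm y))).toLinearMap
    (fderiv ℝ (chartTransition f p q) y) stdFrame
  refine Eq.trans (congrArg _ (funext fun i => ?_)) h2
  exact (coordLift_fderiv_chartTransition f hy (stdFrame i)).symm

end ManifoldOrientation

/-! ### Integration with partitions of unity and change of variables. -/

section ChartIntegrals

variable {M : Type*} [TopologicalSpace M] [ChartedSpace E6 M]

/-- The weight with which the coefficient in the chart at `p` enters the integral. -/
def chartWeight (o : ManifoldOrientation M) (ρ : SmoothPartitionOfUnity M (𝓡 6) M univ) (p : M)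
    (y : E6) : ℝ :=
  ρ p ((chartAt E6 p).symm y) *
    frameSign (o.at_point ((chartAt E6 p).symm y)) (coordFrame p y)

theorem chartWeight_eq (o : ManifoldOrientation M) (ρ : SmoothPartitionOfUnity M (𝓡 6) M univ)
    (p : M) (y : E6) :
    chartWeight o ρ p y = ρ p ((chartAt E6 p).symm y) * chartSign o p y := rfl

theorem chartIntegral_eq_finsum (o : ManifoldOrientation M)
    (ρ : SmoothPartitionOfUnity M (𝓡 6) M univ) (θ : M → E6 → ℂ) :
    chartIntegral o ρ θ =
      ∑ᶠ p : M, ∫ y in (chartAt E6 p).target, (chartWeight o ρ p y : ℂ) * θ p y := rfl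

/-- The coefficients `θ` are integrable on compact subsets of the charts. -/
def IsLocallyIntegrable (θ : M → E6 → ℂ) : Prop :=
  ∀ p : M, ∀ K ⊆ (chartAt E6 p).target, IsCompact K → IntegrableOn (θ p) K

/-- The support of `ρ p` in the coordinates of the chart at `p`. -/
def chartSupport (ρ : SmoothPartitionOfUnity M (𝓡 6) M univ) (p : M) : Set E6 :=
  chartAt E6 p '' tsupport (ρ p)

theorem chartIntegral_congr (o : ManifoldOrientation M)
    (ρ : SmoothPartitionOfUnity M (𝓡 6) M univ) {θ θ' : M → E6 → ℂ}
    (h : ∀ p, ∀ y ∈ (chartAt E6 p).target, θ p y = θ' p y) :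
    chartIntegral o ρ θ = chartIntegral o ρ θ' :=
  finsum_congr fun p => setIntegral_congr_fun (chartAt E6 p).open_target.measurableSet
    fun y hy => congrArg _ (h p y hy)

theorem HasIntegral.congr {o : ManifoldOrientation M} {θ θ' : M → E6 → ℂ} {c : ℂ}
    (hθ : HasIntegral o θ c) (h : ∀ p, ∀ y ∈ (chartAt E6 p).target, θ p y = θ' p y) :
    HasIntegral o θ' c := fun ρ hρ =>
  ⟨fun p => ((hθ ρ hρ).1 p).congr_fun (fun y hy => congrArg _ (h p y hy))
    (chartAt E6 p).open_target.measurableSet,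
    (chartIntegral_congr o ρ h).symm.trans (hθ ρ hρ).2⟩

theorem im_chartIntegral_eq_zero (o : ManifoldOrientation M)
    (ρ : SmoothPartitionOfUnity M (𝓡 6) M univ) {θ : M → E6 → ℂ} (hθ : ∀ p y, (θ p y).im = 0) :
    (chartIntegral o ρ θ).im = 0 := by
  refine finsum_induction (fun z : ℂ => z.im = 0) Complex.zero_im
    (fun z w hz hw => by rw [Complex.add_im, hz, hw, add_zero]) fun p => ?_
  have h : ∀ y, (chartWeight o ρ p y : ℂ) * θ p y =
      ((chartWeight o ρ p y * (θ p y).re : ℝ) : ℂ) := by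
    intro y
    have hre : θ p y = ((θ p y).re : ℂ) := Complex.ext rfl (hθ p y)
    conv_lhs => rw [hre]
    rw [Complex.ofReal_mul]
  change (∫ y in (chartAt E6 p).target, (chartWeight o ρ p y : ℂ) * θ p y).im = 0
  simp_rw [h]
  rw [integral_complex_ofReal]
  exact Complex.ofReal_im _

theorem chartSupport_subset {ρ : SmoothPartitionOfUnity M (𝓡 6) M univ}
    (hρ : ρ.IsSubordinate fun p => (chartAt E6 p).source) (p : M) :
    chartSupport ρ p ⊆ (chartAt E6 p).target :=
  ((chartAt E6 p).mapsTo.mono_left (hρ p)).image_subset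

theorem chartWeight_eq_zero (o : ManifoldOrientation M)
    (ρ : SmoothPartitionOfUnity M (𝓡 6) M univ) {p : M} {y : E6}
    (hy : y ∈ (chartAt E6 p).target \ chartSupport ρ p) : chartWeight o ρ p y = 0 := by
  rw [chartWeight_eq]
  by_contra hne
  refine hy.2 ⟨(chartAt E6 p).symm y, ?_, (chartAt E6 p).right_inv hy.1⟩
  exact subset_tsupport _ (left_ne_zero_of_mul hne)

theorem norm_chartWeight_le_one (o : ManifoldOrientation M)
    (ρ : SmoothPartitionOfUnity M (𝓡 6) M univ) (p : M) (y : E6) :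
    ‖(chartWeight o ρ p y : ℂ)‖ ≤ 1 := by
  rw [Complex.norm_real, Real.norm_eq_abs, chartWeight_eq, abs_mul, abs_of_nonneg (ρ.nonneg _ _)]
  exact mul_le_one₀ (ρ.le_one _ _) (abs_nonneg _) (abs_chartSign_le_one o p y)

theorem continuousOn_chartWeight (o : ManifoldOrientation M)
    (ρ : SmoothPartitionOfUnity M (𝓡 6) M univ) (p : M) :
    ContinuousOn (fun y => (chartWeight o ρ p y : ℂ)) (chartAt E6 p).target := by
  refine Complex.continuous_ofReal.comp_continuousOn (ContinuousOn.mul ?_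
    (continuousOn_chartSign o p))
  exact (ρ p).contMDiff.continuous.comp_continuousOn (chartAt E6 p).continuousOn_symm

theorem setIntegral_chartWeight_mul {ρ : SmoothPartitionOfUnity M (𝓡 6) M univ}
    (hρ : ρ.IsSubordinate fun p => (chartAt E6 p).source)
    (o : ManifoldOrientation M) (θ : M → E6 → ℂ) (p : M) :
    ∫ y in (chartAt E6 p).target, (chartWeight o ρ p y : ℂ) * θ p y =
      ∫ y in chartSupport ρ p, (chartWeight o ρ p y : ℂ) * θ p y := by
  refine setIntegral_eq_of_subset_of_forall_sdiff_eq_zero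
    (chartAt E6 p).open_target.measurableSet (chartSupport_subset hρ p) fun y hy => ?_
  rw [chartWeight_eq_zero o ρ hy, Complex.ofReal_zero, zero_mul]

variable [CompactSpace M]

theorem finite_partition (ρ : SmoothPartitionOfUnity M (𝓡 6) M univ) :
    {p | (Function.support (ρ p)).Nonempty}.Finite :=
  ρ.locallyFinite.finite_nonempty_of_compact

/-- The finitely many indices of a partition of unity on a compact manifold. -/
def partitionIndices (ρ : SmoothPartitionOfUnity M (𝓡 6) M univ) : Finset M :=
  (finite_partition ρ).toFinset

theorem mem_partitionIndices {ρ : SmoothPartitionOfUnity M (𝓡 6) M univ} {p x : M}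
    (h : ρ p x ≠ 0) : p ∈ partitionIndices ρ :=
  (finite_partition ρ).mem_toFinset.2 ⟨x, h⟩

theorem sum_partitionIndices (ρ : SmoothPartitionOfUnity M (𝓡 6) M univ) (x : M) :
    ∑ p ∈ partitionIndices ρ, ρ p x = 1 := by
  rw [← ρ.sum_eq_one (mem_univ x), finsum_eq_sum_of_support_subset]
  exact fun p hp => mem_partitionIndices hp

theorem chartIntegral_eq_sum (o : ManifoldOrientation M)
    (ρ : SmoothPartitionOfUnity M (𝓡 6) M univ) (θ : M → E6 → ℂ) :
    chartIntegral o ρ θ = ∑ p ∈ partitionIndices ρ,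
      ∫ y in (chartAt E6 p).target, (chartWeight o ρ p y : ℂ) * θ p y := by
  rw [chartIntegral_eq_finsum, finsum_eq_sum_of_support_subset]
  intro p hp
  by_contra hn
  refine hp ?_
  have h0 : ∀ y, chartWeight o ρ p y = 0 := fun y => by
    rw [chartWeight_eq]
    by_contra hne
    exact hn (mem_partitionIndices (left_ne_zero_of_mul hne))
  simp [h0]

theorem isCompact_chartSupport {ρ : SmoothPartitionOfUnity M (𝓡 6) M univ}
    (hρ : ρ.IsSubordinate fun p => (chartAt E6 p).source) (p : M) :
    IsCompact (chartSupport ρ p) :=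
  (isClosed_tsupport _).isCompact.image_of_continuousOn
    ((chartAt E6 p).continuousOn.mono (hρ p))

variable {ρ ρ' : SmoothPartitionOfUnity M (𝓡 6) M univ} {θ θ' : M → E6 → ℂ}

theorem integrableOn_chartWeight_mul (hρ : ρ.IsSubordinate fun p => (chartAt E6 p).source)
    (o : ManifoldOrientation M) (hθ : IsLocallyIntegrable θ) (p : M) :
    IntegrableOn (fun y => (chartWeight o ρ p y : ℂ) * θ p y) (chartAt E6 p).target := by
  have hK := isCompact_chartSupport hρ p
  have hsub := chartSupport_subset hρ p
  have h1 : IntegrableOn (fun y => (chartWeight o ρ p y : ℂ) * θ p y) (chartSupport ρ p) := by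
    refine (hθ p _ hsub hK).bdd_mul (c := 1) ?_ (ae_of_all _ (norm_chartWeight_le_one o ρ p))
    exact ((continuousOn_chartWeight o ρ p).mono hsub).aestronglyMeasurable_of_isCompact hK
      hK.measurableSet
  refine h1.of_forall_sdiff_eq_zero (chartAt E6 p).open_target.measurableSet fun y hy => ?_
  rw [chartWeight_eq_zero o ρ hy, Complex.ofReal_zero, zero_mul]

/-- Multiplication by 1 = ∑ ρ'_q∘f splits the integral; the q-th summand vanishes where f leaves the
chart at q, so it lives on the overlap. -/
theorem setIntegral_chartWeight_eq_sum (hρ : ρ.IsSubordinate fun p => (chartAt E6 p).source)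
    (hρ' : ρ'.IsSubordinate fun p => (chartAt E6 p).source) (o : ManifoldOrientation M)
    (hθ : IsLocallyIntegrable θ) {f : M → M} (hf : Continuous f) (p : M) :
    ∫ y in (chartAt E6 p).target, (chartWeight o ρ p y : ℂ) * θ p y =
      ∑ q ∈ partitionIndices ρ', ∫ y in chartOverlap f p q,
        (ρ' q (f ((chartAt E6 p).symm y)) : ℂ) * ((chartWeight o ρ p y : ℂ) * θ p y) := by
  have hmeas := (chartAt E6 p).open_target.measurableSet
  have hint := integrableOn_chartWeight_mul hρ o hθ p
  have h1 : ∀ y, (chartWeight o ρ p y : ℂ) * θ p y = ∑ q ∈ partitionIndices ρ',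
      (ρ' q (f ((chartAt E6 p).symm y)) : ℂ) * ((chartWeight o ρ p y : ℂ) * θ p y) := by
    intro y
    rw [← Finset.sum_mul, ← Complex.ofReal_sum, sum_partitionIndices, Complex.ofReal_one, one_mul]
  rw [integral_congr_ae (ae_of_all _ h1), integral_finsetSum]
  · refine Finset.sum_congr rfl fun q _ => ?_
    refine setIntegral_eq_of_subset_of_forall_sdiff_eq_zero hmeas inter_subset_left fun y hy => ?_
    have h2 : ρ' q (f ((chartAt E6 p).symm y)) = 0 := by
      by_contra hne
      exact hy.2 ⟨hy.1, hρ' q (subset_tsupport _ hne)⟩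
    rw [h2, Complex.ofReal_zero, zero_mul]
  · intro q _
    refine hint.bdd_mul (c := 1) (ContinuousOn.aestronglyMeasurable ?_ hmeas)
      (ae_of_all _ fun y => ?_)
    · exact Complex.continuous_ofReal.comp_continuousOn
        (((ρ' q).contMDiff.continuous.comp hf).comp_continuousOn (chartAt E6 p).continuousOn_symm)
    · rw [Complex.norm_real, Real.norm_eq_abs, abs_of_nonneg (ρ'.nonneg _ _)]
      exact ρ'.le_one _ _

variable [IsManifold (𝓡 6) ∞ M]

/-- Change of variables under an orientation-preserving diffeomorphism. -/
theorem chartIntegral_eq_of_pullback {o : ManifoldOrientation M}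
    {f : Diffeomorph (𝓡 6) (𝓡 6) M M ∞} (hf : PreservesOrientation o f)
    (hρ : ρ.IsSubordinate fun p => (chartAt E6 p).source)
    (hρ' : ρ'.IsSubordinate fun p => (chartAt E6 p).source)
    (hθ : IsLocallyIntegrable θ) (hθ' : IsLocallyIntegrable θ')
    (h : ∀ p q, ∀ᵐ y, y ∈ chartOverlap f p q →
      θ' p y = (fderiv ℝ (chartTransition f p q) y).det * θ q (chartTransition f p q y)) :
    chartIntegral o ρ θ' = chartIntegral o ρ' θ := by
  rw [chartIntegral_eq_sum, chartIntegral_eq_sum]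
  simp_rw [setIntegral_chartWeight_eq_sum hρ hρ' o hθ' f.continuous,
    setIntegral_chartWeight_eq_sum hρ' hρ o hθ f.symm.continuous]
  -- Both integrals are now double sums over pairs of charts, and the terms for each pair are
  -- matched by the transition map.
  rw [Finset.sum_comm]
  refine Finset.sum_congr rfl fun q _ => Finset.sum_congr rfl fun p _ => ?_
  have hT := smoothTransition_chartTransition f p q
  rw [hT.setIntegral_eq]
  refine setIntegral_congr_ae hT.isOpen_source.measurableSet ?_
  filter_upwards [h p q] with y hy hyo
  rw [hy hyo, chartWeight_eq, chartWeight_eq, hf.chartSign_eq hyo,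
    chartAt_symm_chartTransition f hyo, f.symm_apply_apply, Complex.real_smul,
    ← self_mul_sign (fderiv ℝ (chartTransition f p q) y).det]
  push_cast
  ring

end ChartIntegrals

/-! ### The class L⁶₁ on the manifold. -/

section SobolevClass

theorem memLp_of_continuousOn_of_isCompact {X : Type*} [NormedAddCommGroup X]
    {g : E6 → X} {K : Set E6} (hg : ContinuousOn g K) (hK : IsCompact K) (r : ENNReal) :
    MemLp g r (volume.restrict K) := by
  have : IsFiniteMeasure (volume.restrict K) := isFiniteMeasure_restrict.2 hK.measure_lt_top.ne
  obtain ⟨C, hC⟩ := hK.exists_bound_of_continuousOn hg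
  exact MemLp.of_bound (hg.aestronglyMeasurable_of_isCompact hK hK.measurableSet) C
    ((ae_restrict_iff' hK.measurableSet).2 (ae_of_all _ hC))

theorem IsWeakDerivOn.mono {Ω Ω' : Set E6} {f : E6 → E6 →L[ℝ] E6}
    {D : E6 → E6 →L[ℝ] E6 →L[ℝ] E6} (h : IsWeakDerivOn Ω f D) (hΩ : Ω' ⊆ Ω) :
    IsWeakDerivOn Ω' f D :=
  ⟨h.1.mono_set hΩ, h.2.1.mono_set hΩ, fun φ hφ hc hs => h.2.2 φ hφ hc (hs.trans hΩ)⟩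

variable {M : Type*} [TopologicalSpace M] [ChartedSpace E6 M] [IsManifold (𝓡 6) ∞ M]

theorem ComplexField.ae_mem_complexJets (J : ComplexField M) {p : M} {K : Set E6}
    (hK : K ⊆ (chartAt E6 p).target) (hKm : MeasurableSet K) (D : E6 → E6 →L[ℝ] E6 →L[ℝ] E6) :
    ∀ᵐ y ∂volume.restrict K, (J.inChart p y, D y) ∈ complexJets :=
  (ae_restrict_iff' hKm).2 (ae_of_all _ fun _ hy => J.inChart_sq (hK hy))

/-- The coefficients of the Lagrangian evaluated on `J` and a derivative `D` of `J`. -/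
def lagrangianCoefficient (c₁ c₂ : ℂ) (J : ComplexField M) (D : M → E6 → E6 →L[ℝ] E6 →L[ℝ] E6)
    (p : M) (y : E6) : ℂ :=
  lagrangian c₁ c₂ (J.inChart p y, D p y)

theorem ComplexField.MemL61.isLocallyIntegrable {J : ComplexField M} (hJ : J.MemL61)
    {D : M → E6 → E6 →L[ℝ] E6 →L[ℝ] E6} (hD : J.IsL6Deriv D) (c₁ c₂ : ℂ) :
    IsLocallyIntegrable (lagrangianCoefficient c₁ c₂ J D) := fun p K hKp hK =>
  integrable_lagrangian c₁ c₂ (hJ.1 p K hKp hK) ((hD p).2 K hKp hK)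
    (J.ae_mem_complexJets hKp hK.measurableSet _)

theorem IsPullback.ae_lagrangianCoefficient_eq {f : Diffeomorph (𝓡 6) (𝓡 6) M M ∞}
    {J J' : ComplexField M} (h : IsPullback f J J') {D D' : M → E6 → E6 →L[ℝ] E6 →L[ℝ] E6}
    (hD : J.IsL6Deriv D) (hD' : J'.IsL6Deriv D') (c₁ c₂ : ℂ) (p q : M) :
    ∀ᵐ y, y ∈ chartOverlap f p q → lagrangianCoefficient c₁ c₂ J' D' p y =
      (fderiv ℝ (chartTransition f p q) y).det *
        lagrangianCoefficient c₁ c₂ J D q (chartTransition f p q y) :=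
  (smoothTransition_chartTransition f p q).ae_lagrangian_eq c₁ c₂
    (fun _ hz => J'.inChart_sq hz.1) (fun _ hz => J.inChart_sq hz.1)
    (fun _ hz => h.fderiv_inChart p q hz) ((hD' p).1.mono inter_subset_left)
    ((hD q).1.mono inter_subset_left)

theorem ComplexField.IsSmooth.isL6Deriv {J : ComplexField M} (hJ : J.IsSmooth) :
    J.IsL6Deriv fun p => fderiv ℝ (J.inChart p) := fun p => by
  have hc := hJ.contDiffOn_inChart p
  refine ⟨isWeakDerivOn_fderiv (chartAt E6 p).open_target hc, fun K hKp hK => ?_⟩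
  exact memLp_of_continuousOn_of_isCompact ((hc.continuousOn_fderiv_of_isOpen
    (chartAt E6 p).open_target (by simp)).mono hKp) hK 6

theorem ComplexField.IsSmooth.memL61 {J : ComplexField M} (hJ : J.IsSmooth) : J.MemL61 :=
  ⟨fun p _ hKp hK => memLp_of_continuousOn_of_isCompact
    ((hJ.contDiffOn_inChart p).continuousOn.mono hKp) hK ⊤,
    _, hJ.isL6Deriv⟩

variable [CompactSpace M] {ρ ρ' : SmoothPartitionOfUnity M (𝓡 6) M univ}

theorem IsPullback.chartIntegral_eq {o : ManifoldOrientation M}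
    {f : Diffeomorph (𝓡 6) (𝓡 6) M M ∞} (hf : PreservesOrientation o f) {J J' : ComplexField M}
    (h : IsPullback f J J') (hJ : J.MemL61) (hJ' : J'.MemL61)
    {D D' : M → E6 → E6 →L[ℝ] E6 →L[ℝ] E6} (hD : J.IsL6Deriv D) (hD' : J'.IsL6Deriv D')
    (hρ : ρ.IsSubordinate fun p => (chartAt E6 p).source)
    (hρ' : ρ'.IsSubordinate fun p => (chartAt E6 p).source) (c₁ c₂ : ℂ) :
    chartIntegral o ρ (lagrangianCoefficient c₁ c₂ J' D') =
      chartIntegral o ρ' (lagrangianCoefficient c₁ c₂ J D) :=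
  chartIntegral_eq_of_pullback hf hρ hρ' (hJ.isLocallyIntegrable hD c₁ c₂)
    (hJ'.isLocallyIntegrable hD' c₁ c₂) (h.ae_lagrangianCoefficient_eq hD hD' c₁ c₂)

/-- Independence of the partition of unity and of the weak derivative is invariance under the
identity, with different partitions and derivatives on the two sides. -/
theorem ComplexField.MemL61.hasIntegral (o : ManifoldOrientation M) {J : ComplexField M}
    (hJ : J.MemL61) {D D' : M → E6 → E6 →L[ℝ] E6 →L[ℝ] E6} (hD : J.IsL6Deriv D)
    (hD' : J.IsL6Deriv D') (hρ : ρ.IsSubordinate fun p => (chartAt E6 p).source) (c₁ c₂ : ℂ) :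
    HasIntegral o (lagrangianCoefficient c₁ c₂ J D)
      (chartIntegral o ρ (lagrangianCoefficient c₁ c₂ J D')) := fun _ hρ' =>
  ⟨integrableOn_chartWeight_mul hρ' o (hJ.isLocallyIntegrable hD c₁ c₂),
    (isPullback_refl J).chartIntegral_eq (preservesOrientation_refl o) hJ hJ hD' hD hρ' hρ c₁ c₂⟩

/-- The integral is a finite sum over compact supports inside the charts, where the local
convergence theorem applies with the chart weights as bounded factors. -/
theorem tendsto_chartIntegral_lagrangianCoefficient (o : ManifoldOrientation M)
    (hρ : ρ.IsSubordinate fun p => (chartAt E6 p).source) (c₁ c₂ : ℂ)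
    {Js : ℕ → ComplexField M} {J : ComplexField M} (hJs : ∀ n, (Js n).MemL61) (hJ : J.MemL61)
    {Ds : ℕ → M → E6 → E6 →L[ℝ] E6 →L[ℝ] E6} {D : M → E6 → E6 →L[ℝ] E6 →L[ℝ] E6}
    (hDs : ∀ n, (Js n).IsL6Deriv (Ds n)) (hD : J.IsL6Deriv D)
    (h : ∀ p : M, ∀ K ⊆ (chartAt E6 p).target, IsCompact K →
      (∃ C : NNReal, ∀ n, eLpNorm ((Js n).inChart p) ⊤ (volume.restrict K) ≤ C) ∧
      Tendsto (fun n => eLpNorm (fun y => (Js n).inChart p y - J.inChart p y) 6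
        (volume.restrict K)) atTop (𝓝 0) ∧
      Tendsto (fun n => eLpNorm (fun y => Ds n p y - D p y) 6 (volume.restrict K))
        atTop (𝓝 0)) :
    Tendsto (fun n => chartIntegral o ρ (lagrangianCoefficient c₁ c₂ (Js n) (Ds n))) atTop
      (𝓝 (chartIntegral o ρ (lagrangianCoefficient c₁ c₂ J D))) := by
  simp_rw [chartIntegral_eq_sum]
  refine tendsto_finsetSum _ fun p _ => ?_
  simp_rw [setIntegral_chartWeight_mul hρ]
  have hK := isCompact_chartSupport hρ p
  have hKp := chartSupport_subset hρ p
  have : IsFiniteMeasure (volume.restrict (chartSupport ρ p)) :=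
    isFiniteMeasure_restrict.2 hK.measure_lt_top.ne
  obtain ⟨⟨R, hR⟩, hJlim, hDlim⟩ := h p _ hKp hK
  exact tendsto_integral_lagrangian c₁ c₂ (fun n => (hJs n).1 p _ hKp hK)
    (fun n => (hDs n p).2 _ hKp hK) (hJ.1 p _ hKp hK) ((hD p).2 _ hKp hK)
    (fun n => (Js n).ae_mem_complexJets hKp hK.measurableSet _)
    (J.ae_mem_complexJets hKp hK.measurableSet _) hR hJlim hDlim
    (((continuousOn_chartWeight o ρ p).mono hKp).aestronglyMeasurable_of_isCompact hK
      hK.measurableSet) (ae_of_all _ (norm_chartWeight_le_one o ρ p))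

end SobolevClass

/-! ### The functional F_c and its extension. -/

section InvariantFunctional

variable {M : Type*} [TopologicalSpace M] [ChartedSpace E6 M] [IsManifold (𝓡 6) ∞ M]
  [CompactSpace M] [T2Space M]

variable (M) in
/-- The partition of unity in the definition of `integralForm`. -/
def somePartition : SmoothPartitionOfUnity M (𝓡 6) M univ :=
  Classical.choose (SmoothPartitionOfUnity.exists_isSubordinate_chartAt_source (𝓡 6) M)

theorem isSubordinate_somePartition :
    (somePartition M).IsSubordinate fun p => (chartAt E6 p).source :=
  Classical.choose_spec (SmoothPartitionOfUnity.exists_isSubordinate_chartAt_source (𝓡 6) M)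

theorem invariantFunctional_eq (o : ManifoldOrientation M) (c₁ c₂ : ℂ)
    (J : AlmostComplexPlus o) : invariantFunctional o c₁ c₂ J =
      chartIntegral o (somePartition M)
        (lagrangianCoefficient c₁ c₂ J.1 fun p => fderiv ℝ (J.1.inChart p)) :=
  chartIntegral_congr o _ fun p _ hy => coefficient_integrandForm J.2.1 c₁ c₂ p hy

theorem hasIntegral_invariantFunctional (o : ManifoldOrientation M) (c₁ c₂ : ℂ)
    (J : AlmostComplexPlus o) :
    HasIntegral o (lagrangianCoefficient c₁ c₂ J.1 fun p => fderiv ℝ (J.1.inChart p))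
      (invariantFunctional o c₁ c₂ J) := by
  rw [invariantFunctional_eq]
  exact J.2.1.memL61.hasIntegral o J.2.1.isL6Deriv J.2.1.isL6Deriv isSubordinate_somePartition
    c₁ c₂

theorem isDiffeomorphismInvariant_invariantFunctional (o : ManifoldOrientation M) (c₁ c₂ : ℂ) :
    IsDiffeomorphismInvariant o (invariantFunctional o c₁ c₂) := by
  intro J J' f hf
  have h : IsPullback f J.1 J'.1 := hf
  rw [invariantFunctional_eq, invariantFunctional_eq]
  exact h.chartIntegral_eq (h.preservesOrientation J.2.2 J'.2.2) J.2.1.memL61 J'.2.1.memL61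
    J.2.1.isL6Deriv J'.2.1.isL6Deriv isSubordinate_somePartition isSubordinate_somePartition c₁ c₂

theorem isOfClassL61_invariantFunctional (o : ManifoldOrientation M) (c₁ c₂ : ℂ) :
    IsOfClassL61 o (lagrangian c₁ c₂) (invariantFunctional o c₁ c₂) := by
  have hρ := isSubordinate_somePartition (M := M)
  -- The extension is defined with an arbitrarily chosen weak derivative; `hasIntegral` then lets
  -- any other one replace it, the classical derivative for smooth J and the given ones along a
  -- convergent sequence.
  refine ⟨fun J => chartIntegral o (somePartition M)
    (lagrangianCoefficient c₁ c₂ J.1 J.2.1.2.choose), fun J D hD => ?_, fun J => ?_,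
    fun Js J ⟨Ds, D, hDs, hD, h⟩ => ?_⟩
  · exact J.2.1.hasIntegral o hD J.2.1.2.choose_spec hρ c₁ c₂
  · refine ⟨J.2.1.memL61, ?_⟩
    exact ((J.2.1.memL61.hasIntegral o J.2.1.isL6Deriv J.2.1.memL61.2.choose_spec hρ c₁ c₂
      _ hρ).2.symm).trans (invariantFunctional_eq o c₁ c₂ J).symm
  · have hlim := tendsto_chartIntegral_lagrangianCoefficient o hρ c₁ c₂ (fun n => (Js n).2.1)
      J.2.1 hDs hD h
    have hJ := (J.2.1.hasIntegral o hD J.2.1.2.choose_spec hρ c₁ c₂ _ hρ).2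
    have hJs := fun n =>
      ((Js n).2.1.hasIntegral o (hDs n) (Js n).2.1.2.choose_spec hρ c₁ c₂ _ hρ).2
    rw [hJ] at hlim
    simp_rw [hJs] at hlim
    exact hlim

end InvariantFunctional

end

theorem mainTheorem6 {M : Type*} [TopologicalSpace M] [ChartedSpace E6 M]
    [IsManifold (𝓡 6) ∞ M] [CompactSpace M] [T2Space M]
    (o : ManifoldOrientation M) (c₁ c₂ : ℂ) :
    (∀ J : AlmostComplexPlus o, FormsWellDefined J.1 ∧
      HasIntegral o (coefficient (integrandForm c₁ c₂ J.1)) (invariantFunctional o c₁ c₂ J)) ∧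
    (c₁.im = 0 → c₂.im = 0 → ∀ J : AlmostComplexPlus o, (invariantFunctional o c₁ c₂ J).im = 0) ∧
    IsDiffeomorphismInvariant o (invariantFunctional o c₁ c₂) ∧
    (∀ J : AlmostComplexPlus o, ∀ p : M, ∀ y ∈ (chartAt E6 p).target,
      coefficient (integrandForm c₁ c₂ J.1) p y =
        lagrangian c₁ c₂ (J.1.inChart p y, fderiv ℝ (J.1.inChart p) y)) ∧
    IsFirstOrder o (lagrangian c₁ c₂) (invariantFunctional o c₁ c₂) ∧
    IsOfClassL61 o (lagrangian c₁ c₂) (invariantFunctional o c₁ c₂) := by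
  refine ⟨fun J => ⟨formsWellDefined J.2.1, ?_⟩, fun h₁ h₂ J => ?_,
    isDiffeomorphismInvariant_invariantFunctional o c₁ c₂,
    fun J p y hy => coefficient_integrandForm J.2.1 c₁ c₂ p hy,
    ⟨contDiffOn_lagrangian c₁ c₂, hasIntegral_invariantFunctional o c₁ c₂⟩,
    isOfClassL61_invariantFunctional o c₁ c₂⟩
  · exact (hasIntegral_invariantFunctional o c₁ c₂ J).congr fun p y hy =>
      (coefficient_integrandForm J.2.1 c₁ c₂ p hy).symm
  · rw [invariantFunctional_eq]
    exact im_chartIntegral_eq_zero o _ fun p y => lagrangian_im h₁ h₂ _
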